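/- **Setting.** Let $V\subset H\subset V^*$ be a Gelfand triple: $H$ is a separable real Hilbert space with norm $|\cdot|$ and inner product $(\cdot,\cdot)$, $V$ is a separable reflexive real Banach space with norm $\|\cdot\|$, and $V$ is continuously, densely and compactly embedded into $H$; $\langle\cdot,\cdot\rangle$ is the pairing of $V^*$ and $V$, and $\langle h,v\rangle=(h,v)$ for $h\in H$, $v\in V$. Let $T>0$, $p\ge 2$, $\frac1p+\frac1q=1$. Let $A:[0,T]\times V\to V^*$ satisfy: $t\mapsto\langle A(t,x),v\rangle$ is measurable for all $x,v\in V$; and, for a.e. $t\in[0,T]$ and all $x,y,v\in V$, $\langle A(t,x)-A(t,y),x-y\rangle\ge 0$, the map $s\mapsto\langle A(t,x+sy),v\rangle$ is continuous on $[0,1]$, $\|A(t,x)\|_*\le a_1(t)+c_1\|x\|^{p-1}$ and $\langle A(t,x),x\rangle\ge c_2\|x\|^p$, where $a_1\in L^q(0,T;\mathbb R_+)$, $c_1\ge 0$, $c_2>0$ do not depend on $t,x$. The space $C([0,T],H)$ carries the supremum norm $\|\cdot\|_\infty$, and $[0,T]\times C([0,T],H)$ carries the pseudometric $\mathbf d_\infty((t_1,x_1),(t_2,x_2))=|t_1-t_2|+\|x_1(\cdot\wedge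 t_1)-x_2(\cdot\wedge t_2)\|_\infty$; continuity and semicontinuity refer to these. For $L\ge 0$ and $(t_0,x_0)\in[0,T)\times C([0,T],H)$, let $\mathcal X^L(t_0,x_0)$ be the set of all $x\in C([0,T],H)$ with $x=x_0$ on $[0,t_0]$, $x\in L^p(t_0,T;V)$ with generalized derivative $x'\in L^q(t_0,T;V^*)$ (we write $x\in W_{pq}(t_0,T)$), and such that some $f^x\in L^2(t_0,T;H)$ satisfies, for a.e. $t\in[t_0,T]$, $x'(t)+A(t,x(t))=f^x(t)$ and $|f^x(t)|\le L(1+\|x(\cdot\wedge t)\|_\infty)$. **Test functions.** For $t_*\in[0,T)$, $\mathcal C^{1,1}_V([t_*,T]\times C([0,T],H))$ is the set of continuous $\varphi:[t_*,T]\times C([0,T],H)\to\mathbb R$ with continuous path derivatives $\partial_t\varphi$ (real-valued) and $\partial_x\varphi$ ($H$-valued) such that (a) if $x(t)\in V$ for a.e. $t\in[t_*,T]$, then $\partial_x\varphi(t,x)\in V$ for a.e. $t\in[t_*,T]$; (b) for all $t_0\in[t_*,T)$, all $x_0,x\in C([0,T],H)$ with $x=x_0$ on $[0,t_0]$ and $x\in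 W_{pq}(t_0,T)$, and all $t\in[t_0,T]$, $$\varphi(t,x)-\varphi(t_0,x_0)=\int_{t_0}^t\bigl(\partial_t\varphi(s,x)+\langle x'(s),\partial_x\varphi(s,x)\rangle\bigr)\,ds,$$ where the integrand is defined a.e. and integrable. For $z\in V$ put $\tilde\varphi^z(t,x)=\int_{t_0}^t\langle A(s,x(s)),z\rangle\,ds$. **Viscosity semisolutions.** For $F:[0,T]\times C([0,T],H)\times H\to\mathbb R$ and $h:C([0,T],H)\to\mathbb R$, consider the problem $P(F,h)$: $$\partial_tu(t,x)-\langle A(t,x(t)),\partial_xu(t,x)\rangle+F(t,x,\partial_xu(t,x))=0\ \ (t<T),\qquad u(T,x)=h(x).$$ Say that $u$ satisfies the subsolution inequality at $(t_0,x_0)$, $t_0<T$, if for all $\varphi\in\mathcal C^{1,1}_V([t_0,T]\times C([0,T],H))$ and $z\in V$ for which some $T_0\in(t_0,T]$ satisfies $$0=(\varphi+\tilde\varphi^z-u)(t_0,x_0)=\inf_{[t_0,T_0]\times\mathcal X^L(t_0,x_0)}(\varphi+\tilde\varphi^z-u),$$ one has $$\partial_t\varphi(t_0,x_0)+\limsup_{\delta\to0^+}\sup_{x\in\mathcal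 X^L(t_0,x_0)}\frac1\delta\int_{t_0}^{t_0+\delta}\langle A(s,x(s)),z-\partial_x\varphi(s,x)\rangle\,ds+F(t_0,x_0,\partial_x\varphi(t_0,x_0))\ge0.$$ The supersolution inequality is obtained by replacing $\inf$, $\limsup\sup$, $\ge$ with $\sup$, $\liminf\inf$, $\le$. A function $u:[0,T]\times C([0,T],H)\to\mathbb R$ is a viscosity $L$-subsolution (resp. $L$-supersolution) of $P(F,h)$ if its restrictions to all sets $[t^*,T]\times\mathcal X^{L^*}(t^*,x^*)$, $(t^*,x^*)\in[0,T)\times C([0,T],H)$, $L^*\ge0$, are upper (resp. lower) semicontinuous, $u(T,x)\le h(x)$ (resp. $\ge$) for all $x\in C([0,T],H)$, and the subsolution (resp. supersolution) inequality holds at all $(t_0,x_0)\in[0,T)\times C([0,T],H)$. A function $u:[t^*,T]\times\mathcal X^L(t^*,x^*)\to\mathbb R$ is a viscosity $L$-subsolution (resp. $L$-supersolution) of $P(F,h)$ on $[t^*,T]\times\mathcal X^L(t^*,x^*)$ if it is upper (resp. lower) semicontinuous, $u(T,x)\le h(x)$ (resp. $\ge$) for all $x\in\mathcal X^L(t^*,x^*)$,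 and the respective inequality holds at all $(t_0,x_0)\in[t^*,T)\times\mathcal X^L(t^*,x^*)$. **Half-relaxed limits.** For real functions $g_n$ on a (pseudo)metric space and a point $y_0$ of a subset $S$ put, in $[-\infty,\infty]$, $$\limsup_{n\to\infty,\ y\to y_0\text{ in }S}g_n(y)=\lim_{n\to\infty}\ \sup\{g_m(y):m\ge n,\ y\in S,\ d(y,y_0)\le 1/n\},$$ and define the $\liminf$ likewise with $\inf$. Let $u^{L,+}_{t^*,x^*}$, $F^{L,+}_{t^*,x^*}$, $h^{L,+}_{t^*,x^*}$ (resp. $u^{L,-}_{t^*,x^*}$, $F^{L,-}_{t^*,x^*}$, $h^{L,-}_{t^*,x^*}$) be the upper (resp. lower) half-relaxed limits so obtained from $u_n$ with $S=[t^*,T]\times\mathcal X^L(t^*,x^*)$, from $F_n$ with $S=[t^*,T]\times\mathcal X^L(t^*,x^*)\times H$, and from $h_n$ with $S=\mathcal X^L(t^*,x^*)$. **Theorem 6.2.** Fix $L\ge0$, and for $n\in\mathbb N$ let $F_n:[0,T]\times C([0,T],H)\times H\to\mathbb R$, $h_n:C([0,T],H)\to\mathbb R$ and $u_n:[0,T]\times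 C([0,T],H)\to\mathbb R$. Suppose: (i) for each $n$, $F_n$ is continuous and $u_n$ is a viscosity $L$-subsolution (resp. $L$-supersolution) of $P(F_n,h_n)$, and $$\sup\{|u_n(t,x)|: n\in\mathbb N,\ (t,x)\in[t^*,T]\times\mathcal X^L(t^*,x^*)\}<\infty\quad\text{for all }(t^*,x^*)\in[0,T)\times C([0,T],H);$$ (ii) $F:[0,T]\times C([0,T],H)\times H\to\mathbb R$ is continuous and, for all $(t^*,x^*)\in[0,T)\times C([0,T],H)$, $F\ge F^{L,+}_{t^*,x^*}$ (resp. $F\le F^{L,-}_{t^*,x^*}$) on $[t^*,T]\times\mathcal X^L(t^*,x^*)\times H$; (iii) $h:C([0,T],H)\to\mathbb R$ is continuous and, for all such $(t^*,x^*)$, $h\ge h^{L,+}_{t^*,x^*}$ (resp. $h\le h^{L,-}_{t^*,x^*}$) on $\mathcal X^L(t^*,x^*)$. Then, for every $(t^*,x^*)\in[0,T)\times C([0,T],H)$, the function $u^{L,+}_{t^*,x^*}$ (resp. $u^{L,-}_{t^*,x^*}$) is real-valued and is a viscosity $L$-subsolution (resp. $L$-supersolution) of $P(F,h)$ on $[t^*,T]\times\mathcal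 X^L(t^*,x^*)$. -/

import Mathlib

open MeasureTheory Filter Topology
open scoped ContDiff

noncomputable section

namespace PathHJ

/-! ### The path space and its pseudometric -/

/-- The space `C([0,T],H)` with the supremum norm. -/
abbrev PathSp (T : ℝ) (H : Type*) [TopologicalSpace H] : Type _ :=
  C(Set.Icc (0 : ℝ) T, H)

/-- The stopped path `x(· ∧ t)`. -/
def stopAt {T : ℝ} {H : Type*} [TopologicalSpace H]
    (t : Set.Icc (0 : ℝ) T) (x : PathSp T H) : PathSp T H :=
  ⟨fun s => x (min s t), x.continuous.comp (continuous_id.min continuous_const)⟩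

/-- The points `(t, x)` of `[0,T] × C([0,T],H)`.  This is a separate type because it carries the
pseudometric `d_∞` below and not the product metric. -/
structure TimePath (T : ℝ) (H : Type*) [TopologicalSpace H] where
  time : Set.Icc (0 : ℝ) T
  path : PathSp T H

/-- `d_∞((t₁,x₁),(t₂,x₂)) = |t₁ - t₂| + ‖x₁(· ∧ t₁) - x₂(· ∧ t₂)‖_∞`. -/
instance {T : ℝ} {H : Type*} [NormedAddCommGroup H] : PseudoMetricSpace (TimePath T H) where
  dist P Q := |(P.time : ℝ) - Q.time| + ‖stopAt P.time P.path - stopAt Q.time Q.path‖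
  dist_self P := by simp
  dist_comm P Q := by rw [abs_sub_comm, norm_sub_rev]
  dist_triangle P Q R := by
    have h1 := abs_sub_le (P.time : ℝ) Q.time R.time
    have h2 := norm_sub_le_norm_sub_add_norm_sub
      (stopAt P.time P.path) (stopAt Q.time Q.path) (stopAt R.time R.path)
    linarith

/-- The time `s ∈ [0,T]` as an element of the subtype (real numbers outside are projected). -/
def clampTime {T : ℝ} [hT : Fact (0 < T)] (s : ℝ) : Set.Icc (0 : ℝ) T :=
  Set.projIcc 0 T hT.out.le s

/-- The value `x(s)` for real `s ∈ [0,T]`. -/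
def pathAt {T : ℝ} [Fact (0 < T)] {H : Type*} [TopologicalSpace H] (x : PathSp T H) (s : ℝ) : H :=
  x (clampTime s)

/-- The point `(s, x)` for real `s ∈ [0,T]`. -/
def pointAt {T : ℝ} [Fact (0 < T)] {H : Type*} [TopologicalSpace H] (s : ℝ) (x : PathSp T H) :
    TimePath T H :=
  ⟨clampTime s, x⟩

/-! ### The Gelfand triple and the operator `A` -/

section Operator

variable {V H : Type*} [NormedAddCommGroup V] [NormedSpace ℝ V]
  [NormedAddCommGroup H] [InnerProductSpace ℝ H]

/-- `V ⊂ H ⊂ V*` with compact embedding `V ⊂ H`, written as a map `ι`; separability and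
completeness of the spaces are type class assumptions. -/
structure IsGelfandTriple (ι : V →L[ℝ] H) : Prop where
  reflexive : Function.Surjective (NormedSpace.inclusionInDoubleDual ℝ V)
  injective : Function.Injective ι
  dense : DenseRange ι
  compact : IsCompactOperator ι

/-- The embedding of `H` into `V*`, with `⟨h, v⟩ = (h, v)`. -/
def toDual (ι : V →L[ℝ] H) (h : H) : StrongDual ℝ V := (innerSL ℝ h).comp ι

/-- An element of `H` that lies in `V`, as an element of `V`
(it is used only for elements of the range of the injective map `ι`). -/
def toV (ι : V →L[ℝ] H) (h : H) : V := Function.invFun ι h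

/-- The hypotheses `H(A)`; only the values of `A` at times in `[0,T]` matter. -/
structure HypA (T p q : ℝ) (A : ℝ → V → StrongDual ℝ V) : Prop where
  measurable : ∀ x v : V, AEMeasurable (fun t => A t x v) (volume.restrict (Set.Icc 0 T))
  monotone : ∀ᵐ t ∂(volume.restrict (Set.Icc 0 T)), ∀ x y : V,
    0 ≤ (A t x - A t y) (x - y)
  hemicontinuous : ∀ᵐ t ∂(volume.restrict (Set.Icc 0 T)), ∀ x y v : V,
    ContinuousOn (fun s : ℝ => A t (x + s • y) v) (Set.Icc 0 1)
  bounded : ∃ (a₁ : ℝ → ℝ) (c₁ : ℝ), (∀ t, 0 ≤ a₁ t) ∧ 0 ≤ c₁ ∧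
    MemLp a₁ (ENNReal.ofReal q) (volume.restrict (Set.Icc 0 T)) ∧
    ∀ᵐ t ∂(volume.restrict (Set.Icc 0 T)), ∀ x : V, ‖A t x‖ ≤ a₁ t + c₁ * ‖x‖ ^ (p - 1)
  coercive : ∃ c₂ : ℝ, 0 < c₂ ∧
    ∀ᵐ t ∂(volume.restrict (Set.Icc 0 T)), ∀ x : V, c₂ * ‖x‖ ^ p ≤ A t x x

end Operator

/-! ### The sets of trajectories, test functions and viscosity semisolutions -/

section Solutions

variable {T : ℝ} [Fact (0 < T)] {V H : Type*} [NormedAddCommGroup V] [NormedSpace ℝ V]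
  [NormedAddCommGroup H] [InnerProductSpace ℝ H]

/-- The restriction of the path `x` to `(t₀,T)` belongs to `W_{pq}(t₀,T)`, and its generalized
derivative is `x' ∈ L^q(t₀,T;V*)`. -/
structure MemW (ι : V →L[ℝ] H) (p q : ℝ) (t₀ : Set.Icc (0 : ℝ) T) (x : PathSp T H)
    (x' : ℝ → StrongDual ℝ V) : Prop where
  mem_range : ∀ᵐ t ∂(volume.restrict (Set.Ioo (t₀ : ℝ) T)), pathAt x t ∈ Set.range ι
  memLp : MemLp (fun t => toV ι (pathAt x t)) (ENNReal.ofReal p)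
    (volume.restrict (Set.Ioo (t₀ : ℝ) T))
  memLp_deriv : MemLp x' (ENNReal.ofReal q) (volume.restrict (Set.Ioo (t₀ : ℝ) T))
  weak_deriv : ∀ η : ℝ → ℝ, ContDiff ℝ ∞ η → HasCompactSupport η →
    tsupport η ⊆ Set.Ioo (t₀ : ℝ) T →
    ∫ t in Set.Ioo (t₀ : ℝ) T, deriv η t • toDual ι (pathAt x t)
      = - ∫ t in Set.Ioo (t₀ : ℝ) T, η t • x' t

/-- The set `𝒳^L(t₀,x₀)`. -/
def trajectories (ι : V →L[ℝ] H) (p q : ℝ) (A : ℝ → V → StrongDual ℝ V) (L : ℝ)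
    (t₀ : Set.Icc (0 : ℝ) T) (x₀ : PathSp T H) : Set (PathSp T H) :=
  {x | (∀ t ≤ t₀, x t = x₀ t) ∧
    ∃ (x' : ℝ → StrongDual ℝ V) (f : ℝ → H), MemW ι p q t₀ x x' ∧
      MemLp f 2 (volume.restrict (Set.Ioo (t₀ : ℝ) T)) ∧
      ∀ᵐ t ∂(volume.restrict (Set.Ioo (t₀ : ℝ) T)),
        x' t + A t (toV ι (pathAt x t)) = toDual ι (f t) ∧
        ‖f t‖ ≤ L * (1 + ‖stopAt (clampTime t) x‖)}

/-- The set `[t₀,T] × 𝒳^L(t₀,x₀)`. -/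
def tube (ι : V →L[ℝ] H) (p q : ℝ) (A : ℝ → V → StrongDual ℝ V) (L : ℝ)
    (t₀ : Set.Icc (0 : ℝ) T) (x₀ : PathSp T H) : Set (TimePath T H) :=
  {P | t₀ ≤ P.time ∧ P.path ∈ trajectories ι p q A L t₀ x₀}

/-- `φ` is in `C_V^{1,1}([t₁,T] × C([0,T],H))` and `dt`, `dx` are its path derivatives
`∂_t φ`, `∂_x φ`.  That the integrand of the functional chain rule is defined almost everywhere
and integrable is part of the chain rule. -/
structure IsC11V (ι : V →L[ℝ] H) (p q : ℝ) (t₁ : Set.Icc (0 : ℝ) T)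
    (φ dt : TimePath T H → ℝ) (dx : TimePath T H → H) : Prop where
  cont : ContinuousOn φ {P | t₁ ≤ P.time}
  cont_dt : ContinuousOn dt {P | t₁ ≤ P.time}
  cont_dx : ContinuousOn dx {P | t₁ ≤ P.time}
  mem_range : ∀ x : PathSp T H,
    (∀ᵐ t ∂(volume.restrict (Set.Icc (t₁ : ℝ) T)), pathAt x t ∈ Set.range ι) →
    ∀ᵐ t ∂(volume.restrict (Set.Icc (t₁ : ℝ) T)), dx (pointAt t x) ∈ Set.range ι
  chain_rule : ∀ t₀ : Set.Icc (0 : ℝ) T, t₁ ≤ t₀ → (t₀ : ℝ) < T →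
    ∀ (x₀ x : PathSp T H) (x' : ℝ → StrongDual ℝ V),
    (∀ t ≤ t₀, x t = x₀ t) → MemW ι p q t₀ x x' →
    (∀ᵐ s ∂(volume.restrict (Set.Icc (t₀ : ℝ) T)), dx (pointAt s x) ∈ Set.range ι) ∧
    IntegrableOn (fun s => dt (pointAt s x) + x' s (toV ι (dx (pointAt s x))))
      (Set.Icc (t₀ : ℝ) T) ∧
    ∀ t : Set.Icc (0 : ℝ) T, t₀ ≤ t →
      φ ⟨t, x⟩ - φ ⟨t₀, x₀⟩
        = ∫ s in (t₀ : ℝ)..t, (dt (pointAt s x) + x' s (toV ι (dx (pointAt s x))))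

/-- The less smooth part `φ̃^z(t,x) = ∫_{t₀}^t ⟨A(s,x(s)), z⟩ ds` of a test function. -/
def tildePhi (ι : V →L[ℝ] H) (A : ℝ → V → StrongDual ℝ V) (z : V)
    (t₀ : Set.Icc (0 : ℝ) T) (P : TimePath T H) : ℝ :=
  ∫ s in (t₀ : ℝ)..P.time, A s (toV ι (pathAt P.path s)) z

/-- The contact condition in the definition of the set of test functions for subsolutions:
`φ + φ̃^z - u` vanishes at `(t₀,x₀)`, and `0` is its infimum over `[t₀,T₀] × 𝒳^L(t₀,x₀)`. -/
def TouchesAbove (ι : V →L[ℝ] H) (p q : ℝ) (A : ℝ → V → StrongDual ℝ V) (L : ℝ)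
    (u : TimePath T H → ℝ) (t₀ : Set.Icc (0 : ℝ) T) (x₀ : PathSp T H)
    (φ : TimePath T H → ℝ) (z : V) : Prop :=
  ∃ T₀ : Set.Icc (0 : ℝ) T, t₀ < T₀ ∧
    φ ⟨t₀, x₀⟩ + tildePhi ι A z t₀ ⟨t₀, x₀⟩ - u ⟨t₀, x₀⟩ = 0 ∧
    IsGLB ((fun P => φ P + tildePhi ι A z t₀ P - u P) ''
      {P | P ∈ tube ι p q A L t₀ x₀ ∧ P.time ≤ T₀}) 0

/-- The contact condition for supersolutions: the same with a supremum. -/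
def TouchesBelow (ι : V →L[ℝ] H) (p q : ℝ) (A : ℝ → V → StrongDual ℝ V) (L : ℝ)
    (u : TimePath T H → ℝ) (t₀ : Set.Icc (0 : ℝ) T) (x₀ : PathSp T H)
    (φ : TimePath T H → ℝ) (z : V) : Prop :=
  ∃ T₀ : Set.Icc (0 : ℝ) T, t₀ < T₀ ∧
    φ ⟨t₀, x₀⟩ + tildePhi ι A z t₀ ⟨t₀, x₀⟩ - u ⟨t₀, x₀⟩ = 0 ∧
    IsLUB ((fun P => φ P + tildePhi ι A z t₀ P - u P) ''
      {P | P ∈ tube ι p q A L t₀ x₀ ∧ P.time ≤ T₀}) 0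

/-- `δ⁻¹ ∫_{t₀}^{t₀+δ} (⟨A(s,x(s)), z⟩ - ⟨A(s,x(s)), ∂_x φ(s,x)⟩) ds`. -/
def meanTerm (ι : V →L[ℝ] H) (A : ℝ → V → StrongDual ℝ V) (z : V) (dx : TimePath T H → H)
    (t₀ : Set.Icc (0 : ℝ) T) (x : PathSp T H) (δ : ℝ) : ℝ :=
  δ⁻¹ * ∫ s in (t₀ : ℝ)..(t₀ + δ),
    (A s (toV ι (pathAt x s)) z - A s (toV ι (pathAt x s)) (toV ι (dx (pointAt s x))))

/-- The viscosity inequality for subsolutions at `(t₀,x₀)`, for all test functions;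
the upper limit is taken in the extended reals. -/
def SubInequalityAt (ι : V →L[ℝ] H) (p q : ℝ) (A : ℝ → V → StrongDual ℝ V) (L : ℝ)
    (F : TimePath T H × H → ℝ) (u : TimePath T H → ℝ)
    (t₀ : Set.Icc (0 : ℝ) T) (x₀ : PathSp T H) : Prop :=
  ∀ (φ dt : TimePath T H → ℝ) (dx : TimePath T H → H) (z : V),
    IsC11V ι p q t₀ φ dt dx → TouchesAbove ι p q A L u t₀ x₀ φ z →
    (0 : EReal) ≤ ((dt ⟨t₀, x₀⟩ : ℝ) : EReal)
      + limsup (fun δ : ℝ => ⨆ x ∈ trajectories ι p q A L t₀ x₀,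
          ((meanTerm ι A z dx t₀ x δ : ℝ) : EReal)) (𝓝[>] (0 : ℝ))
      + ((F (⟨t₀, x₀⟩, dx ⟨t₀, x₀⟩) : ℝ) : EReal)

/-- The viscosity inequality for supersolutions at `(t₀,x₀)`, for all test functions. -/
def SuperInequalityAt (ι : V →L[ℝ] H) (p q : ℝ) (A : ℝ → V → StrongDual ℝ V) (L : ℝ)
    (F : TimePath T H × H → ℝ) (u : TimePath T H → ℝ)
    (t₀ : Set.Icc (0 : ℝ) T) (x₀ : PathSp T H) : Prop :=
  ∀ (φ dt : TimePath T H → ℝ) (dx : TimePath T H → H) (z : V),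
    IsC11V ι p q t₀ φ dt dx → TouchesBelow ι p q A L u t₀ x₀ φ z →
    ((dt ⟨t₀, x₀⟩ : ℝ) : EReal)
      + liminf (fun δ : ℝ => ⨅ x ∈ trajectories ι p q A L t₀ x₀,
          ((meanTerm ι A z dx t₀ x δ : ℝ) : EReal)) (𝓝[>] (0 : ℝ))
      + ((F (⟨t₀, x₀⟩, dx ⟨t₀, x₀⟩) : ℝ) : EReal) ≤ (0 : EReal)

/-- The terminal time `T` as an element of `[0,T]`. -/
def finalTime : Set.Icc (0 : ℝ) T := clampTime T

/-- Viscosity `L`-subsolutions on `[0,T] × C([0,T],H)`. -/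
structure IsViscositySub (ι : V →L[ℝ] H) (p q : ℝ) (A : ℝ → V → StrongDual ℝ V) (L : ℝ)
    (F : TimePath T H × H → ℝ) (h : PathSp T H → ℝ) (u : TimePath T H → ℝ) : Prop where
  semicont : ∀ (t₁ : Set.Icc (0 : ℝ) T) (x₁ : PathSp T H) (L₁ : ℝ), (t₁ : ℝ) < T → 0 ≤ L₁ →
    UpperSemicontinuousOn u (tube ι p q A L₁ t₁ x₁)
  terminal : ∀ x : PathSp T H, u ⟨finalTime, x⟩ ≤ h x
  interior : ∀ (t₀ : Set.Icc (0 : ℝ) T) (x₀ : PathSp T H), (t₀ : ℝ) < T →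
    SubInequalityAt ι p q A L F u t₀ x₀

/-- Viscosity `L`-supersolutions on `[0,T] × C([0,T],H)`. -/
structure IsViscositySuper (ι : V →L[ℝ] H) (p q : ℝ) (A : ℝ → V → StrongDual ℝ V) (L : ℝ)
    (F : TimePath T H × H → ℝ) (h : PathSp T H → ℝ) (u : TimePath T H → ℝ) : Prop where
  semicont : ∀ (t₁ : Set.Icc (0 : ℝ) T) (x₁ : PathSp T H) (L₁ : ℝ), (t₁ : ℝ) < T → 0 ≤ L₁ →
    LowerSemicontinuousOn u (tube ι p q A L₁ t₁ x₁)
  terminal : ∀ x : PathSp T H, h x ≤ u ⟨finalTime, x⟩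
  interior : ∀ (t₀ : Set.Icc (0 : ℝ) T) (x₀ : PathSp T H), (t₀ : ℝ) < T →
    SuperInequalityAt ι p q A L F u t₀ x₀

/-- Viscosity `L`-subsolutions on `[t₁,T] × 𝒳^L(t₁,x₁)`; values of `u` elsewhere play no role. -/
structure IsViscositySubOn (ι : V →L[ℝ] H) (p q : ℝ) (A : ℝ → V → StrongDual ℝ V) (L : ℝ)
    (F : TimePath T H × H → ℝ) (h : PathSp T H → ℝ)
    (t₁ : Set.Icc (0 : ℝ) T) (x₁ : PathSp T H) (u : TimePath T H → ℝ) : Prop where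
  semicont : UpperSemicontinuousOn u (tube ι p q A L t₁ x₁)
  terminal : ∀ x ∈ trajectories ι p q A L t₁ x₁, u ⟨finalTime, x⟩ ≤ h x
  interior : ∀ (t₀ : Set.Icc (0 : ℝ) T), t₁ ≤ t₀ → (t₀ : ℝ) < T →
    ∀ x₀ ∈ trajectories ι p q A L t₁ x₁, SubInequalityAt ι p q A L F u t₀ x₀

/-- Viscosity `L`-supersolutions on `[t₁,T] × 𝒳^L(t₁,x₁)`. -/
structure IsViscositySuperOn (ι : V →L[ℝ] H) (p q : ℝ) (A : ℝ → V → StrongDual ℝ V) (L : ℝ)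
    (F : TimePath T H × H → ℝ) (h : PathSp T H → ℝ)
    (t₁ : Set.Icc (0 : ℝ) T) (x₁ : PathSp T H) (u : TimePath T H → ℝ) : Prop where
  semicont : LowerSemicontinuousOn u (tube ι p q A L t₁ x₁)
  terminal : ∀ x ∈ trajectories ι p q A L t₁ x₁, h x ≤ u ⟨finalTime, x⟩
  interior : ∀ (t₀ : Set.Icc (0 : ℝ) T), t₁ ≤ t₀ → (t₀ : ℝ) < T →
    ∀ x₀ ∈ trajectories ι p q A L t₁ x₁, SuperInequalityAt ι p q A L F u t₀ x₀

end Solutions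

/-! ### Half-relaxed limits -/

/-- The upper half-relaxed limit of `(g n)` at `y₀`: the upper limit of `g n y`, in the extended
reals, as `n → ∞` and `y → y₀` in `S` jointly. -/
def upperRelaxed {Y : Type*} [TopologicalSpace Y] (S : Set Y) (g : ℕ → Y → ℝ) (y₀ : Y) : EReal :=
  limsup (fun k : ℕ × Y => ((g k.1 k.2 : ℝ) : EReal)) (atTop ×ˢ 𝓝[S] y₀)

/-- The lower half-relaxed limit of `(g n)` at `y₀`. -/
def lowerRelaxed {Y : Type*} [TopologicalSpace Y] (S : Set Y) (g : ℕ → Y → ℝ) (y₀ : Y) : EReal :=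
  liminf (fun k : ℕ × Y => ((g k.1 k.2 : ℝ) : EReal)) (atTop ×ˢ 𝓝[S] y₀)

end PathHJ

end

noncomputable section

namespace PathHJ

set_option linter.unusedSectionVars false

/-! ### Weak derivatives and integral formulas -/

/-! The theorem is the half-relaxed limit method of Barles and Perthame. On the infinite-dimensional
path space that method needs two facts, and most of the work goes into them: the set `trajectories ι
p q A L t₀ x₀` is compact for the supremum norm, and the unsmooth part `tildePhi` of the test
functionals is continuous on the tube of trajectories.

Compactness. The energy identity and Gronwall's lemma bound all trajectories in the supremum norm
and in L^p(V) (`exists_apriori_bound`). Along a subsequence the sources converge weakly in L² and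
the terms A(t, x_n) converge weakly as functionals on L^p(V). The equation then forces (x_n(t), e)
to converge for every t and every e in H. Compactness of V in H upgrades this to convergence in
L¹(H) (`exists_integral_norm_sub_le`), and monotonicity of A upgrades L¹ to uniform convergence
(`cauchySeq_of_weak`). Minty's argument identifies the weak limit of A(t, x_n), so the limit is
again a trajectory (`IsSol.of_tendsto`).

Continuity of `tildePhi` comes from the equation as well: by `IsSol.integral_A` the integral of
⟨A(s,x(s)), z⟩ equals an integral of (f, z) minus an increment of (x, z), in which A no longer
occurs.

Viscosity part. It is enough to test with the functionals κ t + (x(t), z) + `tildePhi`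
(`subInequalityAt_of_affine`). A general test function that violated the inequality could be
replaced near the contact point by such a functional, because V is dense in H and trajectories leave
their common initial path uniformly slowly. For these functionals the mean term vanishes and the
inequality reads 0 ≤ κ + F(t₀, x₀, z).

Stability. Suppose w - Θ is maximal at (t₀, x₀) over its tube, where Θ is affine with slope κ.
Raising κ to κ + ε makes the maximum strict in time. No strictness in the path is needed: all
trajectories in the tube agree with x₀ up to t₀, and d_∞ does not separate them at time t₀. Hence
maximizers of u_k - Θ over tubes that start at points realizing the half-relaxed limit converge to
(t₀, x₀) (`exists_maximizers`). By concatenation of trajectories each maximizer is maximal over its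
own tube, so the inequality for u_k holds there and passes to the limit. At t₀ = T a very negative
slope forces the maximizers to the final time, where the terminal condition applies. Supersolutions
follow from the reflection u ↦ -u, F(t,x,v) ↦ -F(t,x,-v). -/

lemma exists_Ioo_of_isCompact_subset_Ioo {a b : ℝ} (hab : a < b) {K : Set ℝ} (hK : IsCompact K)
    (hKab : K ⊆ Set.Ioo a b) : ∃ α β, a < α ∧ α < β ∧ β < b ∧ K ⊆ Set.Ioo α β := by
  rcases K.eq_empty_or_nonempty with rfl | hne
  · exact ⟨(2 * a + b) / 3, (a + 2 * b) / 3, by linarith, by linarith, by linarith, by simp⟩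
  · have h1 := hKab (hK.sInf_mem hne)
    have h2 := hKab (hK.sSup_mem hne)
    have h3 : sInf K ≤ sSup K := Real.sInf_le_sSup K hK.bddBelow hK.bddAbove
    refine ⟨(a + sInf K) / 2, (sSup K + b) / 2, by linarith [h1.1], by linarith [h1.1, h2.2],
      by linarith [h2.2], fun x hx => ⟨?_, ?_⟩⟩
    · linarith [csInf_le hK.bddBelow hx, h1.1]
    · linarith [le_csSup hK.bddAbove hx, h2.2]

/-- The primitive started to the left of the support vanishes again to its right because the total
integral is zero, so it is itself a test function. -/
lemma exists_primitive_of_integral_eq_zero {a b : ℝ} (hab : a < b) {ψ : ℝ → ℝ}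
    (hψ : ContDiff ℝ ∞ ψ) (hc : HasCompactSupport ψ) (hs : tsupport ψ ⊆ Set.Ioo a b)
    (h0 : ∫ t, ψ t = 0) :
    ∃ η : ℝ → ℝ, ContDiff ℝ ∞ η ∧ HasCompactSupport η ∧ tsupport η ⊆ Set.Ioo a b ∧
      deriv η = ψ := by
  obtain ⟨α, β, haα, hαβ, hβb, hK⟩ := exists_Ioo_of_isCompact_subset_Ioo hab hc hs
  have hout : ∀ r, r ∉ Set.Ioo α β → ψ r = 0 := fun r hr =>
    image_eq_zero_of_notMem_tsupport fun h => hr (hK h)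
  have hd : ∀ t, HasDerivAt (fun t => ∫ r in α..t, ψ r) (ψ t) t := fun t =>
    hψ.continuous.integral_hasStrictDerivAt α t |>.hasDerivAt
  have hder : deriv (fun t => ∫ r in α..t, ψ r) = ψ := funext fun t => (hd t).deriv
  have hsupp : tsupport (fun t => ∫ r in α..t, ψ r) ⊆ Set.Icc α β := by
    refine closure_minimal (fun t ht => ?_) isClosed_Icc
    by_contra hcon
    apply ht
    simp only [Set.mem_Icc, not_and_or, not_le] at hcon
    rcases hcon with hlt | hlt
    · show ∫ r in α..t, ψ r = 0
      rw [intervalIntegral.integral_symm, neg_eq_zero]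
      refine intervalIntegral.integral_zero_ae (Eventually.of_forall fun r hr => hout r ?_)
      rw [Set.uIoc_of_le hlt.le] at hr
      exact fun h => absurd h.1 (not_lt.2 hr.2)
    · show ∫ r in α..t, ψ r = 0
      rw [intervalIntegral.integral_of_le (by linarith), setIntegral_eq_integral_of_forall_compl_eq_zero, h0]
      intro r hr
      refine hout r fun h => hr ⟨h.1, by linarith [h.2]⟩
  refine ⟨_, ?_, ?_, hsupp.trans (Set.Icc_subset_Ioo haα hβb), hder⟩
  · rw [contDiff_infty_iff_deriv, hder]
    exact ⟨fun t => (hd t).differentiableAt, hψ⟩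
  · exact HasCompactSupport.of_support_subset_isCompact isCompact_Icc
      ((subset_tsupport _).trans hsupp)

lemma exists_bump_Ioo {a b : ℝ} (hab : a < b) :
    ∃ ρ : ℝ → ℝ, ContDiff ℝ ∞ ρ ∧ HasCompactSupport ρ ∧ tsupport ρ ⊆ Set.Ioo a b ∧
      ∫ t, ρ t = 1 := by
  let f : ContDiffBump ((a + b) / 2) := ⟨(b - a) / 8, (b - a) / 4, by linarith, by linarith⟩
  refine ⟨f.normed volume, f.contDiff_normed, f.hasCompactSupport_normed, ?_, f.integral_normed⟩
  rw [f.tsupport_normed_eq, Real.closedBall_eq_Icc]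
  exact Set.Icc_subset_Ioo (by simp [f]; linarith) (by simp [f]; linarith)

/-- A continuous function with vanishing weak derivative is constant. -/
lemma const_of_weak_deriv_zero {a b : ℝ} (hab : a < b) {G : ℝ → ℝ}
    (hG : ContinuousOn G (Set.Icc a b))
    (h : ∀ η : ℝ → ℝ, ContDiff ℝ ∞ η → HasCompactSupport η → tsupport η ⊆ Set.Ioo a b →
      ∫ t in Set.Ioo a b, deriv η t * G t = 0) :
    ∃ c, ∀ t ∈ Set.Icc a b, G t = c := by
  obtain ⟨ρ, hρ, hρc, hρs, hρ1⟩ := exists_bump_Ioo hab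
  set c := ∫ t in Set.Ioo a b, ρ t * G t with hcdef
  have hGi : IntegrableOn G (Set.Ioo a b) := (hG.integrableOn_Icc).mono_set Set.Ioo_subset_Icc_self
  have hint : ∀ ψ : ℝ → ℝ, ContDiff ℝ ∞ ψ → HasCompactSupport ψ →
      IntegrableOn (fun t => ψ t * G t) (Set.Ioo a b) := fun ψ h1 h2 => by
    obtain ⟨C, hC⟩ := h2.exists_bound_of_continuous h1.continuous
    exact hGi.bdd_mul h1.continuous.aestronglyMeasurable (Eventually.of_forall hC)
  have key : ∀ᵐ t ∂volume, t ∈ Set.Ioo a b → G t - c = 0 := by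
    refine isOpen_Ioo.ae_eq_zero_of_integral_contDiff_smul_eq_zero ?_ fun ψ hψ hψc hψs => ?_
    · exact (hG.sub continuousOn_const).mono Set.Ioo_subset_Icc_self |>.locallyIntegrableOn
        measurableSet_Ioo
    -- The du Bois-Reymond argument: subtracting from ψ its mass times the bump ρ leaves a function
    -- of mean zero, hence the derivative of a test function, which the hypothesis annihilates.
    · set m := ∫ t, ψ t
      have hψi : Integrable ψ := hψ.continuous.integrable_of_hasCompactSupport hψc
      have hρi : Integrable ρ := hρ.continuous.integrable_of_hasCompactSupport hρc
      have hsup : tsupport (fun t => ψ t - m * ρ t) ⊆ tsupport ψ ∪ tsupport ρ := by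
        refine closure_minimal (fun t ht => ?_) ((isClosed_tsupport _).union (isClosed_tsupport _))
        by_contra hcon
        simp only [Set.mem_union, not_or] at hcon
        exact ht (by simp [image_eq_zero_of_notMem_tsupport hcon.1,
          image_eq_zero_of_notMem_tsupport hcon.2])
      obtain ⟨η, h1, h2, h3, h4⟩ := exists_primitive_of_integral_eq_zero hab
        (ψ := fun t => ψ t - m * ρ t) (hψ.sub (contDiff_const.mul hρ))
        (HasCompactSupport.of_support_subset_isCompact (hψc.isCompact.union hρc.isCompact)
          ((subset_tsupport _).trans hsup))
        (hsup.trans (Set.union_subset hψs hρs))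
        (by rw [integral_sub hψi (hρi.const_mul m), integral_const_mul, hρ1]; simp [m])
      have h5 := h η h1 h2 h3
      rw [h4] at h5
      have h6 : ∫ t in Set.Ioo a b, (ψ t - m * ρ t) * G t
          = (∫ t in Set.Ioo a b, ψ t * G t) - m * c := by
        rw [hcdef, ← integral_const_mul, ← integral_sub (hint ψ hψ hψc)
          ((hint ρ hρ hρc).const_mul m)]
        congr 1; ext t; ring
      have h7 : ∫ t, ψ t • (G t - c) = ∫ t in Set.Ioo a b, ψ t • (G t - c) := by
        rw [setIntegral_eq_integral_of_forall_compl_eq_zero]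
        intro t ht
        rw [image_eq_zero_of_notMem_tsupport fun h => ht (hψs h), zero_smul]
      have h8 : ∫ t in Set.Ioo a b, ψ t = m := by
        rw [setIntegral_eq_integral_of_forall_compl_eq_zero]
        intro t ht
        rw [image_eq_zero_of_notMem_tsupport fun h => ht (hψs h)]
      have h9 : ∫ t in Set.Ioo a b, ψ t • (G t - c) = (∫ t in Set.Ioo a b, ψ t * G t) - m * c := by
        simp only [smul_eq_mul, mul_sub]
        rw [integral_sub (hint ψ hψ hψc) (hψi.integrableOn.mul_const c), integral_mul_const, h8]
      rw [h7, h9, ← h6, h5]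
  refine ⟨c, ?_⟩
  have hcl : Set.EqOn G (fun _ => c) (Set.Ioo a b) := by
    refine Measure.eqOn_open_of_ae_eq (μ := volume) ?_ isOpen_Ioo
      (hG.mono Set.Ioo_subset_Icc_self) continuousOn_const
    rw [EventuallyEq, ae_restrict_iff' measurableSet_Ioo]
    filter_upwards [key] with t ht h
    linarith [ht h]
  have := hcl.of_subset_closure hG continuousOn_const Set.Ioo_subset_Icc_self
    (by rw [closure_Ioo hab.ne])
  exact this

/-- A continuous function with integrable weak derivative is a primitive of it. -/
lemma sub_eq_integral_of_weak_deriv {a b : ℝ} {g k : ℝ → ℝ} (hg : ContinuousOn g (Set.Icc a b))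
    (hk : IntegrableOn k (Set.Ioo a b))
    (h : ∀ η : ℝ → ℝ, ContDiff ℝ ∞ η → HasCompactSupport η → tsupport η ⊆ Set.Ioo a b →
      ∫ t in Set.Ioo a b, deriv η t * g t = - ∫ t in Set.Ioo a b, η t * k t)
    {s t : ℝ} (hs : s ∈ Set.Icc a b) (ht : t ∈ Set.Icc a b) :
    g t - g s = ∫ r in s..t, k r := by
  rcases (hs.1.trans hs.2).eq_or_lt with rfl | hab
  · obtain rfl : s = a := le_antisymm hs.2 hs.1
    obtain rfl : t = s := le_antisymm ht.2 ht.1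
    simp
  have hki : IntervalIntegrable k volume a b := by
    rw [intervalIntegrable_iff_integrableOn_Ioo_of_le hab.le]; exact hk
  have hsub : ∀ {x y}, x ∈ Set.Icc a b → y ∈ Set.Icc a b → IntervalIntegrable k volume x y :=
    fun hx hy => hki.mono_set (by
      rw [Set.uIcc_of_le hab.le]; exact Set.uIcc_subset_Icc hx hy)
  have hac := hki.absolutelyContinuousOnInterval_intervalIntegral (c := a) (by simp)
  have hPc : ContinuousOn (fun t => ∫ r in a..t, k r) (Set.Icc a b) := by
    have := hac.continuousOn
    rwa [Set.uIcc_of_le hab.le] at this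
  -- The primitive of `k` is only absolutely continuous. Integration by parts for such functions
  -- shows that its weak derivative is `k`, so that `g` minus the primitive has weak derivative
  -- zero.
  obtain ⟨c, hc⟩ := const_of_weak_deriv_zero hab (G := fun t => g t - ∫ r in a..t, k r)
    (hg.sub hPc) fun η h1 h2 h3 => by
      have hηac : AbsolutelyContinuousOnInterval η a b :=
        ContDiffOn.absolutelyContinuousOnInterval ((h1.of_le (by simp)).contDiffOn)
      have hηa : η a = 0 := image_eq_zero_of_notMem_tsupport fun h => absurd (h3 h).1 (lt_irrefl a)
      have hηb : η b = 0 := image_eq_zero_of_notMem_tsupport fun h => absurd (h3 h).2 (lt_irrefl b)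
      have hparts := hηac.integral_mul_deriv_eq_deriv_mul hac
      have hk' : ∫ x in a..b, η x * deriv (fun t => ∫ r in a..t, k r) x
          = ∫ x in a..b, η x * k x := by
        refine intervalIntegral.integral_congr_ae ?_
        filter_upwards [hki.ae_hasDerivAt_integral] with x hx hx'
        rw [(hx (Set.uIoc_subset_uIcc hx') a (by simp)).deriv]
      rw [hk', hηa, hηb] at hparts
      simp only [intervalIntegral.integral_of_le hab.le, integral_Ioc_eq_integral_Ioo] at hparts
      have hdc : Continuous (deriv η) := h1.continuous_deriv (by simp)
      obtain ⟨C, hC⟩ := (h2.deriv).exists_bound_of_continuous hdc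
      have i1 : IntegrableOn (fun t => deriv η t * g t) (Set.Ioo a b) :=
        ((hg.integrableOn_Icc).mono_set Set.Ioo_subset_Icc_self).bdd_mul
          hdc.aestronglyMeasurable (Eventually.of_forall hC)
      have i2 : IntegrableOn (fun t => deriv η t * ∫ r in a..t, k r) (Set.Ioo a b) :=
        ((hPc.integrableOn_Icc).mono_set Set.Ioo_subset_Icc_self).bdd_mul
          hdc.aestronglyMeasurable (Eventually.of_forall hC)
      simp only [mul_sub]
      rw [integral_sub i1 i2, h η h1 h2 h3]
      linarith
  have e1 := hc s hs
  have e2 := hc t ht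
  rw [← intervalIntegral.integral_add_adjacent_intervals (hsub hs ⟨le_rfl, hab.le⟩)
    (hsub ⟨le_rfl, hab.le⟩ ht), intervalIntegral.integral_symm a s]
  linarith

/-- The converse of `sub_eq_integral_of_weak_deriv`. -/
lemma weak_deriv_of_sub_eq_integral {a b : ℝ} (hab : a ≤ b) {g k : ℝ → ℝ}
    (hk : IntegrableOn k (Set.Ioo a b))
    (h : ∀ t ∈ Set.Icc a b, g t - g a = ∫ r in a..t, k r)
    {η : ℝ → ℝ} (h1 : ContDiff ℝ ∞ η) (h3 : tsupport η ⊆ Set.Ioo a b) :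
    ∫ t in Set.Ioo a b, deriv η t * g t = - ∫ t in Set.Ioo a b, η t * k t := by
  have hki : IntervalIntegrable k volume a b := by
    rw [intervalIntegrable_iff_integrableOn_Ioo_of_le hab]; exact hk
  have hac := hki.absolutelyContinuousOnInterval_intervalIntegral (c := a) (by simp)
  have hηac : AbsolutelyContinuousOnInterval η a b :=
    ContDiffOn.absolutelyContinuousOnInterval ((h1.of_le (by simp)).contDiffOn)
  have hηa : η a = 0 := image_eq_zero_of_notMem_tsupport fun h => absurd (h3 h).1 (lt_irrefl a)
  have hηb : η b = 0 := image_eq_zero_of_notMem_tsupport fun h => absurd (h3 h).2 (lt_irrefl b)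
  have hparts := hηac.integral_mul_deriv_eq_deriv_mul hac
  have hk' : ∫ x in a..b, η x * deriv (fun t => ∫ r in a..t, k r) x
      = ∫ x in a..b, η x * k x := by
    refine intervalIntegral.integral_congr_ae ?_
    filter_upwards [hki.ae_hasDerivAt_integral] with x hx hx'
    rw [(hx (Set.uIoc_subset_uIcc hx') a (by simp)).deriv]
  rw [hk', hηa, hηb] at hparts
  -- The primitive differs from `g` by the constant `g a`, which integrates to zero against `deriv
  -- η` since η vanishes at both ends.
  have hP : ∫ x in a..b, deriv η x * ∫ r in a..x, k r
      = ∫ x in a..b, (deriv η x * g x - deriv η x * g a) := by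
    refine intervalIntegral.integral_congr fun t ht => ?_
    rw [Set.uIcc_of_le hab] at ht
    simp only [← h t ht]; ring
  have hdη : IntervalIntegrable (deriv η) volume a b :=
    (h1.continuous_deriv (by simp)).intervalIntegrable a b
  have hgc : ContinuousOn g (Set.uIcc a b) := by
    refine (hac.continuousOn.add (continuousOn_const (c := g a))).congr fun t ht => ?_
    rw [Set.uIcc_of_le hab] at ht
    have := h t ht
    show g t = (∫ r in a..t, k r) + g a
    linarith
  rw [hP, intervalIntegral.integral_sub (hdη.mul_continuousOn hgc)
    (hdη.mul_const _), intervalIntegral.integral_mul_const, hηac.integral_deriv_eq_sub, hηa, hηb]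
    at hparts
  simp only [intervalIntegral.integral_of_le hab, integral_Ioc_eq_integral_Ioo] at hparts ⊢
  linarith

/-! ### The energy identity in a Gelfand triple -/

/-- The integral of a difference quotient telescopes into difference quotients of a primitive at the
two end points. -/
lemma tendsto_integral_diffQuot {N : ℝ → ℝ} (hN : Continuous N) (s t : ℝ) {h : ℕ → ℝ}
    (h0 : Tendsto h atTop (𝓝[≠] 0)) :
    Tendsto (fun n => ∫ r in s..t, (h n)⁻¹ * (N (r + h n) - N r)) atTop (𝓝 (N t - N s)) := by
  have hd : ∀ t, HasDerivAt (fun t => ∫ r in (0 : ℝ)..t, N r) (N t) t := fun t =>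
    (hN.integral_hasStrictDerivAt 0 t).hasDerivAt
  have hi : ∀ x y, IntervalIntegrable N volume x y := fun x y => hN.intervalIntegrable x y
  have key : ∀ k : ℝ, ∫ r in s..t, k⁻¹ * (N (r + k) - N r)
      = k⁻¹ • ((∫ r in (0 : ℝ)..(t + k), N r) - ∫ r in (0 : ℝ)..t, N r)
        - k⁻¹ • ((∫ r in (0 : ℝ)..(s + k), N r) - ∫ r in (0 : ℝ)..s, N r) := by
    intro k
    rw [intervalIntegral.integral_const_mul, intervalIntegral.integral_sub
      ((show Continuous fun r => N (r + k) by fun_prop).intervalIntegrable _ _) (hi _ _),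
      intervalIntegral.integral_comp_add_right (fun r => N r),
      ← intervalIntegral.integral_interval_sub_left (hi 0 (t + k)) (hi 0 (s + k)),
      ← intervalIntegral.integral_interval_sub_left (hi 0 t) (hi 0 s)]
    simp only [smul_eq_mul]; ring
  simp only [key]
  exact ((hasDerivAt_iff_tendsto_slope_zero.1 (hd t)).comp h0).sub
    ((hasDerivAt_iff_tendsto_slope_zero.1 (hd s)).comp h0)

/-- Fatou's lemma for nonnegative `Q n` whose integrals converge but whose pointwise behaviour is
known only through the convergent minorants `R n`. Only the positive part of `R₀` has to be
compared, so `R₀` may change sign. -/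
lemma integral_le_of_tendsto_of_le {α : Type*} [MeasurableSpace α] {μ : Measure α}
    {Q R : ℕ → α → ℝ} {R₀ : α → ℝ} {c : ℝ} (hQ : ∀ n, Integrable (Q n) μ)
    (hR₀ : Integrable R₀ μ) (h0 : ∀ n, ∀ᵐ a ∂μ, 0 ≤ Q n a)
    (hRQ : ∀ n, ∀ᵐ a ∂μ, R n a ≤ Q n a)
    (hR : ∀ᵐ a ∂μ, Tendsto (fun n => R n a) atTop (𝓝 (R₀ a)))
    (hc : Tendsto (fun n => ∫ a, Q n a ∂μ) atTop (𝓝 c)) : ∫ a, R₀ a ∂μ ≤ c := by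
  have hc0 : 0 ≤ c := ge_of_tendsto' hc fun n => integral_nonneg_of_ae (h0 n)
  have h1 : ∫⁻ a, ENNReal.ofReal (R₀ a) ∂μ ≤ ENNReal.ofReal c := by
    calc ∫⁻ a, ENNReal.ofReal (R₀ a) ∂μ
        ≤ ∫⁻ a, liminf (fun n => ENNReal.ofReal (Q n a)) atTop ∂μ := by
          refine lintegral_mono_ae ?_
          filter_upwards [hR, ae_all_iff.2 hRQ] with a ha hb
          rw [← (ENNReal.tendsto_ofReal ha).liminf_eq]
          exact liminf_le_liminf (Eventually.of_forall fun n => ENNReal.ofReal_le_ofReal (hb n))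
      _ ≤ liminf (fun n => ∫⁻ a, ENNReal.ofReal (Q n a) ∂μ) atTop :=
          lintegral_liminf_le' fun n => (hQ n).aestronglyMeasurable.aemeasurable.ennreal_ofReal
      _ = ENNReal.ofReal c := by
          have : ∀ n, ∫⁻ a, ENNReal.ofReal (Q n a) ∂μ = ENNReal.ofReal (∫ a, Q n a ∂μ) :=
            fun n => (ofReal_integral_eq_lintegral_ofReal (hQ n) (h0 n)).symm
          simp only [this]
          exact (ENNReal.tendsto_ofReal hc).liminf_eq
  calc ∫ a, R₀ a ∂μ ≤ (∫⁻ a, ENNReal.ofReal (R₀ a) ∂μ).toReal := by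
        rw [integral_eq_lintegral_pos_part_sub_lintegral_neg_part hR₀]
        linarith [ENNReal.toReal_nonneg (a := ∫⁻ a, ENNReal.ofReal (-R₀ a) ∂μ)]
    _ ≤ c := by
        rw [← ENNReal.toReal_ofReal hc0]
        exact ENNReal.toReal_mono ENNReal.ofReal_ne_top h1

section Energy

variable {V H : Type*} [NormedAddCommGroup V] [NormedSpace ℝ V]
  [NormedAddCommGroup H] [InnerProductSpace ℝ H]

/-- Convexity of the squared norm. The dropped term ‖b - a‖² is the reason why the energy identity
is first obtained as an inequality. -/
lemma two_mul_inner_sub_le (a b : H) : 2 * inner ℝ (b - a) a ≤ ‖b‖ ^ 2 - ‖a‖ ^ 2 := by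
  have := norm_add_sq_real (b - a) a
  rw [sub_add_cancel] at this
  nlinarith [sq_nonneg ‖b - a‖]

/-- By convexity, |x(r+h)|² - |x(r)|² is at least twice the pairing of the increment of the
primitive W of `w` with `u r`. After division by h the left side telescopes under the integral, and
the right side converges almost everywhere by Lebesgue differentiation in V*. Fatou's lemma then
gives the inequality without any smooth approximation of x. -/
lemma energy_lower (ι : V →L[ℝ] H) {p q : ℝ} (hpq : p.HolderConjugate q) {x : ℝ → H}
    {u : ℝ → V} {w : ℝ → StrongDual ℝ V} (hxc : Continuous x) (hw : Integrable w)
    (hwq : Integrable fun r => ‖w r‖ ^ q)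
    (hx : ∀ s t v, inner ℝ (x t - x s) (ι v) = ∫ r in s..t, w r v) {s t : ℝ} (hst : s ≤ t)
    (hu : ∀ᵐ r ∂volume.restrict (Set.Ioc s t), x r = ι (u r))
    (hup : IntegrableOn (fun r => ‖u r‖ ^ p) (Set.Ioc s t))
    (hwu : IntegrableOn (fun r => w r (u r)) (Set.Ioc s t)) :
    2 * ∫ r in s..t, w r (u r) ≤ ‖x t‖ ^ 2 - ‖x s‖ ^ 2 := by
  set N : ℝ → ℝ := fun r => ‖x r‖ ^ 2
  have hN : Continuous N := (hxc.norm).pow 2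
  set W : ℝ → StrongDual ℝ V := fun r => ∫ z in (0 : ℝ)..r, w z
  set Γ : ℝ → ℝ := fun r => ∫ z in (0 : ℝ)..r, ‖w z‖ ^ q
  have hΓ : Continuous Γ := intervalIntegral.continuous_primitive (fun a b => hwq.intervalIntegrable) 0
  have hh : ∀ n : ℕ, (0 : ℝ) < 1 / ((n : ℝ) + 1) := fun n => Nat.one_div_pos_of_nat
  set h : ℕ → ℝ := fun n => 1 / ((n : ℝ) + 1) with hdef
  have h0 : Tendsto h atTop (𝓝[≠] 0) := tendsto_nhdsWithin_iff.2
    ⟨tendsto_one_div_add_atTop_nhds_zero_nat, Eventually.of_forall fun n => (hh n).ne'⟩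
  have hwii : ∀ x y, IntervalIntegrable w volume x y := fun x y => hw.intervalIntegrable
  have hWv : ∀ r k v, inner ℝ (x (r + k) - x r) (ι v) = (W (r + k) - W r) v := fun r k v => by
    rw [hx, intervalIntegral.integral_interval_sub_left (hwii _ _) (hwii _ _),
      ContinuousLinearMap.intervalIntegral_apply (hwii _ _)]
  -- Young's inequality supplies the lower bound that Fatou's lemma needs. Its first part is an
  -- increment of Γ, the primitive of ‖w‖^q, so its difference quotient has convergent integrals
  -- too.
  have hWΓ : ∀ r k v, 0 < k →
      -((Γ (r + k) - Γ r) / q + k * (‖v‖ ^ p / p)) ≤ (W (r + k) - W r) v := fun r k v hk => by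
    have e1 : ‖(W (r + k) - W r) v‖ ≤ ∫ z in r..(r + k), ‖w z‖ * ‖v‖ := by
      rw [intervalIntegral.integral_interval_sub_left (hwii _ _) (hwii _ _),
        ContinuousLinearMap.intervalIntegral_apply (hwii _ _)]
      refine intervalIntegral.norm_integral_le_of_norm_le (by linarith)
        (Eventually.of_forall fun z _ => (w z).le_opNorm v) ?_
      exact (hw.norm.mul_const _).intervalIntegrable
    have e2 : ∫ z in r..(r + k), ‖w z‖ * ‖v‖ ≤ ∫ z in r..(r + k), (‖w z‖ ^ q / q + ‖v‖ ^ p / p) := by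
      refine intervalIntegral.integral_mono_on (by linarith)
        (hw.norm.mul_const _).intervalIntegrable
        ((hwq.div_const q).intervalIntegrable.add intervalIntegrable_const) fun z _ => ?_
      have := Real.young_inequality_of_nonneg (norm_nonneg v) (norm_nonneg (w z)) hpq
      linarith [mul_comm ‖v‖ ‖w z‖]
    rw [intervalIntegral.integral_add (hwq.div_const q).intervalIntegrable
      intervalIntegrable_const, intervalIntegral.integral_div,
      intervalIntegral.integral_const, ← intervalIntegral.integral_interval_sub_left
      (hwq.intervalIntegrable (a := 0)) (hwq.intervalIntegrable (a := 0)), add_sub_cancel_left,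
      smul_eq_mul] at e2
    have := abs_le.1 (e1.trans e2)
    exact this.1
  have hdiff : ∀ᵐ r, Tendsto (fun n => (h n)⁻¹ • (W (r + h n) - W r)) atTop (𝓝 (w r)) ∧
      Tendsto (fun n => (h n)⁻¹ • (Γ (r + h n) - Γ r)) atTop (𝓝 (‖w r‖ ^ q)) := by
    filter_upwards [_root_.LocallyIntegrable.ae_hasDerivAt_integral hw.locallyIntegrable,
      _root_.LocallyIntegrable.ae_hasDerivAt_integral hwq.locallyIntegrable] with r h1 h2
    exact ⟨(hasDerivAt_iff_tendsto_slope_zero.1 (h1 0)).comp h0,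
      (hasDerivAt_iff_tendsto_slope_zero.1 (h2 0)).comp h0⟩
  set G : ℝ → ℝ := fun r => 2 * (‖w r‖ ^ q / q + ‖u r‖ ^ p / p) with hG
  have hupi : IntegrableOn (fun r => 2 * (‖u r‖ ^ p / p)) (Set.Ioc s t) :=
    (hup.div_const p).const_mul 2
  -- `Q n` is the difference quotient of |x|² plus the Young compensator that makes it nonnegative.
  -- The compensator contributes the same amount to both sides in the limit and cancels.
  have hmain := integral_le_of_tendsto_of_le (μ := volume.restrict (Set.Ioc s t))
    (Q := fun n r => (h n)⁻¹ * ((N (r + h n) + 2 / q * Γ (r + h n)) - (N r + 2 / q * Γ r))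
      + 2 * (‖u r‖ ^ p / p))
    (R := fun n r => 2 * ((h n)⁻¹ • (W (r + h n) - W r)) (u r)
      + 2 * ((h n)⁻¹ • (Γ (r + h n) - Γ r) / q + ‖u r‖ ^ p / p))
    (R₀ := fun r => 2 * w r (u r) + 2 * (‖w r‖ ^ q / q + ‖u r‖ ^ p / p))
    (c := (‖x t‖ ^ 2 + 2 / q * Γ t) - (‖x s‖ ^ 2 + 2 / q * Γ s)
      + ∫ r in Set.Ioc s t, 2 * (‖u r‖ ^ p / p)) ?_ ?_ ?_ ?_ ?_ ?_
  · have i1 : Integrable (fun r => 2 * (‖w r‖ ^ q / q)) (volume.restrict (Set.Ioc s t)) :=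
      ((hwq.div_const q).const_mul 2).integrableOn
    have e : ∀ r, 2 * w r (u r) + 2 * (‖w r‖ ^ q / q + ‖u r‖ ^ p / p)
        = (2 * w r (u r) + 2 * (‖w r‖ ^ q / q)) + 2 * (‖u r‖ ^ p / p) := fun r => by ring
    simp only [e] at hmain
    have i2 : Integrable (fun r => 2 * w r (u r)) (volume.restrict (Set.Ioc s t)) :=
      hwu.const_mul 2
    have i3 : Integrable (fun r => 2 * w r (u r) + 2 * (‖w r‖ ^ q / q))
      (volume.restrict (Set.Ioc s t)) := i2.add i1
    rw [integral_add i3 hupi, integral_add i2 i1] at hmain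
    have e3 : ∫ r in Set.Ioc s t, 2 * (‖w r‖ ^ q / q) = 2 / q * (Γ t - Γ s) := by
      rw [intervalIntegral.integral_interval_sub_left hwq.intervalIntegrable
        hwq.intervalIntegrable, intervalIntegral.integral_of_le hst, ← integral_const_mul]
      congr 1; ext r; ring
    rw [e3, integral_const_mul] at hmain
    rw [intervalIntegral.integral_of_le hst]
    linarith
  · intro n
    refine Integrable.add ?_ hupi
    exact (Continuous.integrableOn_Ioc (by fun_prop))
  · exact (hwu.const_mul 2).add ((((hwq.div_const q).integrableOn).add (hup.div_const p)).const_mul 2)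
  · intro n
    filter_upwards [hu] with r hr
    have h1 := two_mul_inner_sub_le (x r) (x (r + h n))
    have h2 := hWv r (h n) (u r)
    rw [← hr] at h2
    rw [h2] at h1
    have h3 := hWΓ r (h n) (u r) (hh n)
    have h4 : 0 ≤ (h n)⁻¹ := inv_nonneg.2 (hh n).le
    have h5 : (h n)⁻¹ * (h n) = 1 := inv_mul_cancel₀ (hh n).ne'
    have h6 : 0 ≤ (h n)⁻¹ * (N (r + h n) - N r +
      2 * ((Γ (r + h n) - Γ r) / q + h n * (‖u r‖ ^ p / p))) :=
      mul_nonneg h4 (by simp only [N]; linarith)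
    have h7 : (h n)⁻¹ * (N (r + h n) + 2 / q * Γ (r + h n) - (N r + 2 / q * Γ r))
      + 2 * (‖u r‖ ^ p / p) = (h n)⁻¹ * (N (r + h n) - N r +
      2 * ((Γ (r + h n) - Γ r) / q)) + 2 * ((h n)⁻¹ * h n) * (‖u r‖ ^ p / p) := by
      rw [h5]; ring
    rw [h7]
    linarith
  · intro n
    filter_upwards [hu] with r hr
    have h1 := two_mul_inner_sub_le (x r) (x (r + h n))
    have h2 := hWv r (h n) (u r)
    rw [← hr] at h2
    rw [h2] at h1
    have h4 : 0 ≤ (h n)⁻¹ := inv_nonneg.2 (hh n).le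
    have h6 := mul_le_mul_of_nonneg_left h1 h4
    simp only [_root_.smul_apply, smul_eq_mul, N] at h6 ⊢
    have h7 : (h n)⁻¹ * (‖x (r + h n)‖ ^ 2 + 2 / q * Γ (r + h n) - (‖x r‖ ^ 2 + 2 / q * Γ r))
       = (h n)⁻¹ * (‖x (r + h n)‖ ^ 2 - ‖x r‖ ^ 2) + 2 * ((h n)⁻¹ * (Γ (r + h n) - Γ r) / q) := by
      ring
    rw [h7]
    linarith
  · filter_upwards [ae_restrict_of_ae hdiff] with r hr
    have e1 : Tendsto (fun n => ((h n)⁻¹ • (W (r + h n) - W r)) (u r)) atTop (𝓝 (w r (u r))) :=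
      ((ContinuousLinearMap.apply ℝ ℝ (u r)).continuous.tendsto _).comp hr.1
    exact (e1.const_mul 2).add (((hr.2.div_const q).add_const _).const_mul 2)
  · have e1 := tendsto_integral_diffQuot (N := fun r => N r + 2 / q * Γ r) (by fun_prop) s t h0
    simp only [intervalIntegral.integral_of_le hst] at e1
    refine (e1.add_const (∫ r in Set.Ioc s t, 2 * (‖u r‖ ^ p / p))).congr fun n => ?_
    rw [integral_add (Continuous.integrableOn_Ioc (by fun_prop)) hupi]

/-- Time reversal replaces `w` by -w(-r), so `energy_lower` applied to the reversed path is the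
opposite inequality. -/
lemma energy_identity_real (ι : V →L[ℝ] H) {p q : ℝ} (hpq : p.HolderConjugate q) {x : ℝ → H}
    {u : ℝ → V} {w : ℝ → StrongDual ℝ V} (hxc : Continuous x) (hw : Integrable w)
    (hwq : Integrable fun r => ‖w r‖ ^ q)
    (hx : ∀ s t v, inner ℝ (x t - x s) (ι v) = ∫ r in s..t, w r v) {s t : ℝ} (hst : s ≤ t)
    (hu : ∀ᵐ r ∂volume.restrict (Set.Ioc s t), x r = ι (u r))
    (hup : IntegrableOn (fun r => ‖u r‖ ^ p) (Set.Ioc s t))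
    (hwu : IntegrableOn (fun r => w r (u r)) (Set.Ioc s t)) :
    ‖x t‖ ^ 2 - ‖x s‖ ^ 2 = 2 * ∫ r in s..t, w r (u r) := by
  have neg_mp : MeasurePreserving (fun r : ℝ => -r) (volume.restrict (Set.Ico (-t) (-s)))
      (volume.restrict (Set.Ioc s t)) := by
    have := (Measure.measurePreserving_neg (volume : Measure ℝ)).restrict_preimage
      (measurableSet_Ioc (a := s) (b := t))
    rwa [show (fun r : ℝ => -r) ⁻¹' Set.Ioc s t = Set.Ico (-t) (-s) by
      ext r; simp only [Set.mem_preimage, Set.mem_Ioc, Set.mem_Ico]; constructor <;>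
      exact fun h => ⟨by linarith [h.1, h.2], by linarith [h.1, h.2]⟩] at this
  have hrestr : volume.restrict (Set.Ico (-t) (-s)) = volume.restrict (Set.Ioc (-t) (-s)) :=
    Measure.restrict_congr_set Ico_ae_eq_Ioc
  rw [hrestr] at neg_mp
  have neg_emb : MeasurableEmbedding (fun r : ℝ => -r) := (MeasurableEquiv.neg ℝ).measurableEmbedding
  have h1 := energy_lower ι hpq hxc hw hwq hx hst hu hup hwu
  have h2 := energy_lower ι hpq (x := fun r => x (-r)) (u := fun r => u (-r))
    (w := fun r => -w (-r)) (hxc.comp continuous_neg) hw.comp_neg.neg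
    (by simpa only [norm_neg] using hwq.comp_neg) (fun s t v => by
      rw [hx]
      simp only [_root_.neg_apply]
      rw [intervalIntegral.integral_neg, intervalIntegral.integral_comp_neg (fun r => w r v),
        intervalIntegral.integral_symm]) (neg_le_neg hst)
    (neg_mp.quasiMeasurePreserving.ae hu)
    ((neg_mp.integrable_comp_emb neg_emb).2 hup)
    (((neg_mp.integrable_comp_emb neg_emb).2 hwu).neg)
  simp only [_root_.neg_apply] at h2
  rw [intervalIntegral.integral_neg, intervalIntegral.integral_comp_neg (fun r => w r (u r))] at h2
  simp only [neg_neg] at h2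
  linarith

lemma integral_indicator_Ioo_eq {a b : ℝ} (hab : a ≤ b) (k : ℝ → ℝ) (t : ℝ) :
    ∫ r in a..t, (Set.Ioo a b).indicator k r = ∫ r in a..(max a (min b t)), k r := by
  rcases le_total t a with hta | hta
  · rw [min_eq_right (hta.trans hab), max_eq_left hta, intervalIntegral.integral_same]
    refine intervalIntegral.integral_zero_ae (Eventually.of_forall fun r hr => ?_)
    rw [Set.uIoc_of_ge hta] at hr
    exact Set.indicator_of_notMem (fun h => absurd h.1 (not_lt.2 hr.2)) _
  · have hm : a ≤ max a (min b t) := le_max_left _ _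
    rw [intervalIntegral.integral_of_le hta, intervalIntegral.integral_of_le hm,
      max_eq_right (le_min hab hta), integral_Ioc_eq_integral_Ioo' (by simp),
      integral_Ioc_eq_integral_Ioo' (by simp), setIntegral_indicator measurableSet_Ioo,
      Set.Ioo_inter_Ioo, max_self, min_comm]

lemma exists_integrable_extension {E : Type*} [NormedAddCommGroup E] {w : ℝ → E} {s : Set ℝ}
    (hs : MeasurableSet s) (hw : IntegrableOn w s) :
    ∃ w' : ℝ → E, Integrable w' ∧ (∀ r ∈ s, w' r = w r) ∧ ∀ r ∉ s, w' r = 0 :=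
  ⟨s.indicator w, hw.integrable_indicator hs, fun _ hr => Set.indicator_of_mem hr _,
    fun _ hr => Set.indicator_of_notMem hr _⟩

set_option maxHeartbeats 400000 in
/-- The energy identity `|x(t)|² - |x(s)|² = 2 ∫ₛᵗ ⟨x', x⟩` for `x ∈ W_{pq}(a,b)`. -/
theorem energy_identity (ι : V →L[ℝ] H) {p q : ℝ} (hpq : p.HolderConjugate q) {a b : ℝ}
    {x : ℝ → H} {u : ℝ → V} {w : ℝ → StrongDual ℝ V} (hxc : ContinuousOn x (Set.Icc a b))
    (hu : MemLp u (ENNReal.ofReal p) (volume.restrict (Set.Ioo a b)))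
    (hw : MemLp w (ENNReal.ofReal q) (volume.restrict (Set.Ioo a b)))
    (hxu : ∀ᵐ r ∂volume.restrict (Set.Ioo a b), x r = ι (u r))
    (hx : ∀ t ∈ Set.Icc a b, ∀ v, inner ℝ (x t - x a) (ι v) = ∫ r in a..t, w r v)
    {s t : ℝ} (has : a ≤ s) (hst : s ≤ t) (htb : t ≤ b) :
    ‖x t‖ ^ 2 - ‖x s‖ ^ 2 = 2 * ∫ r in s..t, w r (u r) := by
  have hab : a ≤ b := has.trans (hst.trans htb)
  have hq1 : 1 ≤ ENNReal.ofReal q := by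
    rw [← ENNReal.ofReal_one]; exact ENNReal.ofReal_le_ofReal hpq.symm.lt.le
  have hqt : (ENNReal.ofReal q).toReal = q := ENNReal.toReal_ofReal hpq.symm.pos.le
  have hpt : (ENNReal.ofReal p).toReal = p := ENNReal.toReal_ofReal hpq.pos.le
  have hH : ENNReal.HolderConjugate (ENNReal.ofReal q) (ENNReal.ofReal p) :=
    hpq.symm.ennrealOfReal
  -- The path is continued by its end values and `w` by zero, which preserves the integral relation
  -- and puts the problem on the whole line.
  obtain ⟨c, hcdef⟩ : ∃ c : ℝ → ℝ, c = fun r => max a (min b r) := ⟨_, rfl⟩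
  have hc : Continuous c := by rw [hcdef]; fun_prop
  have hcm : ∀ r, c r ∈ Set.Icc a b := fun r => hcdef ▸ ⟨le_max_left _ _, max_le hab (min_le_left _ _)⟩
  have hcid : ∀ r ∈ Set.Icc a b, c r = r := fun r hr => by
    simp only [hcdef]; rw [min_eq_right hr.2, max_eq_right hr.1]
  have hwI : IntegrableOn w (Set.Ioo a b) volume := hw.integrable hq1
  obtain ⟨w', hwi, hw', hw0⟩ := exists_integrable_extension measurableSet_Ioo hwI
  have hwq : Integrable fun r => ‖w' r‖ ^ q := by
    have h1 := hw.integrable_norm_rpow (by simpa using hpq.symm.pos) (by simp)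
    rw [hqt] at h1
    refine ((integrable_indicator_iff (f := fun r => ‖w r‖ ^ q) (μ := volume)
      measurableSet_Ioo).2 h1).congr (Eventually.of_forall fun r => ?_)
    by_cases hr : r ∈ Set.Ioo a b
    · simp [hw' r hr, hr]
    · simp [hw0 r hr, hr, Real.zero_rpow hpq.symm.pos.ne']
  have hwv : ∀ v t, ∫ r in a..t, w' r v = ∫ r in a..(c t), w r v := fun v t => by
    rw [hcdef, ← integral_indicator_Ioo_eq hab (fun r => w r v) t]
    congr 1; ext r
    by_cases hr : r ∈ Set.Ioo a b
    · simp [hw' r hr, hr]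
    · simp [hw0 r hr, hr]
  have hwvi : ∀ v x y, IntervalIntegrable (fun r => w' r v) volume x y := fun v x y =>
    (hwi.apply_continuousLinearMap v).intervalIntegrable
  have hsub : Set.Ioc s t ⊆ Set.Icc a b := Set.Ioc_subset_Icc_self.trans (Set.Icc_subset_Icc has htb)
  have hrle : volume.restrict (Set.Ioc s t) ≤ volume.restrict (Set.Ioo a b) := by
    rw [Measure.restrict_congr_set (Ioo_ae_eq_Icc (a := a) (b := b))]
    exact Measure.restrict_mono hsub le_rfl
  have hup := hu.integrable_norm_rpow (by simpa using hpq.pos) (by simp)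
  rw [hpt] at hup
  have hwu : Integrable (fun r => w r (u r)) (volume.restrict (Set.Ioo a b)) := by
    rw [← memLp_one_iff_integrable]
    exact (ContinuousLinearMap.id ℝ (StrongDual ℝ V)).memLp_of_bilin 1 hw hu
  have hww : ∀ᵐ r ∂volume.restrict (Set.Ioo a b), w' r = w r := by
    filter_upwards [ae_restrict_mem measurableSet_Ioo] with r hr using hw' r hr
  have := energy_identity_real ι hpq (x := fun r => x (c r)) (u := u) (w := w')
    (hxc.comp_continuous hc hcm) hwi hwq (fun s t v => by
      have h1 := hx _ (hcm t) v
      have h2 := hx _ (hcm s) v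
      rw [← hwv] at h1 h2
      rw [← sub_sub_sub_cancel_right _ _ (x a), inner_sub_left, h1, h2,
        intervalIntegral.integral_interval_sub_left (hwvi _ _ _) (hwvi _ _ _)]) hst
    (by
      filter_upwards [ae_mono hrle hxu, ae_restrict_mem measurableSet_Ioc] with r h1 h2
      rw [hcid r (hsub h2), h1])
    (hup.mono_measure hrle)
    ((hwu.congr (by filter_upwards [hww] with r hr; rw [hr])).mono_measure hrle)
  rw [hcid t ⟨has.trans hst, htb⟩, hcid s ⟨has, hst.trans htb⟩] at this
  rw [this]
  congr 1
  refine intervalIntegral.integral_congr_ae ?_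
  rw [← ae_restrict_iff' measurableSet_uIoc, Set.uIoc_of_le hst]
  filter_upwards [ae_mono hrle hww] with r hr
  rw [hr]

end Energy

/-! ### Reflexive spaces and duality -/

section Dual

variable {V : Type*} [NormedAddCommGroup V] [NormedSpace ℝ V]

lemma exists_dual_ne_zero_of_notMem_closure {E : Type*} [NormedAddCommGroup E] [NormedSpace ℝ E]
    (S : Submodule ℝ E) {x : E} (hx : x ∉ closure (S : Set E)) :
    ∃ g : StrongDual ℝ E, (∀ y ∈ S, g y = 0) ∧ g x ≠ 0 := by
  obtain ⟨f, u, h1, h2⟩ := geometric_hahn_banach_closed_point S.convex.closure isClosed_closure hx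
  have h0 : ∀ y ∈ S, f y = 0 := fun y hy => by
    -- A functional bounded above by `u` on a subspace vanishes there: otherwise a multiple of `y`
    -- would reach the value `u + 1`.
    by_contra hne
    have := h1 (((u + 1) / f y) • y) (subset_closure (S.smul_mem _ hy))
    rw [map_smul, smul_eq_mul, div_mul_cancel₀ _ hne] at this
    linarith
  have hu : 0 < u := by simpa using h1 0 (subset_closure S.zero_mem)
  exact ⟨f, h0, (hu.trans h2).ne'⟩

/-- Norming functionals of a dense sequence span a dense subspace: an annihilating element of V** is
some v in V, and a norming functional of a point near v cannot vanish at v unless v = 0.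
Separability of V* gives weak sequential compactness in V and the measurability of V*-valued maps.
-/
lemma separableSpace_dual_of_reflexive [TopologicalSpace.SeparableSpace V]
    (hV : Function.Surjective (NormedSpace.inclusionInDoubleDual ℝ V)) :
    TopologicalSpace.SeparableSpace (StrongDual ℝ V) := by
  choose w hw1 hw2 using fun n => exists_dual_vector'' ℝ (TopologicalSpace.denseSeq V n)
  have hsep : TopologicalSpace.IsSeparable
      (closure (Submodule.span ℝ (Set.range w) : Set (StrongDual ℝ V))) :=
    (Set.countable_range w).isSeparable.span.closure
  have huniv : closure (Submodule.span ℝ (Set.range w) : Set (StrongDual ℝ V)) = Set.univ := by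
    rw [Set.eq_univ_iff_forall]
    intro x
    by_contra hx
    obtain ⟨g, hg0, hgx⟩ := exists_dual_ne_zero_of_notMem_closure _ hx
    obtain ⟨v, rfl⟩ := hV g
    refine hgx ?_
    have hv : v = 0 := by
      by_contra hne
      obtain ⟨n, hn⟩ := (TopologicalSpace.denseRange_denseSeq V).exists_dist_lt v
        (show 0 < ‖v‖ / 3 by positivity)
      set d := TopologicalSpace.denseSeq V n
      have e1 : w n v = 0 := hg0 _ (Submodule.subset_span ⟨n, rfl⟩)
      have e2 : ‖d‖ ≤ ‖d - v‖ := by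
        have : (‖d‖ : ℝ) = w n (d - v) := by
          rw [map_sub, e1, sub_zero]; exact (hw2 n).symm
        rw [this]
        refine (le_abs_self _).trans (((w n).le_opNorm _).trans ?_)
        exact mul_le_of_le_one_left (norm_nonneg _) (hw1 n)
      rw [dist_eq_norm, norm_sub_rev] at hn
      have := norm_sub_norm_le v d
      rw [norm_sub_rev] at this
      have : 0 < ‖v‖ := norm_pos_iff.2 hne
      linarith
    simp [hv]
  rw [huniv] at hsep
  exact TopologicalSpace.isSeparable_univ_iff.1 hsep

/-- Evaluation on a dense sequence is a continuous injection of the Polish space V* into ℝ^ℕ, hence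
a measurable embedding, so scalar measurability lifts to V*. -/
lemma aestronglyMeasurable_dual_of_apply [TopologicalSpace.SeparableSpace V]
    [TopologicalSpace.SeparableSpace (StrongDual ℝ V)] {α : Type*} [MeasurableSpace α]
    {μ : Measure α} {w : α → StrongDual ℝ V} (hw : ∀ v, AEMeasurable (fun a => w a v) μ) :
    AEStronglyMeasurable w μ := by
  borelize (StrongDual ℝ V)
  have : SecondCountableTopology (StrongDual ℝ V) :=
    UniformSpace.secondCountable_of_separable _
  let Φ : StrongDual ℝ V → ℕ → ℝ := fun φ n => φ (TopologicalSpace.denseSeq V n)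
  have hΦc : Continuous Φ := continuous_pi fun n => by fun_prop
  have hΦi : Function.Injective Φ := fun φ ψ h =>
    ContinuousLinearMap.coeFn_injective ((TopologicalSpace.denseRange_denseSeq V).equalizer
      φ.continuous ψ.continuous (funext fun n => congrFun h n))
  have hemb := hΦc.measurableEmbedding hΦi
  have : AEMeasurable w μ :=
    (hemb.aemeasurable_comp_iff).1 (aemeasurable_pi_iff.2 fun n => hw _)
  exact this.aestronglyMeasurable

/-- A monotone, hemicontinuous and locally bounded operator is demicontinuous. -/
lemma demicontinuous_of_monotone {B : V → StrongDual ℝ V}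
    (hmono : ∀ x y, 0 ≤ (B x - B y) (x - y))
    (hhemi : ∀ x y v : V, ContinuousOn (fun s : ℝ => B (x + s • y) v) (Set.Icc 0 1))
    {u : V} {U : ℕ → V} (hU : Tendsto U atTop (𝓝 u)) {R : ℝ} (hR : ∀ n, ‖B (U n)‖ ≤ R) (v : V) :
    Tendsto (fun n => B (U n) v) atTop (𝓝 (B u v)) := by
  have hR0 : 0 ≤ R := (norm_nonneg _).trans (hR 0)
  have h1 : Tendsto (fun n => ‖U n - u‖) atTop (𝓝 0) := by
    simpa using (hU.sub_const u).norm
  have upper : ∀ v : V, ∀ ε > 0, ∀ᶠ n in atTop, B (U n) v < B u v + ε := by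
    intro v ε hε
    have hc := hhemi u v v 0 (by simp)
    simp only [ContinuousWithinAt, zero_smul, add_zero] at hc
    have hc' : Tendsto (fun s : ℝ => B (u + s • v) v) (𝓝[Set.Ioc 0 1] 0) (𝓝 (B u v)) :=
      hc.mono_left (nhdsWithin_mono _ Set.Ioc_subset_Icc_self)
    have hne : (𝓝[Set.Ioc (0 : ℝ) 1] 0).NeBot := by
      rw [nhdsWithin_Ioc_eq_nhdsGT one_pos]; infer_instance
    -- Minty's trick: θ is fixed so small that hemicontinuity costs at most ε/2. Monotonicity
    -- between `U n` and u + θv, divided by θ, then bounds B(U n) v from above up to an error of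
    -- order ‖U n - u‖/θ. The lower bound comes from -v.
    obtain ⟨θ, hθ1, hθ⟩ := ((hc'.eventually_lt_const
      (show B u v < B u v + ε / 2 by linarith)).and self_mem_nhdsWithin).exists
    set b := B (u + θ • v)
    have h2 : Tendsto (fun n => (R + ‖b‖) * ‖U n - u‖) atTop (𝓝 0) := by
      simpa using h1.const_mul (R + ‖b‖)
    filter_upwards [h2.eventually_lt_const (show 0 < θ * (ε / 2) from mul_pos hθ.1 (by linarith))]
      with n hn
    have h3 := hmono (U n) (u + θ • v)
    have h4 : U n - (u + θ • v) = (U n - u) - θ • v := by abel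
    rw [h4, map_sub, map_smul, smul_eq_mul] at h3
    have h5 : (B (U n) - b) (U n - u) ≤ (R + ‖b‖) * ‖U n - u‖ :=
      (le_abs_self _).trans (((B (U n) - b).le_opNorm _).trans (mul_le_mul_of_nonneg_right
        ((norm_sub_le _ _).trans (by linarith [hR n])) (norm_nonneg _)))
    have h6 : θ * (B (U n) v - b v) < θ * (ε / 2) := by
      have : (B (U n) - b) v = B (U n) v - b v := rfl
      rw [← this]; linarith
    have h7 := lt_of_mul_lt_mul_left h6 hθ.1.le
    linarith
  rw [Metric.tendsto_atTop']
  intro ε hε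
  have := (upper v ε hε).and (upper (-v) ε hε)
  simp only [map_neg] at this
  obtain ⟨N, hN⟩ := eventually_atTop.1 this
  refine ⟨N, fun n hn => ?_⟩
  rw [Real.dist_eq, abs_lt]
  constructor <;> linarith [(hN n hn.le).1, (hN n hn.le).2]

end Dual

/-! ### Gelfand triples: density, weak limits and compactness of the embedding -/

section Gelfand

variable {V H : Type*} [NormedAddCommGroup V] [NormedSpace ℝ V]
  [NormedAddCommGroup H] [InnerProductSpace ℝ H] {ι : V →L[ℝ] H}

lemma toDual_apply (h : H) (v : V) : toDual ι h v = inner ℝ h (ι v) := rfl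

lemma toV_apply (hinj : Function.Injective ι) (v : V) : toV ι (ι v) = v :=
  Function.leftInverse_invFun hinj v

lemma map_toV {h : H} (hh : h ∈ Set.range ι) : ι (toV ι h) = h := Function.invFun_eq hh

variable (ι) in
/-- The embedding `H → V*` as a continuous linear map. -/
def toDualL : H →L[ℝ] StrongDual ℝ V :=
  ((ContinuousLinearMap.compL ℝ V H ℝ).flip ι).comp (innerSL ℝ)

/-- By reflexivity a functional on V* that annihilates the image of H is evaluation at some v, and
testing it on ι v itself gives |ι v|² = 0. -/
lemma denseRange_toDual (hι : IsGelfandTriple ι) (φ : StrongDual ℝ V) {ε : ℝ} (hε : 0 < ε) :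
    ∃ h : H, ‖φ - toDual ι h‖ < ε := by
  have : φ ∈ closure ((LinearMap.range (toDualL ι).toLinearMap : Submodule ℝ _) : Set _) := by
    by_contra hφ
    obtain ⟨g, hg, hne⟩ := exists_dual_ne_zero_of_notMem_closure _ hφ
    obtain ⟨v, rfl⟩ := hι.reflexive g
    have h0 : inner ℝ (ι v) (ι v) = (0 : ℝ) := hg (toDual ι (ι v)) ⟨ι v, rfl⟩
    have hv : v = 0 := hι.injective (by rw [inner_self_eq_zero.1 h0, map_zero])
    simp [hv] at hne
  obtain ⟨_, ⟨h, rfl⟩, hd⟩ := Metric.mem_closure_iff.1 this ε hε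
  exact ⟨h, by rwa [dist_eq_norm] at hd⟩

/-- Bounded sequences of `V` that converge in `H` converge weakly in `V`. -/
lemma exists_weak_limit [TopologicalSpace.SeparableSpace V] (hι : IsGelfandTriple ι) {U : ℕ → V}
    {R : ℝ} (hR : ∀ n, ‖U n‖ ≤ R) {y : H} (hy : Tendsto (fun n => ι (U n)) atTop (𝓝 y)) :
    ∃ v, ι v = y ∧ ‖v‖ ≤ R := by
  have := separableSpace_dual_of_reflexive hι.reflexive
  -- The sequence is viewed in V**, the dual of the separable space V*, where balls are weak*
  -- sequentially compact; reflexivity brings the limit back to V.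
  obtain ⟨g, hg, ψ, hψ, hlim⟩ := WeakDual.isSeqCompact_closedBall ℝ (StrongDual ℝ V) 0 R
    (x := fun n => StrongDual.toWeakDual (NormedSpace.inclusionInDoubleDual ℝ V (U n)))
    (fun n => by
      simp only [Set.mem_preimage, Metric.mem_closedBall, dist_zero_right]
      exact (NormedSpace.double_dual_bound ℝ V (U n)).trans (hR n))
  obtain ⟨v, hv⟩ := hι.reflexive (WeakDual.toStrongDual g)
  have hev : ∀ φ : StrongDual ℝ V, Tendsto (fun n => φ (U (ψ n))) atTop (𝓝 (φ v)) := fun φ => by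
    have h1 := ((WeakDual.eval_continuous φ).tendsto g).comp hlim
    have h2 : g φ = φ v := by
      have : WeakDual.toStrongDual g φ = φ v := by rw [← hv]; rfl
      exact this
    rw [h2] at h1
    exact h1
  refine ⟨v, ?_, ?_⟩
  · refine ext_inner_left ℝ fun h => ?_
    exact tendsto_nhds_unique (hev (toDual ι h))
      ((tendsto_const_nhds.inner hy).comp hψ.tendsto_atTop)
  · obtain ⟨f, hf1, hf2⟩ := exists_dual_vector'' ℝ v
    have h1 := (continuous_abs.tendsto _).comp (hev f)
    rw [hf2] at h1
    have h2 : |((‖v‖ : ℝ))| ≤ R := le_of_tendsto' h1 fun n => by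
      refine ((f.le_opNorm _).trans ?_)
      exact (mul_le_of_le_one_left (norm_nonneg _) hf1).trans (hR _)
    simpa using h2

/-- A quantitative form of the compactness of `ι`: up to `ε ‖v‖`, the norm of `ι v` is controlled
by finitely many functionals. -/
lemma exists_finite_rank_bound (hc : IsCompactOperator ι) {ε : ℝ} (hε : 0 < ε) :
    ∃ (m : ℕ) (e : Fin m → H), ∀ v, ‖ι v‖ ≤ ε * ‖v‖ + ∑ i, |inner ℝ (e i) (ι v)| := by
  have hK := hc.isCompact_closure_image_closedBall 1
  -- A finite ε-net of the image of the unit ball spans S. By homogeneity the distance of ι v to S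
  -- is at most ε‖v‖, and the projection onto S is controlled by its coordinates in an orthonormal
  -- basis, which provides the vectors `e i`.
  obtain ⟨t, -, htf, ht⟩ := hK.totallyBounded.exists_subset (Metric.dist_mem_uniformity hε)
  have : Fintype t := htf.fintype
  set S := Submodule.span ℝ t
  have hfin : FiniteDimensional ℝ S := FiniteDimensional.span_of_finite ℝ htf
  let b := stdOrthonormalBasis ℝ S
  refine ⟨_, fun i => (b i : H), fun v => ?_⟩
  have hP : ‖ι v - S.starProjection (ι v)‖ ≤ ε * ‖v‖ := by
    rcases eq_or_ne v 0 with rfl | hv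
    · simp
    have hv0 : 0 < ‖v‖ := norm_pos_iff.2 hv
    have hmem : ι (‖v‖⁻¹ • v) ∈ closure (ι '' Metric.closedBall 0 1) :=
      subset_closure ⟨_, by simp [norm_smul, hv0.ne'], rfl⟩
    have := ht hmem
    simp only [Set.mem_iUnion, Set.mem_ofPred_eq] at this
    obtain ⟨y, hy, hd⟩ := this
    have h1 : ‖v‖ • y ∈ S := S.smul_mem _ (Submodule.subset_span hy)
    have h2 : ‖ι v - S.starProjection (ι v)‖ ≤ ‖ι v - ‖v‖ • y‖ := by
      rw [S.starProjection_minimal]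
      exact ciInf_le ⟨0, by rintro _ ⟨z, rfl⟩; exact norm_nonneg _⟩ (⟨_, h1⟩ : S)
    refine h2.trans ?_
    have h3 : ι v - ‖v‖ • y = ‖v‖ • (ι (‖v‖⁻¹ • v) - y) := by
      rw [smul_sub, map_smul, smul_inv_smul₀ hv0.ne']
    rw [h3, norm_smul, norm_norm, mul_comm]
    rw [dist_eq_norm] at hd
    exact mul_le_mul_of_nonneg_right hd.le hv0.le
  have hQ : ‖S.starProjection (ι v)‖ ≤ ∑ i, |inner ℝ (b i : H) (ι v)| := by
    have h1 : S.starProjection (ι v) = ∑ i, inner ℝ (b i : H) (ι v) • (b i : H) := by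
      rw [Submodule.starProjection_apply, b.orthogonalProjectionOnto_apply_eq_sum]; simp
    rw [h1]
    refine (norm_sum_le _ _).trans (Finset.sum_le_sum fun i _ => ?_)
    have hb : ‖(b i : H)‖ = 1 := b.orthonormal.1 i
    rw [norm_smul, hb, mul_one, Real.norm_eq_abs]
  calc ‖ι v‖ = ‖(ι v - S.starProjection (ι v)) + S.starProjection (ι v)‖ := by rw [sub_add_cancel]
    _ ≤ _ := (norm_add_le _ _).trans (add_le_add hP hQ)

end Gelfand

/-! ### Elementary facts about paths -/

section Paths

variable {T : ℝ} {H : Type*}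

lemma clampTime_of_mem [Fact (0 < T)] {s : ℝ} (hs : s ∈ Set.Icc 0 T) :
    (clampTime s : Set.Icc (0 : ℝ) T) = ⟨s, hs⟩ := Set.projIcc_of_mem _ hs

lemma clampTime_coe [Fact (0 < T)] (t : Set.Icc (0 : ℝ) T) : clampTime (t : ℝ) = t :=
  Set.projIcc_val _ t

lemma coe_clampTime_of_mem [Fact (0 < T)] {s : ℝ} (hs : s ∈ Set.Icc 0 T) :
    ((clampTime s : Set.Icc (0 : ℝ) T) : ℝ) = s := by rw [clampTime_of_mem hs]

lemma continuous_clampTime [Fact (0 < T)] :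
    Continuous (clampTime : ℝ → Set.Icc (0 : ℝ) T) :=
  continuous_projIcc (h := (Fact.out : 0 < T).le)

lemma monotone_clampTime [Fact (0 < T)] :
    Monotone (clampTime : ℝ → Set.Icc (0 : ℝ) T) := Set.monotone_projIcc (Fact.out : 0 < T).le

lemma pathAt_coe [Fact (0 < T)] [TopologicalSpace H] (x : PathSp T H) (t : Set.Icc (0 : ℝ) T) :
    pathAt x t = x t := by rw [pathAt, clampTime_coe]

lemma continuous_pathAt [Fact (0 < T)] [TopologicalSpace H] (x : PathSp T H) :
    Continuous (pathAt x) := x.continuous.comp continuous_clampTime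

lemma continuous_stopAt [TopologicalSpace H] :
    Continuous fun P : Set.Icc (0 : ℝ) T × PathSp T H => stopAt P.1 P.2 := by
  refine ContinuousMap.continuous_of_continuous_uncurry _ ?_
  show Continuous fun Q : (Set.Icc (0 : ℝ) T × PathSp T H) × Set.Icc (0 : ℝ) T =>
    Q.1.2 (min Q.2 Q.1.1)
  exact continuous_eval.comp (by fun_prop :
    Continuous fun Q : (Set.Icc (0 : ℝ) T × PathSp T H) × Set.Icc (0 : ℝ) T =>
      ((Q.1.2, min Q.2 Q.1.1) : PathSp T H × Set.Icc (0 : ℝ) T))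

lemma stopAt_apply_of_le [TopologicalSpace H] {t s : Set.Icc (0 : ℝ) T} (h : s ≤ t)
    (x : PathSp T H) : stopAt t x s = x s := by
  show x (min s t) = x s
  rw [min_eq_left h]

lemma stopAt_congr [TopologicalSpace H] {t : Set.Icc (0 : ℝ) T} {x y : PathSp T H}
    (h : ∀ s ≤ t, x s = y s) : stopAt t x = stopAt t y :=
  ContinuousMap.ext fun _ => h _ (min_le_right _ _)

variable [NormedAddCommGroup H]

lemma norm_apply_le_norm_stopAt {t s : Set.Icc (0 : ℝ) T} (h : s ≤ t) (x : PathSp T H) :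
    ‖x s‖ ≤ ‖stopAt t x‖ := by
  rw [← stopAt_apply_of_le h]
  exact ContinuousMap.norm_coe_le_norm _ _

lemma norm_stopAt_le (t : Set.Icc (0 : ℝ) T) (x : PathSp T H) : ‖stopAt t x‖ ≤ ‖x‖ :=
  (ContinuousMap.norm_le (stopAt t x) (norm_nonneg x)).2 fun s => x.norm_coe_le_norm (min s t)

lemma dist_timePath (P Q : TimePath T H) : dist P Q =
    |(P.time : ℝ) - Q.time| + ‖stopAt P.time P.path - stopAt Q.time Q.path‖ := rfl

/-- The product topology is finer than that of d_∞; through this map compactness of trajectory sets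
passes to tubes. -/
lemma continuous_timePath_mk :
    Continuous fun P : Set.Icc (0 : ℝ) T × PathSp T H => (⟨P.1, P.2⟩ : TimePath T H) := by
  refine continuous_iff_continuousAt.2 fun P => tendsto_iff_dist_tendsto_zero.2 ?_
  simp only [dist_timePath]
  have h1 : Continuous fun Q : Set.Icc (0 : ℝ) T × PathSp T H =>
      |(Q.1 : ℝ) - P.1| + ‖stopAt Q.1 Q.2 - stopAt P.1 P.2‖ :=
    (((continuous_subtype_val.comp continuous_fst).sub continuous_const).abs).add
      (continuous_stopAt.sub continuous_const).norm
  simpa using h1.tendsto P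

lemma continuous_time : Continuous fun P : TimePath T H => P.time := by
  refine continuous_iff_continuousAt.2 fun P => tendsto_iff_dist_tendsto_zero.2 ?_
  refine squeeze_zero (fun _ => dist_nonneg) (g := fun Q => dist Q P) (fun Q => ?_) ?_
  · rw [dist_timePath]
    exact le_add_of_nonneg_right (norm_nonneg _)
  · simpa using (continuous_id.dist (continuous_const (y := P))).tendsto P

lemma continuous_stopped : Continuous fun P : TimePath T H => stopAt P.time P.path := by
  refine continuous_iff_continuousAt.2 fun P => tendsto_iff_dist_tendsto_zero.2 ?_
  refine squeeze_zero (fun _ => dist_nonneg) (g := fun Q => dist Q P) (fun Q => ?_) ?_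
  · rw [dist_timePath, dist_eq_norm]
    exact le_add_of_nonneg_left (abs_nonneg _)
  · simpa using (continuous_id.dist (continuous_const (y := P))).tendsto P

lemma continuous_pointAt [Fact (0 < T)] (x : PathSp T H) : Continuous fun s => pointAt s x :=
  continuous_timePath_mk.comp (continuous_clampTime.prodMk continuous_const)

/-- The current value is the value at T of the stopped path, which d_∞ controls. -/
lemma continuous_current [Fact (0 < T)] : Continuous fun P : TimePath T H => P.path P.time := by
  have : (fun P : TimePath T H => P.path P.time) = fun P => stopAt P.time P.path finalTime := by
    funext P
    show _ = P.path (min finalTime P.time)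
    rw [min_eq_right]
    have := P.time.2.2
    show (P.time : ℝ) ≤ (clampTime T : Set.Icc (0 : ℝ) T)
    rwa [coe_clampTime_of_mem ⟨(Fact.out : 0 < T).le, le_rfl⟩]
  rw [this]
  exact (continuous_eval_const _).comp continuous_stopped

end Paths

/-! ### Superposition operators -/

section Superposition

variable {V : Type*} [NormedAddCommGroup V] [NormedSpace ℝ V] {T p q : ℝ}
  {A : ℝ → V → StrongDual ℝ V}

lemma aemeasurable_simpleFunc_superposition {μ : Measure ℝ}
    (hA : ∀ x v : V, AEMeasurable (fun t => A t x v) μ) (s : SimpleFunc ℝ V) (v : V) :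
    AEMeasurable (fun t => A t (s t) v) μ := by
  classical
  have h : (fun t => A t (s t) v)
      = fun t => ∑ y ∈ s.range, (s ⁻¹' {y}).indicator (fun t => A t y v) t := by
    funext t
    rw [Finset.sum_eq_single (s t)]
    · simp
    · intro y _ hy
      exact Set.indicator_of_notMem (fun h => hy (by simpa using h.symm)) _
    · intro h
      exact absurd (s.mem_range_self t) h
  rw [h]
  exact Finset.aemeasurable_fun_sum _ fun y _ => (hA y v).indicator (s.measurableSet_fiber y)

lemma restrict_Ioo_le_Icc {a : ℝ} (ha : 0 ≤ a) :
    volume.restrict (Set.Ioo a T) ≤ volume.restrict (Set.Icc 0 T) :=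
  Measure.restrict_mono (Set.Ioo_subset_Icc_self.trans (Set.Icc_subset_Icc_left ha)) le_rfl

/-- Demicontinuity of A(t, ·) replaces Carathéodory continuity: along simple functions converging to
`u` the scalar functions A(t, u(t)) v converge, the growth bound keeping the operators bounded. -/
lemma HypA.aestronglyMeasurable [TopologicalSpace.SeparableSpace V]
    [TopologicalSpace.SeparableSpace (StrongDual ℝ V)] (hA : HypA T p q A) (hp : 2 ≤ p) {a : ℝ}
    (ha : 0 ≤ a) {u : ℝ → V} (hu : AEStronglyMeasurable u (volume.restrict (Set.Ioo a T))) :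
    AEStronglyMeasurable (fun t => A t (u t)) (volume.restrict (Set.Ioo a T)) := by
  have hle := restrict_Ioo_le_Icc (T := T) ha
  refine aestronglyMeasurable_dual_of_apply fun v => ?_
  obtain ⟨a₁, c₁, -, hc₁, -, hbd⟩ := hA.bounded
  set s : ℕ → SimpleFunc ℝ V := hu.stronglyMeasurable_mk.approx
  refine aemeasurable_of_tendsto_metrizable_ae atTop (f := fun n t => A t (s n t) v)
    (fun n => aemeasurable_simpleFunc_superposition
      (fun x v => (hA.measurable x v).mono_measure hle) (s n) v) ?_
  filter_upwards [hu.ae_eq_mk, ae_mono hle hA.monotone, ae_mono hle hA.hemicontinuous,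
    ae_mono hle hbd] with t h1 h2 h3 h4
  have hs : Tendsto (fun n => s n t) atTop (𝓝 (u t)) := by
    rw [h1]; exact hu.stronglyMeasurable_mk.tendsto_approx t
  obtain ⟨R, hR⟩ := hs.norm.bddAbove_range
  refine demicontinuous_of_monotone h2 h3 hs (R := a₁ t + c₁ * R ^ (p - 1)) (fun n => ?_) v
  refine (h4 _).trans ?_
  gcongr
  · linarith
  · exact hR ⟨n, rfl⟩

/-- The growth condition and q(p-1) = p. The constant depends on `u` only through `M`, which allows
weak limits to be extracted from the terms A(t, x_n). -/
lemma eLpNorm_superposition_le [TopologicalSpace.SeparableSpace V]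
    [TopologicalSpace.SeparableSpace (StrongDual ℝ V)] (hA : HypA T p q A) (hp : 2 ≤ p)
    (hpq : p.HolderConjugate q) {a : ℝ} (ha : 0 ≤ a) {M : ENNReal} (hM : M ≠ ⊤) :
    ∃ C : ENNReal, C ≠ ⊤ ∧ ∀ u : ℝ → V,
      AEStronglyMeasurable u (volume.restrict (Set.Ioo a T)) →
      eLpNorm u (ENNReal.ofReal p) (volume.restrict (Set.Ioo a T)) ≤ M →
      eLpNorm (fun t => A t (u t)) (ENNReal.ofReal q) (volume.restrict (Set.Ioo a T)) ≤ C := by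
  have hle := restrict_Ioo_le_Icc (T := T) ha
  set μ := volume.restrict (Set.Ioo a T)
  obtain ⟨a₁, c₁, ha₁, hc₁, hmem, hbd⟩ := hA.bounded
  have hmem' : MemLp a₁ (ENNReal.ofReal q) μ := hmem.mono_measure hle
  have hp1 : 0 < p - 1 := by linarith
  refine ⟨eLpNorm a₁ (ENNReal.ofReal q) μ + ENNReal.ofReal c₁ * M ^ (p - 1), ?_, fun u hu huM => ?_⟩
  · exact ENNReal.add_ne_top.2 ⟨hmem'.2.ne, ENNReal.mul_ne_top ENNReal.ofReal_ne_top
      (ENNReal.rpow_ne_top_of_nonneg hp1.le hM)⟩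
  have hm2 : AEStronglyMeasurable (fun t => ‖u t‖ ^ (p - 1)) μ :=
    (hu.norm.aemeasurable.pow_const _).aestronglyMeasurable
  have h1 : eLpNorm (fun t => A t (u t)) (ENNReal.ofReal q) μ
      ≤ eLpNorm (a₁ + c₁ • fun t => ‖u t‖ ^ (p - 1)) (ENNReal.ofReal q) μ := by
    refine eLpNorm_mono_ae ?_
    filter_upwards [ae_mono hle hbd] with t ht
    refine (ht (u t)).trans (le_trans ?_ (le_abs_self _))
    simp
  refine h1.trans ((eLpNorm_add_le hmem'.1 (hm2.const_smul c₁) ?_).trans ?_)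
  · rw [← ENNReal.ofReal_one]; exact ENNReal.ofReal_le_ofReal hpq.symm.lt.le
  · gcongr
    refine (eLpNorm_const_smul_le).trans ?_
    rw [eLpNorm_norm_rpow u hp1, ← ENNReal.ofReal_mul hpq.symm.pos.le]
    have hqp : q * (p - 1) = p := by
      have := hpq.mul_eq_add
      linarith
    rw [hqp]
    have hcc : ‖c₁‖ₑ = ENNReal.ofReal c₁ := Real.enorm_of_nonneg hc₁
    rw [hcc]
    gcongr

lemma HypA.memLp [TopologicalSpace.SeparableSpace V]
    [TopologicalSpace.SeparableSpace (StrongDual ℝ V)] (hA : HypA T p q A) (hp : 2 ≤ p)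
    (hpq : p.HolderConjugate q) {a : ℝ} (ha : 0 ≤ a) {u : ℝ → V}
    (hu : MemLp u (ENNReal.ofReal p) (volume.restrict (Set.Ioo a T))) :
    MemLp (fun t => A t (u t)) (ENNReal.ofReal q) (volume.restrict (Set.Ioo a T)) := by
  obtain ⟨C, hC, h⟩ := eLpNorm_superposition_le hA hp hpq ha hu.2.ne
  exact ⟨hA.aestronglyMeasurable hp ha hu.1, (h u hu.1 le_rfl).trans_lt hC.lt_top⟩

lemma integrable_pairing (hpq : p.HolderConjugate q) {μ : Measure ℝ} {u : ℝ → V}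
    {w : ℝ → StrongDual ℝ V} (hw : MemLp w (ENNReal.ofReal q) μ)
    (hu : MemLp u (ENNReal.ofReal p) μ) : Integrable (fun r => w r (u r)) μ := by
  have hH : ENNReal.HolderConjugate (ENNReal.ofReal q) (ENNReal.ofReal p) :=
    hpq.symm.ennrealOfReal
  rw [← memLp_one_iff_integrable]
  exact (ContinuousLinearMap.id ℝ (StrongDual ℝ V)).memLp_of_bilin 1 hw hu

end Superposition

/-! ### Trajectories as solutions of an integral equation -/

section Solutions

variable {T : ℝ} [Fact (0 < T)] {V H : Type*} [NormedAddCommGroup V] [NormedSpace ℝ V]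
  [NormedAddCommGroup H] [InnerProductSpace ℝ H] {ι : V →L[ℝ] H} {p q : ℝ}
  {A : ℝ → V → StrongDual ℝ V}

lemma one_le_ofReal_conj (hpq : p.HolderConjugate q) : 1 ≤ ENNReal.ofReal q := by
  rw [← ENNReal.ofReal_one]; exact ENNReal.ofReal_le_ofReal hpq.symm.lt.le

lemma inner_sub_eq_integral_of_memW (hpq : p.HolderConjugate q) {t₀ : Set.Icc (0 : ℝ) T}
    {x : PathSp T H} {x' : ℝ → StrongDual ℝ V} (h : MemW ι p q t₀ x x') (v : V) {s t : ℝ}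
    (hs : s ∈ Set.Icc (t₀ : ℝ) T) (ht : t ∈ Set.Icc (t₀ : ℝ) T) :
    inner ℝ (pathAt x t - pathAt x s) (ι v) = ∫ r in s..t, x' r v := by
  have hx'i : Integrable x' (volume.restrict (Set.Ioo (t₀ : ℝ) T)) :=
    h.memLp_deriv.integrable (one_le_ofReal_conj hpq)
  have hc : Continuous fun t => inner ℝ (pathAt x t) (ι v) :=
    (continuous_pathAt x).inner continuous_const
  rw [inner_sub_left]
  refine sub_eq_integral_of_weak_deriv (g := fun t => inner ℝ (pathAt x t) (ι v))
    hc.continuousOn (hx'i.apply_continuousLinearMap v) (fun η h1 h2 h3 => ?_) hs ht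
  have h4 := congrArg (fun φ : StrongDual ℝ V => φ v) (h.weak_deriv η h1 h2 h3)
  simp only [_root_.neg_apply] at h4
  have hdc : Continuous (deriv η) := h1.continuous_deriv (by simp)
  have i1 : Integrable (fun t => deriv η t • toDual ι (pathAt x t))
      (volume.restrict (Set.Ioo (t₀ : ℝ) T)) :=
    ((hdc.smul ((toDualL ι).continuous.comp (continuous_pathAt x))).integrableOn_Icc).mono_set
      Set.Ioo_subset_Icc_self
  have i2 : Integrable (fun t => η t • x' t) (volume.restrict (Set.Ioo (t₀ : ℝ) T)) := by
    obtain ⟨C, hC⟩ := h2.exists_bound_of_continuous h1.continuous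
    exact hx'i.bdd_smul C h1.continuous.aestronglyMeasurable (Eventually.of_forall hC)
  rw [ContinuousLinearMap.integral_apply i1, ContinuousLinearMap.integral_apply i2] at h4
  exact h4

/-- `x` solves `x' + A(t,x) = f` on `(t₀,T)`, in integrated form. -/
structure IsSol (ι : V →L[ℝ] H) (p : ℝ) (A : ℝ → V → StrongDual ℝ V) (t₀ : Set.Icc (0 : ℝ) T)
    (x : PathSp T H) (f : ℝ → H) : Prop where
  mem_range : ∀ᵐ t ∂(volume.restrict (Set.Ioo (t₀ : ℝ) T)), pathAt x t ∈ Set.range ι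
  memLp : MemLp (fun t => toV ι (pathAt x t)) (ENNReal.ofReal p)
    (volume.restrict (Set.Ioo (t₀ : ℝ) T))
  memLp_source : MemLp f 2 (volume.restrict (Set.Ioo (t₀ : ℝ) T))
  eqn : ∀ t ∈ Set.Icc (t₀ : ℝ) T, ∀ v, inner ℝ (pathAt x t - pathAt x t₀) (ι v)
    = ∫ r in (t₀ : ℝ)..t, (inner ℝ (f r) (ι v) - A r (toV ι (pathAt x r)) v)

/-- The derivative `f - A(t,x)` of a solution. -/
def solDeriv (ι : V →L[ℝ] H) (A : ℝ → V → StrongDual ℝ V) (x : PathSp T H) (f : ℝ → H) (r : ℝ) :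
    StrongDual ℝ V := toDual ι (f r) - A r (toV ι (pathAt x r))

section Separable

variable [TopologicalSpace.SeparableSpace V] [TopologicalSpace.SeparableSpace (StrongDual ℝ V)]

lemma le_two_of_conj (hp : 2 ≤ p) (hpq : p.HolderConjugate q) : q ≤ 2 := by
  have h1 := hpq.mul_eq_add
  have h2 := hpq.symm.pos
  nlinarith

lemma memLp_toDual (hp : 2 ≤ p) (hpq : p.HolderConjugate q) {a b : ℝ} {f : ℝ → H}
    (hf : MemLp f 2 (volume.restrict (Set.Ioo a b))) :
    MemLp (fun r => toDual ι (f r)) (ENNReal.ofReal q) (volume.restrict (Set.Ioo a b)) := by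
  refine ((toDualL ι).comp_memLp' hf).mono_exponent ?_
  rw [← ENNReal.ofReal_ofNat]
  exact ENNReal.ofReal_le_ofReal (le_two_of_conj hp hpq)

lemma memLp_solDeriv (hA : HypA T p q A) (hp : 2 ≤ p) (hpq : p.HolderConjugate q)
    {t₀ : Set.Icc (0 : ℝ) T} {x : PathSp T H} {f : ℝ → H}
    (hu : MemLp (fun t => toV ι (pathAt x t)) (ENNReal.ofReal p)
      (volume.restrict (Set.Ioo (t₀ : ℝ) T)))
    (hf : MemLp f 2 (volume.restrict (Set.Ioo (t₀ : ℝ) T))) :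
    MemLp (solDeriv ι A x f) (ENNReal.ofReal q) (volume.restrict (Set.Ioo (t₀ : ℝ) T)) :=
  (memLp_toDual hp hpq hf).sub (hA.memLp hp hpq t₀.2.1 hu)

lemma IsSol.memW (hA : HypA T p q A) (hp : 2 ≤ p) (hpq : p.HolderConjugate q)
    {t₀ : Set.Icc (0 : ℝ) T} {x : PathSp T H} {f : ℝ → H} (h : IsSol ι p A t₀ x f) :
    MemW ι p q t₀ x (solDeriv ι A x f) := by
  have hmem := memLp_solDeriv hA hp hpq h.memLp h.memLp_source
  refine ⟨h.mem_range, h.memLp, hmem, fun η h1 h2 h3 => ?_⟩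
  have hx'i := hmem.integrable (one_le_ofReal_conj hpq)
  have hdc : Continuous (deriv η) := h1.continuous_deriv (by simp)
  have i1 : Integrable (fun t => deriv η t • toDual ι (pathAt x t))
      (volume.restrict (Set.Ioo (t₀ : ℝ) T)) :=
    ((hdc.smul ((toDualL ι).continuous.comp (continuous_pathAt x))).integrableOn_Icc).mono_set
      Set.Ioo_subset_Icc_self
  have i2 : Integrable (fun t => η t • solDeriv ι A x f t)
      (volume.restrict (Set.Ioo (t₀ : ℝ) T)) := by
    obtain ⟨C, hC⟩ := h2.exists_bound_of_continuous h1.continuous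
    exact hx'i.bdd_smul C h1.continuous.aestronglyMeasurable (Eventually.of_forall hC)
  ext v
  rw [_root_.neg_apply, ContinuousLinearMap.integral_apply i1,
    ContinuousLinearMap.integral_apply i2]
  refine weak_deriv_of_sub_eq_integral t₀.2.2 (g := fun t => inner ℝ (pathAt x t) (ι v))
    (k := fun t => solDeriv ι A x f t v) (hx'i.apply_continuousLinearMap v) (fun t ht => ?_) h1 h3
  rw [← inner_sub_left, h.eqn t ht v]
  rfl

lemma MemW.isSol (hpq : p.HolderConjugate q) {t₀ : Set.Icc (0 : ℝ) T} {x : PathSp T H}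
    {x' : ℝ → StrongDual ℝ V} {f : ℝ → H} (h : MemW ι p q t₀ x x')
    (hf : MemLp f 2 (volume.restrict (Set.Ioo (t₀ : ℝ) T)))
    (he : ∀ᵐ t ∂(volume.restrict (Set.Ioo (t₀ : ℝ) T)),
      x' t + A t (toV ι (pathAt x t)) = toDual ι (f t)) : IsSol ι p A t₀ x f := by
  refine ⟨h.mem_range, h.memLp, hf, fun t ht v => ?_⟩
  rw [inner_sub_eq_integral_of_memW hpq h v ⟨le_rfl, t₀.2.2⟩ ht]
  rw [intervalIntegral.integral_of_le ht.1, intervalIntegral.integral_of_le ht.1,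
    integral_Ioc_eq_integral_Ioo, integral_Ioc_eq_integral_Ioo]
  refine integral_congr_ae (ae_restrict_of_ae_restrict_of_subset
    (Set.Ioo_subset_Ioo_right ht.2) ?_)
  filter_upwards [he] with r hr
  rw [← toDual_apply, ← hr, _root_.add_apply]; ring

/-- The integrated equation involves only point values of the path and integrals that are weakly
continuous in the source, so it is the form in which limits are taken. -/
lemma mem_trajectories_iff (hA : HypA T p q A) (hp : 2 ≤ p) (hpq : p.HolderConjugate q) {L : ℝ}
    {t₀ : Set.Icc (0 : ℝ) T} {x₀ x : PathSp T H} :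
    x ∈ trajectories ι p q A L t₀ x₀ ↔ (∀ t ≤ t₀, x t = x₀ t) ∧ ∃ f, IsSol ι p A t₀ x f ∧
      ∀ᵐ t ∂(volume.restrict (Set.Ioo (t₀ : ℝ) T)), ‖f t‖ ≤ L * (1 + ‖stopAt (clampTime t) x‖) := by
  constructor
  · rintro ⟨h1, x', f, h2, h3, h4⟩
    exact ⟨h1, f, h2.isSol hpq h3 (h4.mono fun _ h => h.1), h4.mono fun _ h => h.2⟩
  · rintro ⟨h1, f, h2, h3⟩
    refine ⟨h1, _, f, h2.memW hA hp hpq, h2.memLp_source, h3.mono fun t h => ⟨?_, h⟩⟩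
    exact sub_add_cancel _ _

lemma integrable_inner_const {a b : ℝ} {f : ℝ → H}
    (hf : MemLp f 2 (volume.restrict (Set.Ioo a b))) (h : H) :
    Integrable (fun r => inner ℝ (f r) h) (volume.restrict (Set.Ioo a b)) := by
  have : Integrable f (volume.restrict (Set.Ioo a b)) := hf.integrable (by norm_num)
  exact this.inner_const h

lemma intervalIntegrable_of_Ioo {a b s t : ℝ} {E : Type*} [NormedAddCommGroup E] {k : ℝ → E}
    (hk : Integrable k (volume.restrict (Set.Ioo a b))) (hs : s ∈ Set.Icc a b)
    (ht : t ∈ Set.Icc a b) : IntervalIntegrable k volume s t := by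
  have hab := hs.1.trans hs.2
  have : IntervalIntegrable k volume a b := by
    rw [intervalIntegrable_iff_integrableOn_Ioo_of_le hab]; exact hk
  refine this.mono_set ?_
  rw [Set.uIcc_of_le hab]
  exact Set.uIcc_subset_Icc hs ht

lemma IsSol.integrable_A (hA : HypA T p q A) (hp : 2 ≤ p) (hpq : p.HolderConjugate q)
    {t₀ : Set.Icc (0 : ℝ) T} {x : PathSp T H} {f : ℝ → H} (h : IsSol ι p A t₀ x f) :
    Integrable (fun r => A r (toV ι (pathAt x r))) (volume.restrict (Set.Ioo (t₀ : ℝ) T)) :=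
  (hA.memLp hp hpq t₀.2.1 h.memLp).integrable (one_le_ofReal_conj hpq)

/-- The equation eliminates the nonlinear operator: the right side is continuous in the path for
uniform convergence and in the source for weak convergence. Compactness, the continuity of
`tildePhi` and the reduction to affine test functionals all use this. -/
lemma IsSol.integral_A (hA : HypA T p q A) (hp : 2 ≤ p) (hpq : p.HolderConjugate q)
    {t₀ : Set.Icc (0 : ℝ) T} {x : PathSp T H} {f : ℝ → H} (h : IsSol ι p A t₀ x f) {t : ℝ}
    (ht : t ∈ Set.Icc (t₀ : ℝ) T) (v : V) :
    ∫ r in (t₀ : ℝ)..t, A r (toV ι (pathAt x r)) v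
      = (∫ r in (t₀ : ℝ)..t, inner ℝ (f r) (ι v)) - inner ℝ (pathAt x t - pathAt x t₀) (ι v) := by
  have h0 : (t₀ : ℝ) ∈ Set.Icc (t₀ : ℝ) T := ⟨le_rfl, t₀.2.2⟩
  rw [h.eqn t ht v, intervalIntegral.integral_sub
    (intervalIntegrable_of_Ioo (integrable_inner_const h.memLp_source _) h0 ht)
    (intervalIntegrable_of_Ioo ((h.integrable_A hA hp hpq).apply_continuousLinearMap v) h0 ht)]
  ring

/-! #### Restriction and concatenation -/

lemma IsSol.restrict (hA : HypA T p q A) (hp : 2 ≤ p) (hpq : p.HolderConjugate q)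
    {t₀ t₁ : Set.Icc (0 : ℝ) T} (h01 : t₀ ≤ t₁) {x : PathSp T H} {f : ℝ → H}
    (h : IsSol ι p A t₀ x f) : IsSol ι p A t₁ x f := by
  have hsub : Set.Ioo (t₁ : ℝ) T ⊆ Set.Ioo (t₀ : ℝ) T := Set.Ioo_subset_Ioo_left h01
  have hle : volume.restrict (Set.Ioo (t₁ : ℝ) T) ≤ volume.restrict (Set.Ioo (t₀ : ℝ) T) :=
    Measure.restrict_mono hsub le_rfl
  refine ⟨ae_mono hle h.mem_range, h.memLp.mono_measure hle, h.memLp_source.mono_measure hle,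
    fun t ht v => ?_⟩
  have h0 : (t₀ : ℝ) ∈ Set.Icc (t₀ : ℝ) T := ⟨le_rfl, t₀.2.2⟩
  have h1 : (t₁ : ℝ) ∈ Set.Icc (t₀ : ℝ) T := ⟨h01, t₁.2.2⟩
  have h2 : t ∈ Set.Icc (t₀ : ℝ) T := ⟨le_trans h01 ht.1, ht.2⟩
  have hi := (integrable_inner_const h.memLp_source (ι v)).sub
    ((h.integrable_A hA hp hpq).apply_continuousLinearMap v)
  rw [← sub_sub_sub_cancel_right _ _ (pathAt x t₀), inner_sub_left, h.eqn t h2 v, h.eqn _ h1 v]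
  exact intervalIntegral.integral_interval_sub_left (intervalIntegrable_of_Ioo hi h0 h2)
    (intervalIntegrable_of_Ioo hi h0 h1)

lemma pathAt_congr {t₁ : Set.Icc (0 : ℝ) T} {x y : PathSp T H} (hxy : ∀ t ≤ t₁, x t = y t) {r : ℝ}
    (hr : r ≤ t₁) : pathAt x r = pathAt y r :=
  hxy _ (by have := monotone_clampTime (T := T) hr; rwa [clampTime_coe] at this)

/-- One half of the flow property, with `trajectories_concat` as the other: a trajectory may be
restarted at a later time, and trajectories may be glued. -/
lemma trajectories_restrict (hA : HypA T p q A) (hp : 2 ≤ p) (hpq : p.HolderConjugate q) {L : ℝ}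
    {t₀ t₁ : Set.Icc (0 : ℝ) T} (h01 : t₀ ≤ t₁) {x₀ x y : PathSp T H}
    (hx : x ∈ trajectories ι p q A L t₀ x₀) (hxy : ∀ t ≤ t₁, x t = y t) :
    x ∈ trajectories ι p q A L t₁ y := by
  rw [mem_trajectories_iff hA hp hpq] at hx ⊢
  obtain ⟨-, f, h2, h3⟩ := hx
  exact ⟨hxy, f, h2.restrict hA hp hpq h01,
    ae_restrict_of_ae_restrict_of_subset (Set.Ioo_subset_Ioo_left h01) h3⟩

lemma ae_Ioo_of_ae {a b c : ℝ} {P Q : ℝ → Prop}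
    (h1 : ∀ᵐ t ∂volume.restrict (Set.Ioo a c), P t) (h2 : ∀ᵐ t ∂volume.restrict (Set.Ioo b c), Q t) :
    ∀ᵐ t ∂volume.restrict (Set.Ioo a c), (t < b ∧ P t) ∨ (b < t ∧ Q t) := by
  rw [ae_restrict_iff' measurableSet_Ioo] at h1 h2 ⊢
  have hne : ∀ᵐ t : ℝ, t ≠ b := by simp [ae_iff, measure_singleton]
  filter_upwards [h1, h2, hne] with t h1 h2 h3 ht
  rcases lt_or_gt_of_ne h3 with h | h
  · exact Or.inl ⟨h, h1 ht⟩
  · exact Or.inr ⟨h, h2 ⟨h, ht.2⟩⟩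

lemma memLp_Ioo_concat {E : Type*} [NormedAddCommGroup E] {a b c : ℝ} {r : ENNReal} {f g k : ℝ → E}
    (hf : MemLp f r (volume.restrict (Set.Ioo a c)))
    (hg : MemLp g r (volume.restrict (Set.Ioo b c)))
    (hk1 : ∀ t < b, k t = f t) (hk2 : ∀ t, b < t → k t = g t) :
    MemLp k r (volume.restrict (Set.Ioo a c)) := by
  have h1 : MemLp ((Set.Iio b).indicator f) r (volume.restrict (Set.Ioo a c)) :=
    hf.indicator measurableSet_Iio
  have h2 : MemLp ((Set.Ioo b c).indicator g) r (volume.restrict (Set.Ioo a c)) :=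
    ((memLp_indicator_iff_restrict measurableSet_Ioo).2 hg).mono_measure Measure.restrict_le_self
  refine (h1.add h2).ae_eq ?_
  filter_upwards [ae_Ioo_of_ae (b := b) (ae_restrict_mem (measurableSet_Ioo (a := a) (b := c)))
    (ae_restrict_mem (measurableSet_Ioo (a := b) (b := c)))] with t ht
  rcases ht with ⟨h, -⟩ | ⟨h, h'⟩
  · rw [Pi.add_apply, Set.indicator_of_mem (by exact h), Set.indicator_of_notMem, add_zero, hk1 t h]
    exact fun h' => lt_asymm h h'.1
  · rw [Pi.add_apply, Set.indicator_of_notMem (by simpa using h.le), Set.indicator_of_mem h',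
      zero_add, hk2 t h]

lemma trajectories_concat (hA : HypA T p q A) (hp : 2 ≤ p) (hpq : p.HolderConjugate q) {L : ℝ}
    {t₀ t₁ : Set.Icc (0 : ℝ) T} (h01 : t₀ ≤ t₁) {x₀ y x : PathSp T H}
    (hy : y ∈ trajectories ι p q A L t₀ x₀) (hx : x ∈ trajectories ι p q A L t₁ y) :
    x ∈ trajectories ι p q A L t₀ x₀ := by
  rw [mem_trajectories_iff hA hp hpq] at hx hy ⊢
  obtain ⟨hyx₀, f, hf, hfL⟩ := hy
  obtain ⟨hxy, g, hg, hgL⟩ := hx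
  have hpath : ∀ r, r ≤ (t₁ : ℝ) → pathAt x r = pathAt y r := fun r hr => pathAt_congr hxy hr
  set k : ℝ → H := fun r => if r < t₁ then f r else g r
  have hk1 : ∀ r < (t₁ : ℝ), k r = f r := fun r hr => if_pos hr
  have hk2 : ∀ r, (t₁ : ℝ) < r → k r = g r := fun r hr => if_neg hr.not_gt
  have hu : MemLp (fun t => toV ι (pathAt x t)) (ENNReal.ofReal p)
      (volume.restrict (Set.Ioo (t₀ : ℝ) T)) :=
    memLp_Ioo_concat hf.memLp hg.memLp (fun t ht => by rw [hpath t ht.le]) fun _ _ => rfl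
  have hkL : MemLp k 2 (volume.restrict (Set.Ioo (t₀ : ℝ) T)) :=
    memLp_Ioo_concat hf.memLp_source hg.memLp_source hk1 hk2
  have h0 : (t₀ : ℝ) ∈ Set.Icc (t₀ : ℝ) T := ⟨le_rfl, t₀.2.2⟩
  have h1 : (t₁ : ℝ) ∈ Set.Icc (t₀ : ℝ) T := ⟨h01, t₁.2.2⟩
  have ha : ∀ t ∈ Set.Icc (t₀ : ℝ) T, t ≤ t₁ → ∀ v,
      inner ℝ (pathAt x t - pathAt x t₀) (ι v)
      = ∫ r in (t₀ : ℝ)..t, (inner ℝ (k r) (ι v) - A r (toV ι (pathAt x r)) v) := by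
    intro t ht htt v
    rw [hpath t htt, hpath _ h01, hf.eqn t ht v, intervalIntegral.integral_of_le ht.1,
      intervalIntegral.integral_of_le ht.1, integral_Ioc_eq_integral_Ioo,
      integral_Ioc_eq_integral_Ioo]
    refine setIntegral_congr_fun measurableSet_Ioo fun r hr => ?_
    rw [hk1 r (hr.2.trans_le htt), hpath r (hr.2.le.trans htt)]
  refine ⟨fun t ht => (hxy t (ht.trans h01)).trans (hyx₀ t ht), k, ⟨?_, hu, hkL, fun t ht v => ?_⟩, ?_⟩
  · filter_upwards [ae_Ioo_of_ae hf.mem_range hg.mem_range] with t ht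
    rcases ht with ⟨h, h'⟩ | ⟨-, h'⟩
    · rwa [hpath t h.le]
    · exact h'
  · rcases le_total t t₁ with htt | htt
    · exact ha t ht htt v
    · have hi : Integrable (fun r => inner ℝ (k r) (ι v) - A r (toV ι (pathAt x r)) v)
        (volume.restrict (Set.Ioo (t₀ : ℝ) T)) := (integrable_inner_const hkL (ι v)).sub
        (((hA.memLp hp hpq t₀.2.1 hu).integrable
          (one_le_ofReal_conj hpq)).apply_continuousLinearMap v)
      rw [← intervalIntegral.integral_add_adjacent_intervals
        (intervalIntegrable_of_Ioo hi h0 h1) (intervalIntegrable_of_Ioo hi h1 ht),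
        ← ha _ h1 le_rfl v, ← sub_add_sub_cancel (pathAt x t) (pathAt x t₁), inner_add_left,
        add_comm, hg.eqn t ⟨htt, ht.2⟩ v]
      congr 1
      rw [intervalIntegral.integral_of_le htt, intervalIntegral.integral_of_le htt]
      refine setIntegral_congr_fun measurableSet_Ioc fun r hr => ?_
      rw [hk2 r hr.1]
  · filter_upwards [ae_Ioo_of_ae hfL hgL] with t ht
    rcases ht with ⟨h, h'⟩ | ⟨h, h'⟩
    · rw [hk1 t h, stopAt_congr (y := y)]
      · exact h'
      · intro s hs
        refine hxy s (hs.trans ?_)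
        have := monotone_clampTime (T := T) h.le
        rwa [clampTime_coe] at this
    · rwa [hk2 t h]

end Separable

end Solutions

/-! ### Energy estimates -/

section Energy

variable {T : ℝ} [Fact (0 < T)] {V H : Type*} [NormedAddCommGroup V] [NormedSpace ℝ V]
  [NormedAddCommGroup H] [InnerProductSpace ℝ H] {ι : V →L[ℝ] H} {p q : ℝ}
  {A : ℝ → V → StrongDual ℝ V}

lemma integrable_inner_continuous {a b : ℝ} {f : ℝ → H}
    (hf : MemLp f 2 (volume.restrict (Set.Ioo a b))) {x : ℝ → H} (hx : Continuous x) :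
    Integrable (fun r => inner ℝ (f r) (x r)) (volume.restrict (Set.Ioo a b)) := by
  have hfi : Integrable f (volume.restrict (Set.Ioo a b)) := hf.integrable (by norm_num)
  obtain ⟨C, hC⟩ := isCompact_Icc.exists_bound_of_continuousOn (s := Set.Icc a b) hx.continuousOn
  refine (hfi.norm.mul_const C).mono' (hfi.1.inner hx.aestronglyMeasurable) ?_
  filter_upwards [ae_restrict_mem measurableSet_Ioo] with r hr
  exact (norm_inner_le_norm _ _).trans
    (mul_le_mul_of_nonneg_left (hC r ⟨hr.1.le, hr.2.le⟩) (norm_nonneg _))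

lemma integral_congr_Ioo {a b s t : ℝ} (hs : s ∈ Set.Icc a b) (ht : t ∈ Set.Icc a b) (hst : s ≤ t)
    {E : Type*} [NormedAddCommGroup E] [NormedSpace ℝ E] {f g : ℝ → E}
    (h : ∀ᵐ r ∂volume.restrict (Set.Ioo a b), f r = g r) :
    ∫ r in s..t, f r = ∫ r in s..t, g r := by
  rw [intervalIntegral.integral_of_le hst, intervalIntegral.integral_of_le hst,
    integral_Ioc_eq_integral_Ioo, integral_Ioc_eq_integral_Ioo]
  exact integral_congr_ae (ae_restrict_of_ae_restrict_of_subset (Set.Ioo_subset_Ioo hs.1 ht.2) h)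

variable [TopologicalSpace.SeparableSpace V] [TopologicalSpace.SeparableSpace (StrongDual ℝ V)]

lemma IsSol.energy (hA : HypA T p q A) (hp : 2 ≤ p) (hpq : p.HolderConjugate q)
    {t₀ : Set.Icc (0 : ℝ) T} {x : PathSp T H} {f : ℝ → H} (h : IsSol ι p A t₀ x f) {t : ℝ}
    (ht : t ∈ Set.Icc (t₀ : ℝ) T) :
    ‖pathAt x t‖ ^ 2 + 2 * ∫ r in (t₀ : ℝ)..t, A r (toV ι (pathAt x r)) (toV ι (pathAt x r))
      = ‖pathAt x t₀‖ ^ 2 + 2 * ∫ r in (t₀ : ℝ)..t, inner ℝ (f r) (pathAt x r) := by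
  have h0 : (t₀ : ℝ) ∈ Set.Icc (t₀ : ℝ) T := ⟨le_rfl, t₀.2.2⟩
  have h1 := energy_identity ι hpq (continuous_pathAt x).continuousOn h.memLp
    (memLp_solDeriv hA hp hpq h.memLp h.memLp_source)
    (h.mem_range.mono fun r hr => (map_toV hr).symm) (fun t ht v => h.eqn t ht v) le_rfl ht.1 ht.2
  have i1 := integrable_inner_continuous h.memLp_source (continuous_pathAt x)
  have i2 := integrable_pairing hpq (hA.memLp hp hpq t₀.2.1 h.memLp) h.memLp
  have h2 : ∫ r in (t₀ : ℝ)..t, solDeriv ι A x f r (toV ι (pathAt x r))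
      = (∫ r in (t₀ : ℝ)..t, inner ℝ (f r) (pathAt x r))
        - ∫ r in (t₀ : ℝ)..t, A r (toV ι (pathAt x r)) (toV ι (pathAt x r)) := by
    rw [← intervalIntegral.integral_sub (intervalIntegrable_of_Ioo i1 h0 ht)
      (intervalIntegrable_of_Ioo i2 h0 ht)]
    refine integral_congr_Ioo h0 ht ht.1 ?_
    filter_upwards [h.mem_range] with r hr
    rw [solDeriv, _root_.sub_apply, toDual_apply, map_toV hr]
  rw [h2] at h1
  linarith

/-- The term with A is nonnegative by monotonicity, so the distance of two solutions with equal
initial value is governed by their sources alone. -/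
lemma IsSol.diff_energy (hA : HypA T p q A) (hp : 2 ≤ p) (hpq : p.HolderConjugate q)
    {t₀ : Set.Icc (0 : ℝ) T} {x y : PathSp T H} {f g : ℝ → H} (hx : IsSol ι p A t₀ x f)
    (hy : IsSol ι p A t₀ y g) (hxy : pathAt x t₀ = pathAt y t₀) {t : ℝ}
    (ht : t ∈ Set.Icc (t₀ : ℝ) T) :
    ‖pathAt x t - pathAt y t‖ ^ 2 + 2 * ∫ r in (t₀ : ℝ)..t,
        (A r (toV ι (pathAt x r)) - A r (toV ι (pathAt y r)))
          (toV ι (pathAt x r) - toV ι (pathAt y r))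
      = 2 * ∫ r in (t₀ : ℝ)..t, inner ℝ (f r - g r) (pathAt x r - pathAt y r) := by
  have h0 : (t₀ : ℝ) ∈ Set.Icc (t₀ : ℝ) T := ⟨le_rfl, t₀.2.2⟩
  have hc : Continuous fun r => pathAt x r - pathAt y r :=
    (continuous_pathAt x).sub (continuous_pathAt y)
  have mx := memLp_solDeriv hA hp hpq hx.memLp hx.memLp_source
  have my := memLp_solDeriv hA hp hpq hy.memLp hy.memLp_source
  have h1 := energy_identity ι hpq hc.continuousOn (hx.memLp.sub hy.memLp) (mx.sub my)
    (by
      filter_upwards [hx.mem_range, hy.mem_range] with r h1 h2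
      rw [Pi.sub_apply, map_sub, map_toV h1, map_toV h2])
    (fun t ht v => by
      rw [sub_sub_sub_comm, inner_sub_left, hx.eqn t ht v, hy.eqn t ht v]
      refine (intervalIntegral.integral_sub ?_ ?_).symm
      · exact intervalIntegrable_of_Ioo ((mx.integrable
          (one_le_ofReal_conj hpq)).apply_continuousLinearMap v) h0 ht
      · exact intervalIntegrable_of_Ioo ((my.integrable
          (one_le_ofReal_conj hpq)).apply_continuousLinearMap v) h0 ht) le_rfl ht.1 ht.2
  have i1 := integrable_inner_continuous (hx.memLp_source.sub hy.memLp_source) hc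
  have i2 := integrable_pairing hpq ((hA.memLp hp hpq t₀.2.1 hx.memLp).sub
    (hA.memLp hp hpq t₀.2.1 hy.memLp)) (hx.memLp.sub hy.memLp)
  simp only [Pi.sub_apply] at i1 i2
  have h2 : ∫ r in (t₀ : ℝ)..t, (solDeriv ι A x f - solDeriv ι A y g) r
        (((fun t => toV ι (pathAt x t)) - fun t => toV ι (pathAt y t)) r)
      = (∫ r in (t₀ : ℝ)..t, inner ℝ (f r - g r) (pathAt x r - pathAt y r))
        - ∫ r in (t₀ : ℝ)..t, (A r (toV ι (pathAt x r)) - A r (toV ι (pathAt y r)))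
          (toV ι (pathAt x r) - toV ι (pathAt y r)) := by
    rw [← intervalIntegral.integral_sub (intervalIntegrable_of_Ioo i1 h0 ht)
      (intervalIntegrable_of_Ioo i2 h0 ht)]
    refine integral_congr_Ioo h0 ht ht.1 ?_
    filter_upwards [hx.mem_range, hy.mem_range] with r hr hr'
    have e : pathAt x r - pathAt y r = ι (toV ι (pathAt x r) - toV ι (pathAt y r)) := by
      rw [map_sub, map_toV hr, map_toV hr']
    rw [e]
    simp only [solDeriv, Pi.sub_apply, _root_.sub_apply, toDual_apply, inner_sub_left]
    ring
  rw [h2, hxy, sub_self, norm_zero] at h1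
  linarith

/-- A priori bounds for the trajectories with given initial path. -/
theorem exists_apriori_bound (hA : HypA T p q A) (hp : 2 ≤ p) (hpq : p.HolderConjugate q) {L : ℝ}
    (hL : 0 ≤ L) (t₀ : Set.Icc (0 : ℝ) T) (x₀ : PathSp T H) :
    ∃ (C : ℝ) (M : ENNReal), 0 ≤ C ∧ M ≠ ⊤ ∧ ∀ (x : PathSp T H) (f : ℝ → H),
      (∀ t ≤ t₀, x t = x₀ t) → IsSol ι p A t₀ x f →
      (∀ᵐ t ∂(volume.restrict (Set.Ioo (t₀ : ℝ) T)),
        ‖f t‖ ≤ L * (1 + ‖stopAt (clampTime t) x‖)) →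
      ‖x‖ ≤ C ∧ eLpNorm (fun t => toV ι (pathAt x t)) (ENNReal.ofReal p)
        (volume.restrict (Set.Ioo (t₀ : ℝ) T)) ≤ M := by
  obtain ⟨c₂, hc₂, hco⟩ := hA.coercive
  set B := ‖x₀‖
  -- With m the running supremum of |x| and Z the primitive of (1+m)² from t₀, the energy identity
  -- gives m² ≤ B² + 2LZ. Hence Z' = (1+m)² ≤ 2 + 2m² ≤ 2 + 2B² + 4LZ with Z(t₀) = 0, and Gronwall's
  -- lemma bounds Z(T) by `G`.
  set G := gronwallBound 0 (4 * L) (2 + 2 * B ^ 2) (T - t₀)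
  refine ⟨√(B ^ 2 + 2 * L * G), ENNReal.ofReal (((B ^ 2 / 2 + L * G) / c₂) ^ p⁻¹),
    Real.sqrt_nonneg _, ENNReal.ofReal_ne_top, fun x f hx hf hb => ?_⟩
  have h0 : (t₀ : ℝ) ∈ Set.Icc (t₀ : ℝ) T := ⟨le_rfl, t₀.2.2⟩
  have hT : T ∈ Set.Icc (t₀ : ℝ) T := ⟨t₀.2.2, le_rfl⟩
  have hT0 : T ∈ Set.Icc 0 T := ⟨(Fact.out : 0 < T).le, le_rfl⟩
  set m : ℝ → ℝ := fun t => ‖stopAt (clampTime t) x‖ with hm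
  have hmc : Continuous m :=
    (continuous_stopAt.comp (continuous_clampTime.prodMk continuous_const)).norm
  have hm0 : ∀ t, 0 ≤ m t := fun t => norm_nonneg _
  set Y : ℝ → ℝ := fun t => (1 + m t) ^ 2 with hY
  have hYc : Continuous Y := (continuous_const.add hmc).pow 2
  have hY0 : ∀ t, 0 ≤ Y t := fun t => sq_nonneg _
  have hpm : ∀ r ∈ Set.Icc (t₀ : ℝ) T, ‖pathAt x r‖ ≤ m r := fun r _ =>
    norm_apply_le_norm_stopAt le_rfl x
  have hB0 : ∀ t ≤ t₀, ‖x t‖ ≤ B := fun t ht => by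
    rw [hx t ht]; exact x₀.norm_coe_le_norm t
  have hBt : ‖pathAt x t₀‖ ^ 2 ≤ B ^ 2 := by
    rw [pathAt_coe]; exact pow_le_pow_left₀ (norm_nonneg _) (hB0 _ le_rfl) 2
  have i1 := integrable_inner_continuous hf.memLp_source (continuous_pathAt x)
  have i2 := integrable_pairing hpq (hA.memLp hp hpq t₀.2.1 hf.memLp) hf.memLp
  set Z : ℝ → ℝ := fun t => ∫ r in (t₀ : ℝ)..t, Y r with hZ
  have hZmono : ∀ s t, s ≤ t → Z s ≤ Z t := fun s t hst => by
    have : Z t - Z s = ∫ r in s..t, Y r :=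
      intervalIntegral.integral_interval_sub_left (hYc.intervalIntegrable _ _)
        (hYc.intervalIntegrable _ _)
    have h2 : 0 ≤ ∫ r in s..t, Y r := intervalIntegral.integral_nonneg hst fun r _ => hY0 r
    linarith
  have hZ0 : Z t₀ = 0 := intervalIntegral.integral_same
  have hfx : ∀ t ∈ Set.Icc (t₀ : ℝ) T, ∫ r in (t₀ : ℝ)..t, inner ℝ (f r) (pathAt x r) ≤ L * Z t := by
    intro t ht
    rw [hZ, ← intervalIntegral.integral_const_mul]
    rw [intervalIntegral.integral_of_le ht.1, intervalIntegral.integral_of_le ht.1,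
      integral_Ioc_eq_integral_Ioo, integral_Ioc_eq_integral_Ioo]
    have hss : Set.Ioo (t₀ : ℝ) t ⊆ Set.Ioo (t₀ : ℝ) T := Set.Ioo_subset_Ioo_right ht.2
    refine integral_mono_ae (i1.mono_measure (Measure.restrict_mono hss le_rfl))
      ((hYc.const_mul L).integrableOn_Icc.mono_set Set.Ioo_subset_Icc_self) ?_
    filter_upwards [ae_restrict_of_ae_restrict_of_subset hss hb,
      ae_restrict_mem measurableSet_Ioo] with r h1 h2
    have h3 := hpm r ⟨h2.1.le, (h2.2.trans_le ht.2).le⟩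
    calc inner ℝ (f r) (pathAt x r) ≤ ‖f r‖ * ‖pathAt x r‖ := real_inner_le_norm _ _
      _ ≤ L * (1 + m r) * m r := mul_le_mul h1 h3 (norm_nonneg _)
          (mul_nonneg hL (by linarith [hm0 r]))
      _ ≤ L * Y r := by
          have : 0 ≤ L * (1 + m r) := mul_nonneg hL (by linarith [hm0 r])
          simp only [hY]; nlinarith
  have hAint : ∀ t ∈ Set.Icc (t₀ : ℝ) T, c₂ * ∫ r in (t₀ : ℝ)..t, ‖toV ι (pathAt x r)‖ ^ p
      ≤ ∫ r in (t₀ : ℝ)..t, A r (toV ι (pathAt x r)) (toV ι (pathAt x r)) := by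
    intro t ht
    have hss : Set.Ioo (t₀ : ℝ) t ⊆ Set.Ioo (t₀ : ℝ) T := Set.Ioo_subset_Ioo_right ht.2
    rw [← intervalIntegral.integral_const_mul, intervalIntegral.integral_of_le ht.1,
      intervalIntegral.integral_of_le ht.1,
      integral_Ioc_eq_integral_Ioo, integral_Ioc_eq_integral_Ioo]
    have hup := hf.memLp.integrable_norm_rpow (by simpa using hpq.pos) (by simp)
    rw [ENNReal.toReal_ofReal hpq.pos.le] at hup
    refine integral_mono_ae ((hup.const_mul c₂).mono_measure (Measure.restrict_mono hss le_rfl))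
      (i2.mono_measure (Measure.restrict_mono hss le_rfl)) ?_
    filter_upwards [ae_mono ((Measure.restrict_mono hss le_rfl).trans
      (restrict_Ioo_le_Icc t₀.2.1)) hco] with r hr using hr _
  have hAnn : ∀ t ∈ Set.Icc (t₀ : ℝ) T,
      0 ≤ c₂ * ∫ r in (t₀ : ℝ)..t, ‖toV ι (pathAt x r)‖ ^ p := fun t ht =>
    mul_nonneg hc₂.le (intervalIntegral.integral_nonneg ht.1 fun r _ =>
      Real.rpow_nonneg (norm_nonneg _) _)
  have hR : ∀ t ∈ Set.Icc (t₀ : ℝ) T, ‖pathAt x t‖ ^ 2 ≤ B ^ 2 + 2 * L * Z t := fun t ht => by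
    have h1 := hf.energy hA hp hpq ht
    have h2 := hfx t ht
    have h3 := hAint t ht
    have h4 := hAnn t ht
    linarith
  -- Since Z is increasing, the bound on the current value passes to the running supremum; before t₀
  -- the path is bounded by `B`.
  have hm2 : ∀ t ∈ Set.Icc (t₀ : ℝ) T, m t ^ 2 ≤ B ^ 2 + 2 * L * Z t := fun t ht => by
    have hZt : 0 ≤ Z t := hZ0 ▸ hZmono _ _ ht.1
    have hnn : 0 ≤ B ^ 2 + 2 * L * Z t := by positivity
    have : m t ≤ √(B ^ 2 + 2 * L * Z t) := by
      refine (ContinuousMap.norm_le _ (Real.sqrt_nonneg _)).2 fun s => ?_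
      refine Real.le_sqrt_of_sq_le ?_
      show ‖x (min s (clampTime t))‖ ^ 2 ≤ _
      set r := min s (clampTime t) with hr
      have hrt : (r : ℝ) ≤ t := by
        have h1 : (r : ℝ) ≤ (clampTime t : Set.Icc (0 : ℝ) T) := min_le_right s (clampTime t)
        rwa [coe_clampTime_of_mem ⟨t₀.2.1.trans ht.1, ht.2⟩] at h1
      rcases le_total r t₀ with h | h
      · have := pow_le_pow_left₀ (norm_nonneg _) (hB0 r h) 2
        have : 0 ≤ 2 * L * Z t := by positivity
        linarith
      · have h1 := hR r ⟨h, r.2.2⟩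
        rw [pathAt_coe] at h1
        have h2 : 2 * L * Z r ≤ 2 * L * Z t :=
          mul_le_mul_of_nonneg_left (hZmono _ _ hrt) (by linarith)
        linarith
    calc m t ^ 2 ≤ √(B ^ 2 + 2 * L * Z t) ^ 2 := pow_le_pow_left₀ (hm0 t) this 2
      _ = _ := Real.sq_sqrt hnn
  have hgr := norm_le_gronwallBound_of_norm_deriv_right_le (f := Z) (f' := Y) (δ := 0)
    (K := 4 * L) (ε := 2 + 2 * B ^ 2) (a := t₀) (b := T)
    (intervalIntegral.continuous_primitive (fun a b => hYc.intervalIntegrable a b) _).continuousOn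
    (fun t _ => (hYc.integral_hasStrictDerivAt (t₀ : ℝ) t).hasDerivAt.hasDerivWithinAt)
    (by rw [hZ0, norm_zero]) (fun t ht => by
      have h1 := hm2 t ⟨ht.1, ht.2.le⟩
      rw [Real.norm_of_nonneg (hY0 t), Real.norm_of_nonneg (hZ0 ▸ hZmono _ _ ht.1)]
      simp only [hY]
      nlinarith [sq_nonneg (1 - m t)]) T hT
  have hZT : Z T ≤ G := (le_abs_self _).trans hgr
  have hxm : ‖x‖ = m T := by
    simp only [hm]
    congr 1
    refine ContinuousMap.ext fun s => (stopAt_apply_of_le ?_ x).symm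
    show (s : ℝ) ≤ (clampTime T : Set.Icc (0 : ℝ) T)
    rw [coe_clampTime_of_mem hT0]
    exact s.2.2
  have hLG : L * Z T ≤ L * G := mul_le_mul_of_nonneg_left hZT hL
  refine ⟨?_, ?_⟩
  · refine Real.le_sqrt_of_sq_le ?_
    rw [hxm]
    linarith [hm2 T hT]
  · have h1 := hf.energy hA hp hpq hT
    have h2 := hfx T hT
    have h3 := hAint T hT
    rw [hf.memLp.eLpNorm_eq_integral_rpow_norm (by simpa using hpq.pos) (by simp),
      ENNReal.toReal_ofReal hpq.pos.le]
    refine ENNReal.ofReal_le_ofReal (Real.rpow_le_rpow (integral_nonneg fun r =>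
      Real.rpow_nonneg (norm_nonneg _) _) ?_ (inv_nonneg.2 hpq.pos.le))
    rw [le_div_iff₀ hc₂, ← integral_Ioc_eq_integral_Ioo, ← intervalIntegral.integral_of_le hT.1]
    nlinarith [sq_nonneg ‖pathAt x T‖]

end Energy

/-! ### Weak convergence tools -/

section Weak

variable {V H : Type*} [NormedAddCommGroup V] [NormedSpace ℝ V]
  [NormedAddCommGroup H] [InnerProductSpace ℝ H] {ι : V →L[ℝ] H} {p q : ℝ}

lemma abs_integral_pairing_le {p q : ENNReal} [q.HolderConjugate p] {μ : Measure ℝ} {u : ℝ → V}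
    {w : ℝ → StrongDual ℝ V} (hw : MemLp w q μ) (hu : MemLp u p μ) :
    |∫ r, w r (u r) ∂μ| ≤ (eLpNorm w q μ * eLpNorm u p μ).toReal := by
  have h1 : ‖∫ r, w r (u r) ∂μ‖ₑ ≤ eLpNorm w q μ * eLpNorm u p μ := by
    refine (enorm_integral_le_lintegral_enorm _).trans ?_
    rw [← eLpNorm_one_eq_lintegral_enorm]
    have := eLpNorm_le_eLpNorm_mul_eLpNorm'_of_norm (p := q) (q := p) (r := 1) hw.1 hu.1
      (fun (φ : StrongDual ℝ V) v => φ v) 1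
      (Eventually.of_forall fun r => by simpa using (w r).le_opNorm (u r))
    simpa using this
  rw [← Real.norm_eq_abs, ← toReal_enorm]
  exact ENNReal.toReal_mono (ENNReal.mul_ne_top hw.2.ne hu.2.ne) h1

/-- Through the pairing the functions act as bounded functionals on the separable space L^p(V),
whose dual balls are weak* sequentially compact. The limit is kept as a functional `Λ`; no
representation by a V*-valued function is needed, as it is identified later by monotonicity. -/
lemma exists_weak_subseq [TopologicalSpace.SeparableSpace V] {p q : ENNReal}
    [hpq : q.HolderConjugate p] [hp1 : Fact (1 ≤ p)] [hq1 : Fact (1 ≤ q)] [hpt : Fact (p ≠ ⊤)]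
    {μ : Measure ℝ} [IsFiniteMeasure μ] {w : ℕ → ℝ → StrongDual ℝ V} (hw : ∀ n, MemLp (w n) q μ)
    {C : ENNReal} (hC : C ≠ ⊤) (hwC : ∀ n, eLpNorm (w n) q μ ≤ C) :
    ∃ (φ : ℕ → ℕ) (Λ : StrongDual ℝ (Lp V p μ)), StrictMono φ ∧ ∀ (v : ℝ → V) (hv : MemLp v p μ),
      Tendsto (fun n => ∫ r, w (φ n) r (v r) ∂μ) atTop (𝓝 (Λ (hv.toLp v))) := by
  set P := (ContinuousLinearMap.id ℝ (StrongDual ℝ V)).lpPairing μ q p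
  have hb : ∀ n, ‖P ((hw n).toLp (w n))‖ ≤ ‖P‖ * C.toReal := fun n => by
    refine (P.le_opNorm _).trans (mul_le_mul_of_nonneg_left ?_ (norm_nonneg _))
    rw [Lp.norm_toLp]
    exact ENNReal.toReal_mono hC (hwC n)
  obtain ⟨g, -, φ, hφ, hlim⟩ := WeakDual.isSeqCompact_closedBall ℝ (Lp V p μ) 0 (‖P‖ * C.toReal)
    (x := fun n => StrongDual.toWeakDual (P ((hw n).toLp (w n)))) (fun n => by
      simp only [Set.mem_preimage, Metric.mem_closedBall, dist_zero_right]
      exact hb n)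
  refine ⟨φ, WeakDual.toStrongDual g, hφ, fun v hv => ?_⟩
  have h1 := ((WeakDual.eval_continuous (hv.toLp v)).tendsto g).comp hlim
  refine h1.congr fun n => ?_
  show P ((hw (φ n)).toLp (w (φ n))) (hv.toLp v) = _
  rw [ContinuousLinearMap.lpPairing_eq_integral]
  refine integral_congr_ae ?_
  filter_upwards [(hw (φ n)).coeFn_toLp, hv.coeFn_toLp] with r h1 h2
  rw [h1, h2]; rfl

/-- Simple functions are dense in L^q(V*), and each of their values can be replaced by a nearby
element of H. Weak convergence can then be tested against H-valued functions. -/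
lemma exists_simpleFunc_toDual_approx (hι : IsGelfandTriple ι) (hpq : p.HolderConjugate q)
    {μ : Measure ℝ} [IsFiniteMeasure μ] {g : ℝ → StrongDual ℝ V}
    (hg : MemLp g (ENNReal.ofReal q) μ) {ε : ℝ} (hε : 0 < ε) :
    ∃ h : SimpleFunc ℝ H,
      eLpNorm (fun r => g r - toDual ι (h r)) (ENNReal.ofReal q) μ ≤ ENNReal.ofReal ε := by
  have hq1 : 1 ≤ ENNReal.ofReal q := one_le_ofReal_conj hpq
  obtain ⟨s, hs, -⟩ := hg.exists_simpleFunc_eLpNorm_sub_lt ENNReal.ofReal_ne_top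
    (ε := ENNReal.ofReal (ε / 2)) (by simpa using by linarith)
  set m : ENNReal := μ Set.univ ^ (ENNReal.ofReal q).toReal⁻¹
  have hm : m ≠ ⊤ := ENNReal.rpow_ne_top_of_nonneg (by positivity) (measure_ne_top _ _)
  -- `m` is the factor by which a uniform bound passes to the L^q norm; adding 1 keeps the quotient
  -- meaningful when the measure is zero.
  have hδ : 0 < ε / 2 / (m.toReal + 1) := by positivity
  choose k hk using fun φ : StrongDual ℝ V => denseRange_toDual hι φ hδ
  refine ⟨s.map k, ?_⟩
  have h1 : (fun r => g r - toDual ι (s.map k r)) = (g - s) + fun r => s r - toDual ι (k (s r)) := by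
    funext r
    simp
  have hsm : AEStronglyMeasurable (fun r => s r - toDual ι (k (s r))) μ :=
    ((s.map fun φ => φ - toDual ι (k φ)).aestronglyMeasurable)
  rw [h1]
  refine (eLpNorm_add_le (hg.1.sub s.aestronglyMeasurable) hsm hq1).trans ?_
  have h2 : eLpNorm (fun r => s r - toDual ι (k (s r))) (ENNReal.ofReal q) μ
      ≤ ENNReal.ofReal (ε / 2) := by
    refine (eLpNorm_le_of_ae_bound (Eventually.of_forall fun r => (hk (s r)).le)).trans ?_
    change m * ENNReal.ofReal (ε / 2 / (m.toReal + 1)) ≤ _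
    generalize m = m at hm
    lift m to NNReal using hm
    rw [← ENNReal.ofReal_coe_nnreal, ← ENNReal.ofReal_mul m.coe_nonneg]
    refine ENNReal.ofReal_le_ofReal ?_
    rw [ENNReal.toReal_ofReal m.coe_nonneg]
    rw [mul_div_assoc', div_le_iff₀ (by positivity)]
    have : 0 ≤ (m : ℝ) := m.coe_nonneg
    nlinarith
  calc _ ≤ ENNReal.ofReal (ε / 2) + ENNReal.ofReal (ε / 2) := add_le_add hs.le h2
    _ = ENNReal.ofReal ε := by rw [← ENNReal.ofReal_add (by linarith) (by linarith), add_halves]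

/-- Sequences bounded in `L^p(V)` that converge pointwise in `H` and are bounded in `H` converge
weakly in `L^p(V)`. -/
lemma tendsto_integral_pairing (hι : IsGelfandTriple ι) (hpq : p.HolderConjugate q)
    {μ : Measure ℝ} [IsFiniteMeasure μ] {U : ℕ → ℝ → V} {u : ℝ → V}
    (hU : ∀ n, MemLp (U n) (ENNReal.ofReal p) μ) (hu : MemLp u (ENNReal.ofReal p) μ)
    {M : ENNReal} (hM : M ≠ ⊤) (hUM : ∀ n, eLpNorm (U n) (ENNReal.ofReal p) μ ≤ M)
    {C : ℝ} (hC : ∀ n, ∀ᵐ r ∂μ, ‖ι (U n r)‖ ≤ C)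
    (hlim : ∀ᵐ r ∂μ, Tendsto (fun n => ι (U n r)) atTop (𝓝 (ι (u r))))
    {g : ℝ → StrongDual ℝ V} (hg : MemLp g (ENNReal.ofReal q) μ) :
    Tendsto (fun n => ∫ r, g r (U n r) ∂μ) atTop (𝓝 (∫ r, g r (u r) ∂μ)) := by
  have hH : ENNReal.HolderConjugate (ENNReal.ofReal q) (ENNReal.ofReal p) :=
    hpq.symm.ennrealOfReal
  have hp1 : 1 ≤ ENNReal.ofReal p := one_le_ofReal_conj hpq.symm
  set K : ENNReal := M + eLpNorm u (ENNReal.ofReal p) μ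
  have hK : K ≠ ⊤ := ENNReal.add_ne_top.2 ⟨hM, hu.2.ne⟩
  rw [Metric.tendsto_atTop']
  intro ε hε
  have hδ : 0 < ε / 2 / (K.toReal + 1) := by positivity
  -- Against the H-valued simple function `h` dominated convergence applies; the remainder is small
  -- uniformly in n by Hölder's inequality, `K` bounding the L^p norm of `U n - u`.
  obtain ⟨h, hh⟩ := exists_simpleFunc_toDual_approx hι hpq hg hδ
  have hhm : MemLp (fun r => toDual ι (h r)) (ENNReal.ofReal q) μ := by
    obtain ⟨B, hB⟩ := (h.map fun y => toDual ι y).exists_forall_norm_le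
    exact MemLp.of_bound (h.map fun y => toDual ι y).aestronglyMeasurable B
      (Eventually.of_forall hB)
  obtain ⟨B, hB⟩ := h.exists_forall_norm_le
  have h1 : Tendsto (fun n => ∫ r, inner ℝ (h r) (ι (U n r)) ∂μ) atTop
      (𝓝 (∫ r, inner ℝ (h r) (ι (u r)) ∂μ)) := by
    refine tendsto_integral_of_dominated_convergence (fun _ => B * C) (fun n => ?_)
      (integrable_const _) (fun n => ?_) ?_
    · exact h.aestronglyMeasurable.inner (ι.continuous.comp_aestronglyMeasurable (hU n).1)
    · filter_upwards [hC n] with r hr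
      exact (norm_inner_le_norm _ _).trans (mul_le_mul (hB r) hr (norm_nonneg _)
        ((norm_nonneg _).trans (hB r)))
    · filter_upwards [hlim] with r hr using tendsto_const_nhds.inner hr
  obtain ⟨N, hN⟩ := Metric.tendsto_atTop'.1 h1 (ε / 2) (by linarith)
  refine ⟨N, fun n hn => ?_⟩
  have h2 := hN n hn
  rw [Real.dist_eq] at h2 ⊢
  have hd : ∀ v, MemLp v (ENNReal.ofReal p) μ →
      ∫ r, (g r - toDual ι (h r)) (v r) ∂μ
        = ∫ r, g r (v r) ∂μ - ∫ r, inner ℝ (h r) (ι (v r)) ∂μ := fun v hv => by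
    rw [← integral_sub (integrable_pairing hpq hg hv)]
    · rfl
    · exact integrable_pairing hpq hhm hv
  have h3 : (∫ r, g r (U n r) ∂μ) - ∫ r, g r (u r) ∂μ
      = (∫ r, (g r - toDual ι (h r)) ((U n - u) r) ∂μ)
        + ((∫ r, inner ℝ (h r) (ι (U n r)) ∂μ) - ∫ r, inner ℝ (h r) (ι (u r)) ∂μ) := by
    have i1 := integrable_pairing hpq (hg.sub hhm) (hU n)
    have i2 := integrable_pairing hpq (hg.sub hhm) hu
    simp only [Pi.sub_apply] at i1 i2
    simp only [Pi.sub_apply, map_sub (_ : StrongDual ℝ V)]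
    rw [integral_sub i1 i2, hd _ (hU n), hd _ hu]
    ring
  have h4 := abs_integral_pairing_le (hg.sub hhm) ((hU n).sub hu)
  have h5 : (eLpNorm (g - fun r => toDual ι (h r)) (ENNReal.ofReal q) μ *
      eLpNorm (U n - u) (ENNReal.ofReal p) μ).toReal ≤ ε / 2 / (K.toReal + 1) * K.toReal := by
    refine (ENNReal.toReal_mono (ENNReal.mul_ne_top ENNReal.ofReal_ne_top hK) (mul_le_mul' hh
      ((eLpNorm_sub_le (hU n).1 hu.1 hp1).trans (add_le_add (hUM n) le_rfl)))).trans ?_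
    rw [ENNReal.toReal_mul, ENNReal.toReal_ofReal hδ.le]
  have h6 : ε / 2 / (K.toReal + 1) * K.toReal ≤ ε / 2 := by
    rw [div_mul_eq_mul_div, div_le_iff₀ (by positivity)]
    nlinarith
  rw [h3]
  refine (abs_add_le _ _).trans_lt ?_
  have h7 : |∫ r, (g r - toDual ι (h r)) ((U n - u) r) ∂μ| ≤ ε / 2 := (h4.trans h5).trans h6
  linarith

/-! ### Steklov averages -/

/-- The backward average over an interval of length `h`. -/
def steklov {E : Type*} [NormedAddCommGroup E] [NormedSpace ℝ E] (h : ℝ) (u : ℝ → E) (s : ℝ) : E :=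
  h⁻¹ • ∫ r in (s - h)..s, u r

/-- Jensen's inequality for the average. -/
lemma norm_steklov_rpow_le {E : Type*} [NormedAddCommGroup E] [NormedSpace ℝ E] (hp : 1 ≤ p)
    {u : ℝ → E} (hu : Integrable u) (hup : Integrable fun r => ‖u r‖ ^ p) {h : ℝ} (hh : 0 < h)
    (s : ℝ) : ‖steklov h u s‖ ^ p ≤ steklov h (fun r => ‖u r‖ ^ p) s := by
  have hlt : s - h ≤ s := by linarith
  have hvol : volume.real (Set.Ioc (s - h) s) = h := by
    rw [measureReal_def, Real.volume_Ioc, sub_sub_cancel, ENNReal.toReal_ofReal hh.le]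
  have h1 : ‖steklov h u s‖ ≤ ⨍ r in Set.Ioc (s - h) s, ‖u r‖ := by
    rw [steklov, norm_smul, setAverage_eq, hvol, Real.norm_of_nonneg (inv_nonneg.2 hh.le),
      intervalIntegral.integral_of_le hlt, smul_eq_mul]
    exact mul_le_mul_of_nonneg_left (norm_integral_le_integral_norm _) (inv_nonneg.2 hh.le)
  refine (Real.rpow_le_rpow (norm_nonneg _) h1 (by linarith)).trans ?_
  have := (convexOn_rpow hp).map_set_average_le (μ := volume) (t := Set.Ioc (s - h) s)
    (f := fun r => ‖u r‖)
    (continuousOn_id.rpow_const fun _ _ => Or.inr (by linarith)) isClosed_Ici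
    (by rw [Real.volume_Ioc]; simp [hh]) (by rw [Real.volume_Ioc]; simp)
    (Eventually.of_forall fun r => norm_nonneg _) hu.norm.integrableOn hup.integrableOn
  refine this.trans (le_of_eq ?_)
  rw [setAverage_eq, hvol, steklov, intervalIntegral.integral_of_le hlt]

lemma tendsto_steklov {E : Type*} [NormedAddCommGroup E] [NormedSpace ℝ E] [CompleteSpace E]
    {u : ℝ → E} (hu : Integrable u) {h : ℕ → ℝ} (h0 : Tendsto h atTop (𝓝[≠] 0)) :
    ∀ᵐ s, Tendsto (fun n => steklov (h n) u s) atTop (𝓝 (u s)) := by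
  have h0' : Tendsto (fun n => -h n) atTop (𝓝[≠] 0) := by
    refine tendsto_nhdsWithin_iff.2 ⟨?_, ?_⟩
    · simpa using (h0.mono_right nhdsWithin_le_nhds).neg
    · filter_upwards [h0.eventually self_mem_nhdsWithin] with n hn
      exact neg_ne_zero.2 hn
  have hi : ∀ x y, IntervalIntegrable u volume x y := fun x y => hu.intervalIntegrable
  filter_upwards [_root_.LocallyIntegrable.ae_hasDerivAt_integral hu.locallyIntegrable] with s hs
  refine ((hasDerivAt_iff_tendsto_slope_zero.1 (hs 0)).comp h0').congr fun n => ?_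
  simp only [Function.comp, steklov]
  rw [intervalIntegral.integral_interval_sub_left (hi _ _) (hi _ _), ← sub_eq_add_neg,
    intervalIntegral.integral_symm, inv_neg, smul_neg, neg_smul, neg_neg]

lemma continuous_steklov {E : Type*} [NormedAddCommGroup E] [NormedSpace ℝ E]
    {u : ℝ → E} (hu : Integrable u) (h : ℝ) : Continuous (steklov h u) := by
  have hi : ∀ x y, IntervalIntegrable u volume x y := fun x y => hu.intervalIntegrable
  have hP : Continuous fun t => ∫ r in (0 : ℝ)..t, u r :=
    intervalIntegral.continuous_primitive hi 0
  have : steklov h u = fun s => h⁻¹ • ((∫ r in (0 : ℝ)..s, u r) - ∫ r in (0 : ℝ)..(s - h), u r) := by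
    funext s
    rw [steklov, intervalIntegral.integral_interval_sub_left (hi _ _) (hi _ _)]
  rw [this]
  exact (hP.sub (hP.comp (continuous_id.sub continuous_const))).const_smul _

lemma tendsto_integral_steklov {g : ℝ → ℝ} (hg : Integrable g) {h : ℕ → ℝ}
    (h0 : Tendsto h atTop (𝓝[≠] 0)) (a b : ℝ) :
    Tendsto (fun n => ∫ s in a..b, steklov (h n) g s) atTop (𝓝 (∫ s in a..b, g s)) := by
  have hi : ∀ x y, IntervalIntegrable g volume x y := fun x y => hg.intervalIntegrable
  have hP : Continuous fun t => ∫ r in (0 : ℝ)..t, g r :=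
    intervalIntegral.continuous_primitive hi 0
  have h0' : Tendsto (fun n => -h n) atTop (𝓝[≠] 0) := by
    refine tendsto_nhdsWithin_iff.2 ⟨?_, ?_⟩
    · simpa using (h0.mono_right nhdsWithin_le_nhds).neg
    · filter_upwards [h0.eventually self_mem_nhdsWithin] with n hn
      exact neg_ne_zero.2 hn
  have := tendsto_integral_diffQuot hP a b h0'
  rw [intervalIntegral.integral_interval_sub_left (hi _ _) (hi _ _)] at this
  refine this.congr fun n => intervalIntegral.integral_congr fun s _ => ?_
  simp only [steklov]
  rw [intervalIntegral.integral_interval_sub_left (hi _ _) (hi _ _), ← sub_eq_add_neg,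
    intervalIntegral.integral_symm, inv_neg, mul_neg, neg_mul, neg_neg, smul_eq_mul]

lemma norm_sub_rpow_le {E : Type*} [NormedAddCommGroup E] (hp : 0 ≤ p) (a b : E) :
    ‖a - b‖ ^ p ≤ 2 ^ p * (‖a‖ ^ p + ‖b‖ ^ p) := by
  have h1 : ‖a - b‖ ≤ 2 * max ‖a‖ ‖b‖ := by
    refine (norm_sub_le a b).trans ?_
    linarith [le_max_left ‖a‖ ‖b‖, le_max_right ‖a‖ ‖b‖]
  refine (Real.rpow_le_rpow (norm_nonneg _) h1 hp).trans ?_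
  rw [Real.mul_rpow (by norm_num) (le_max_of_le_left (norm_nonneg _))]
  gcongr
  rcases max_choice ‖a‖ ‖b‖ with h | h <;> rw [h]
  · linarith [Real.rpow_nonneg (norm_nonneg b) p]
  · linarith [Real.rpow_nonneg (norm_nonneg a) p]

/-- Steklov averages converge in `L^p`. -/
lemma tendsto_integral_norm_steklov_sub {E : Type*} [NormedAddCommGroup E] [NormedSpace ℝ E]
    [CompleteSpace E] (hp : 1 ≤ p) {u : ℝ → E} (hu : Integrable u)
    (hup : Integrable fun r => ‖u r‖ ^ p) {h : ℕ → ℝ} (hh : ∀ n, 0 < h n)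
    (h0 : Tendsto h atTop (𝓝 0)) {a b : ℝ} (hab : a ≤ b) :
    (∀ n, IntegrableOn (fun s => ‖steklov (h n) u s - u s‖ ^ p) (Set.Ioc a b)) ∧
    Tendsto (fun n => ∫ s in Set.Ioc a b, ‖steklov (h n) u s - u s‖ ^ p) atTop (𝓝 0) := by
  have h0' : Tendsto h atTop (𝓝[≠] 0) :=
    tendsto_nhdsWithin_iff.2 ⟨h0, Eventually.of_forall fun n => (hh n).ne'⟩
  set G : ℕ → ℝ → ℝ := fun n => steklov (h n) fun r => ‖u r‖ ^ p
  have hGc : ∀ n, Continuous (G n) := fun n => continuous_steklov hup _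
  have hbd : ∀ n s, ‖steklov (h n) u s - u s‖ ^ p ≤ 2 ^ p * (G n s + ‖u s‖ ^ p) := fun n s => by
    refine (norm_sub_rpow_le (by linarith) _ _).trans ?_
    gcongr
    exact norm_steklov_rpow_le hp hu hup (hh n) s
  have hup' : IntegrableOn (fun r => ‖u r‖ ^ p) (Set.Ioc a b) := hup.integrableOn
  have hGi : ∀ n, IntegrableOn (fun s => 2 ^ p * (G n s + ‖u s‖ ^ p)) (Set.Ioc a b) := fun n =>
    (((hGc n).integrableOn_Ioc).add hup').const_mul _
  have hmeas : ∀ n, AEStronglyMeasurable (fun s => ‖steklov (h n) u s - u s‖ ^ p)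
      (volume.restrict (Set.Ioc a b)) := fun n =>
    (((continuous_steklov hu _).aestronglyMeasurable.sub
      hu.1.restrict).norm.aemeasurable.pow_const _).aestronglyMeasurable
  have hint : ∀ n, IntegrableOn (fun s => ‖steklov (h n) u s - u s‖ ^ p) (Set.Ioc a b) := fun n =>
    (hGi n).mono' (hmeas n) (Eventually.of_forall fun s => by
      rw [Real.norm_of_nonneg (Real.rpow_nonneg (norm_nonneg _) _)]; exact hbd n s)
  refine ⟨hint, ?_⟩
  have hGlim := tendsto_integral_steklov hup h0' a b
  simp only [intervalIntegral.integral_of_le hab] at hGlim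
  set I := ∫ s in Set.Ioc a b, ‖u s‖ ^ p
  have hGint : ∀ n, ∫ s in Set.Ioc a b, 2 ^ p * (G n s + ‖u s‖ ^ p)
      = 2 ^ p * ((∫ s in Set.Ioc a b, G n s) + I) := fun n => by
    rw [integral_const_mul, integral_add ((hGc n).integrableOn_Ioc) hup']
  have hGI : Tendsto (fun n => ∫ s in Set.Ioc a b, 2 ^ p * (G n s + ‖u s‖ ^ p)) atTop
      (𝓝 (2 ^ p * (I + I))) := by
    simp only [hGint]
    exact (hGlim.add_const I).const_mul _
  have hnn : ∀ n, 0 ≤ ∫ s in Set.Ioc a b, ‖steklov (h n) u s - u s‖ ^ p := fun n =>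
    integral_nonneg fun s => Real.rpow_nonneg (norm_nonneg _) _
  obtain ⟨B, hB⟩ := hGI.bddAbove_range
  have hle : ∀ n, ∫ s in Set.Ioc a b, ‖steklov (h n) u s - u s‖ ^ p ≤ B := fun n =>
    (integral_mono (hint n) (hGi n) (hbd n)).trans (hB ⟨n, rfl⟩)
  -- Generalized dominated convergence: the majorants vary with n, but their integrals converge to
  -- 2^p(I + I). On a subsequence whose error integrals converge to some c, Fatou's lemma for
  -- majorant minus error gives 2^p(I + I) ≤ 2^p(I + I) - c, so c = 0.
  refine tendsto_of_subseq_tendsto fun ns hns => ?_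
  obtain ⟨c, -, ψ, hψ, hc⟩ := (isCompact_Icc (a := (0 : ℝ)) (b := B)).tendsto_subseq
    (x := fun n => ∫ s in Set.Ioc a b, ‖steklov (h (ns n)) u s - u s‖ ^ p)
    fun n => ⟨hnn _, hle _⟩
  refine ⟨ψ, ?_⟩
  have hm : Tendsto (fun n => ns (ψ n)) atTop atTop := hns.comp hψ.tendsto_atTop
  have hc0 : 0 ≤ c := ge_of_tendsto hc (Eventually.of_forall fun n => hnn _)
  have hF := integral_le_of_tendsto_of_le (μ := volume.restrict (Set.Ioc a b))
    (Q := fun n s => 2 ^ p * (G (ns (ψ n)) s + ‖u s‖ ^ p) - ‖steklov (h (ns (ψ n))) u s - u s‖ ^ p)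
    (R := fun n s => 2 ^ p * ‖u s‖ ^ p + (2 ^ p * ‖steklov (h (ns (ψ n))) u s‖ ^ p
      - ‖steklov (h (ns (ψ n))) u s - u s‖ ^ p))
    (R₀ := fun s => 2 ^ p * ‖u s‖ ^ p + (2 ^ p * ‖u s‖ ^ p - ‖u s - u s‖ ^ p))
    (c := 2 ^ p * (I + I) - c)
    (fun n => (hGi _).sub (hint _)) (by
      simp only [sub_self, norm_zero, Real.zero_rpow (by linarith : p ≠ 0), sub_zero]
      exact (hup'.const_mul _).add (hup'.const_mul _))
    (fun n => Eventually.of_forall fun s => sub_nonneg.2 (hbd _ _))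
    (fun n => Eventually.of_forall fun s => by
      have := norm_steklov_rpow_le hp hu hup (hh (ns (ψ n))) s
      have h2 : (0 : ℝ) ≤ 2 ^ p := by positivity
      have := mul_le_mul_of_nonneg_left this h2
      simp only [mul_add]
      linarith)
    (by
      filter_upwards [ae_restrict_of_ae (tendsto_steklov hu (h0'.comp hm))] with s hs
      have hp0 : 0 ≤ p := by linarith
      exact tendsto_const_nhds.add (((hs.norm.rpow_const (Or.inr hp0)).const_mul _).sub
        ((hs.sub_const _).norm.rpow_const (Or.inr hp0))))
    (by
      refine ((hGI.comp hm).sub hc).congr fun n => ?_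
      exact (integral_sub (hGi _) (hint _)).symm)
  simp only [sub_self, norm_zero, Real.zero_rpow (by linarith : p ≠ 0), sub_zero] at hF
  rw [integral_add (hup'.const_mul _) (hup'.const_mul _), integral_const_mul] at hF
  have : c = 0 := by
    change 2 ^ p * I + 2 ^ p * I ≤ _ at hF
    linarith
  exact this ▸ hc

end Weak

/-! ### Passage to the limit in the equation -/

section Steklov

variable {E F : Type*} [NormedAddCommGroup E] [NormedSpace ℝ E] [NormedAddCommGroup F]
  [NormedSpace ℝ F]

lemma hasDerivAt_steklov [CompleteSpace E] {X : ℝ → E} (hX : Continuous X) (h s : ℝ) :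
    HasDerivAt (steklov h X) (h⁻¹ • (X s - X (s - h))) s := by
  have hi : ∀ x y, IntervalIntegrable X volume x y := fun x y => hX.intervalIntegrable x y
  have hd : ∀ t, HasDerivAt (fun t => ∫ r in (0 : ℝ)..t, X r) (X t) t := fun t =>
    (hX.integral_hasStrictDerivAt 0 t).hasDerivAt
  have h2 : HasDerivAt (fun s => ∫ r in (0 : ℝ)..(s - h), X r) (X (s - h)) s :=
    (hd (s - h)).comp_sub_const s h
  have : steklov h X = fun s => h⁻¹ • ((∫ r in (0 : ℝ)..s, X r) - ∫ r in (0 : ℝ)..(s - h), X r) := by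
    funext s
    rw [steklov, intervalIntegral.integral_interval_sub_left (hi _ _) (hi _ _)]
  rw [this]
  exact ((hd s).sub h2).const_smul _

lemma map_steklov [CompleteSpace E] [CompleteSpace F] (ι : E →L[ℝ] F) {u : ℝ → E}
    (hu : Integrable u) (h s : ℝ) : ι (steklov h u s) = steklov h (fun r => ι (u r)) s := by
  rw [steklov, steklov, map_smul, ι.intervalIntegral_comp_comm hu.intervalIntegrable]

lemma steklov_congr {u v : ℝ → E} {a b : ℝ} (huv : ∀ᵐ r ∂volume.restrict (Set.Ioo a b), u r = v r)
    {h s : ℝ} (hh : 0 ≤ h) (h1 : a ≤ s - h) (h2 : s ≤ b) : steklov h u s = steklov h v s := by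
  rw [steklov, steklov]
  congr 1
  exact integral_congr_Ioo ⟨h1, by linarith⟩ ⟨by linarith, h2⟩ (by linarith) huv

lemma norm_steklov_le {u : ℝ → E} {C : ℝ} (hC : ∀ r, ‖u r‖ ≤ C) {h : ℝ} (hh : 0 < h) (s : ℝ) :
    ‖steklov h u s‖ ≤ C := by
  have := intervalIntegral.norm_integral_le_of_norm_le_const (a := s - h) (b := s) (f := u)
    (C := C) fun r _ => hC r
  rw [steklov, norm_smul, Real.norm_of_nonneg (inv_nonneg.2 hh.le)]
  rw [sub_sub_cancel, abs_of_pos hh] at this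
  calc h⁻¹ * _ ≤ h⁻¹ * (C * h) := by gcongr
    _ = C := by field_simp

lemma tendsto_steklov_of_continuous [CompleteSpace E] {X : ℝ → E} (hX : Continuous X) {h : ℕ → ℝ}
    (h0 : Tendsto h atTop (𝓝[≠] 0)) (s : ℝ) :
    Tendsto (fun n => steklov (h n) X s) atTop (𝓝 (X s)) := by
  have hi : ∀ x y, IntervalIntegrable X volume x y := fun x y => hX.intervalIntegrable x y
  have h0' : Tendsto (fun n => -h n) atTop (𝓝[≠] 0) := by
    refine tendsto_nhdsWithin_iff.2 ⟨?_, ?_⟩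
    · simpa using (h0.mono_right nhdsWithin_le_nhds).neg
    · filter_upwards [h0.eventually self_mem_nhdsWithin] with n hn
      exact neg_ne_zero.2 hn
  refine ((hasDerivAt_iff_tendsto_slope_zero.1
    (hX.integral_hasStrictDerivAt 0 s).hasDerivAt).comp h0').congr fun n => ?_
  simp only [Function.comp, steklov]
  rw [intervalIntegral.integral_interval_sub_left (hi _ _) (hi _ _), ← sub_eq_add_neg,
    intervalIntegral.integral_symm, inv_neg, smul_neg, neg_smul, neg_neg]

end Steklov

/-! ### Integration by parts and the energy inequality for weak limits -/

section Limit

variable {T : ℝ} [Fact (0 < T)] {V H : Type*} [NormedAddCommGroup V] [NormedSpace ℝ V]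
  [NormedAddCommGroup H] [InnerProductSpace ℝ H] {ι : V →L[ℝ] H} {p q : ℝ}
  {A : ℝ → V → StrongDual ℝ V}
  [TopologicalSpace.SeparableSpace V] [TopologicalSpace.SeparableSpace (StrongDual ℝ V)]

lemma intervalIntegral_eq_integral_Ioo {E : Type*} [NormedAddCommGroup E] [NormedSpace ℝ E]
    {a b : ℝ} (hab : a ≤ b) (f : ℝ → E) : ∫ r in a..b, f r = ∫ r in Set.Ioo a b, f r := by
  rw [intervalIntegral.integral_of_le hab, integral_Ioc_eq_integral_Ioo]

lemma memLp_fun_add {E : Type*} [NormedAddCommGroup E] {r : ENNReal} {μ : Measure ℝ} {f g : ℝ → E}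
    (hf : MemLp f r μ) (hg : MemLp g r μ) : MemLp (fun t => f t + g t) r μ := hf.add hg

/-- Polarization: the energy identity for x + y minus those for x and y is integration by parts. -/
lemma integral_pairing_add_integral_pairing (hpq : p.HolderConjugate q) {a b : ℝ} (hab : a ≤ b)
    {x y : ℝ → H} {u v : ℝ → V} {w g : ℝ → StrongDual ℝ V} (hxc : ContinuousOn x (Set.Icc a b))
    (hyc : ContinuousOn y (Set.Icc a b))
    (hu : MemLp u (ENNReal.ofReal p) (volume.restrict (Set.Ioo a b)))
    (hv : MemLp v (ENNReal.ofReal p) (volume.restrict (Set.Ioo a b)))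
    (hw : MemLp w (ENNReal.ofReal q) (volume.restrict (Set.Ioo a b)))
    (hg : MemLp g (ENNReal.ofReal q) (volume.restrict (Set.Ioo a b)))
    (hxu : ∀ᵐ r ∂volume.restrict (Set.Ioo a b), x r = ι (u r))
    (hyv : ∀ᵐ r ∂volume.restrict (Set.Ioo a b), y r = ι (v r))
    (hx : ∀ t ∈ Set.Icc a b, ∀ v, inner ℝ (x t - x a) (ι v) = ∫ r in a..t, w r v)
    (hy : ∀ t ∈ Set.Icc a b, ∀ v, inner ℝ (y t - y a) (ι v) = ∫ r in a..t, g r v) :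
    (∫ r in Set.Ioo a b, w r (v r)) + ∫ r in Set.Ioo a b, g r (u r)
      = inner ℝ (x b) (y b) - inner ℝ (x a) (y a) := by
  have hq1 := one_le_ofReal_conj hpq
  have e1 := energy_identity ι hpq hxc hu hw hxu hx le_rfl hab le_rfl
  have e2 := energy_identity ι hpq hyc hv hg hyv hy le_rfl hab le_rfl
  have huv : MemLp (fun r => u r + v r) (ENNReal.ofReal p) (volume.restrict (Set.Ioo a b)) :=
    memLp_fun_add hu hv
  have hwg : MemLp (fun r => w r + g r) (ENNReal.ofReal q) (volume.restrict (Set.Ioo a b)) :=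
    memLp_fun_add hw hg
  have hxy : ∀ t ∈ Set.Icc a b, ∀ z, inner ℝ ((x t + y t) - (x a + y a)) (ι z)
      = ∫ r in a..t, (w r + g r) z := fun t ht z => by
    have hs : a ∈ Set.Icc a b := ⟨le_rfl, hab⟩
    rw [add_sub_add_comm, inner_add_left, hx t ht z, hy t ht z]
    refine (intervalIntegral.integral_add ?_ ?_).symm
    · exact intervalIntegrable_of_Ioo ((hw.integrable hq1).apply_continuousLinearMap z) hs ht
    · exact intervalIntegrable_of_Ioo ((hg.integrable hq1).apply_continuousLinearMap z) hs ht
  have hxyuv : ∀ᵐ r ∂volume.restrict (Set.Ioo a b), x r + y r = ι (u r + v r) := by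
    filter_upwards [hxu, hyv] with r h1 h2
    rw [map_add, ← h1, ← h2]
  have e3 := energy_identity ι hpq (hxc.add hyc) huv hwg hxyuv hxy le_rfl hab le_rfl
  rw [intervalIntegral_eq_integral_Ioo hab] at e1 e2 e3
  have iwu := integrable_pairing hpq hw hu
  have iwv := integrable_pairing hpq hw hv
  have igu := integrable_pairing hpq hg hu
  have igv := integrable_pairing hpq hg hv
  have h3 : ∫ r in Set.Ioo a b, (w r + g r) (u r + v r)
      = ((∫ r in Set.Ioo a b, w r (u r)) + ∫ r in Set.Ioo a b, w r (v r))
        + ((∫ r in Set.Ioo a b, g r (u r)) + ∫ r in Set.Ioo a b, g r (v r)) := by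
    rw [← integral_add iwu iwv, ← integral_add igu igv]
    refine Eq.trans ?_ (integral_add (iwu.add iwv) (igu.add igv))
    refine integral_congr_ae (Eventually.of_forall fun r => ?_)
    simp only [_root_.add_apply, map_add]
    ring
  rw [h3] at e3
  simp only [Pi.add_apply] at e3
  rw [norm_add_sq_real, norm_add_sq_real] at e3
  linarith

/-- Against a path that is C¹ in H the derivative moves off the solution. What remains contains only
values of the solution in H and is stable under uniform convergence. -/
lemma IsSol.integral_solDeriv_pairing (hA : HypA T p q A) (hp : 2 ≤ p) (hpq : p.HolderConjugate q)
    {t₀ : Set.Icc (0 : ℝ) T} {x : PathSp T H} {f : ℝ → H} (hx : IsSol ι p A t₀ x f)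
    {v : ℝ → V} {y y' : ℝ → H}
    (hv : MemLp v (ENNReal.ofReal p) (volume.restrict (Set.Ioo (t₀ : ℝ) T)))
    (hy : ∀ s, HasDerivAt y (y' s) s) (hy' : Continuous y')
    (hyv : ∀ᵐ r ∂volume.restrict (Set.Ioo (t₀ : ℝ) T), y r = ι (v r)) :
    ∫ r in Set.Ioo (t₀ : ℝ) T, solDeriv ι A x f r (v r)
      = inner ℝ (pathAt x T) (y T) - inner ℝ (pathAt x t₀) (y t₀)
        - ∫ r in Set.Ioo (t₀ : ℝ) T, inner ℝ (pathAt x r) (y' r) := by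
  have h0T : (t₀ : ℝ) ≤ T := t₀.2.2
  have mw := memLp_solDeriv hA hp hpq hx.memLp hx.memLp_source
  have mg : MemLp (fun r => toDual ι (y' r)) (ENNReal.ofReal q)
      (volume.restrict (Set.Ioo (t₀ : ℝ) T)) := by
    have hc : Continuous fun r => toDual ι (y' r) := (toDualL ι).continuous.comp hy'
    obtain ⟨C, hC⟩ := isCompact_Icc.exists_bound_of_continuousOn (s := Set.Icc (t₀ : ℝ) T)
      hc.continuousOn
    refine MemLp.of_bound hc.aestronglyMeasurable C ?_
    filter_upwards [ae_restrict_mem measurableSet_Ioo] with r hr using hC r ⟨hr.1.le, hr.2.le⟩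
  have hyc : Continuous y := continuous_iff_continuousAt.2 fun s => (hy s).continuousAt
  have eqy : ∀ t ∈ Set.Icc (t₀ : ℝ) T, ∀ v, inner ℝ (y t - y t₀) (ι v)
      = ∫ r in (t₀ : ℝ)..t, toDual ι (y' r) v := fun t ht v => by
    have := intervalIntegral.integral_eq_sub_of_hasDerivAt (a := (t₀ : ℝ)) (b := t)
      (f := fun s => inner ℝ (y s) (ι v)) (f' := fun s => inner ℝ (y' s) (ι v))
      (fun s _ => by simpa using (hy s).inner ℝ (hasDerivAt_const s (ι v)))
      ((hy'.inner continuous_const).intervalIntegrable _ _)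
    rw [inner_sub_left, ← this]
    rfl
  have hux : ∀ᵐ r ∂volume.restrict (Set.Ioo (t₀ : ℝ) T), pathAt x r = ι (toV ι (pathAt x r)) :=
    hx.mem_range.mono fun r hr => (map_toV hr).symm
  have h := integral_pairing_add_integral_pairing hpq h0T (continuous_pathAt x).continuousOn
    hyc.continuousOn hx.memLp hv mw mg hux hyv (fun t ht v => hx.eqn t ht v) eqy
  have h4 : ∫ r in Set.Ioo (t₀ : ℝ) T, toDual ι (y' r) (toV ι (pathAt x r))
      = ∫ r in Set.Ioo (t₀ : ℝ) T, inner ℝ (pathAt x r) (y' r) := by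
    refine integral_congr_ae (hux.mono fun r hr => ?_)
    simp only [toDual_apply]
    rw [← hr, real_inner_comm]
  rw [h4] at h
  linarith

variable [CompleteSpace V] [CompleteSpace H]

lemma memLp_indicator_toV {t₀ : Set.Icc (0 : ℝ) T} {u : ℝ → V}
    (hu : MemLp u (ENNReal.ofReal p) (volume.restrict (Set.Ioo (t₀ : ℝ) T))) (hp : 2 ≤ p) :
    Integrable ((Set.Ioo (t₀ : ℝ) T).indicator u) ∧
      Integrable fun r => ‖(Set.Ioo (t₀ : ℝ) T).indicator u r‖ ^ p := by
  have hp1 : 1 ≤ ENNReal.ofReal p := by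
    rw [← ENNReal.ofReal_one]; exact ENNReal.ofReal_le_ofReal (by linarith)
  refine ⟨(integrable_indicator_iff measurableSet_Ioo).2 (hu.integrable hp1), ?_⟩
  have := ((memLp_indicator_iff_restrict measurableSet_Ioo).2 hu).integrable_norm_rpow
    (by positivity) ENNReal.ofReal_ne_top
  rwa [ENNReal.toReal_ofReal (by linarith)] at this

/-- If Λ were known to come from the equation, this would be the energy identity for x. Here Λ is
only a functional, so it is evaluated on backward Steklov averages of x, which are C¹ in H.
Integration by parts is available for them, and convexity of the squared norm gives the inequality
in the direction that Minty's argument needs. -/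
lemma energy_le_weak_limit [Fact (1 ≤ ENNReal.ofReal p)]
    (hA : HypA T p q A) (hp : 2 ≤ p) (hpq : p.HolderConjugate q)
    {t₀ t₁ : Set.Icc (0 : ℝ) T} (h01 : t₀ < t₁) {xs : ℕ → PathSp T H}
    {x : PathSp T H} {fs : ℕ → ℝ → H} {f : ℝ → H} (hs : ∀ n, IsSol ι p A t₁ (xs n) (fs n))
    (hlim : Tendsto xs atTop (𝓝 x))
    (hmem : ∀ᵐ r ∂volume.restrict (Set.Ioo (t₀ : ℝ) T), pathAt x r ∈ Set.range ι)
    (hu₀ : MemLp (fun r => toV ι (pathAt x r)) (ENNReal.ofReal p)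
      (volume.restrict (Set.Ioo (t₀ : ℝ) T)))
    (hu : MemLp (fun r => toV ι (pathAt x r)) (ENNReal.ofReal p)
      (volume.restrict (Set.Ioo (t₁ : ℝ) T)))
    (hf : MemLp f 2 (volume.restrict (Set.Ioo (t₁ : ℝ) T)))
    (hfw : ∀ g : ℝ → H, Continuous g → Tendsto (fun n => ∫ r in Set.Ioo (t₁ : ℝ) T,
      inner ℝ (fs n r) (g r)) atTop (𝓝 (∫ r in Set.Ioo (t₁ : ℝ) T, inner ℝ (f r) (g r))))
    (Λ : StrongDual ℝ (Lp V (ENNReal.ofReal p) (volume.restrict (Set.Ioo (t₁ : ℝ) T))))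
    (hΛ : ∀ (v : ℝ → V) (hv : MemLp v (ENNReal.ofReal p) (volume.restrict (Set.Ioo (t₁ : ℝ) T))),
      Tendsto (fun n => ∫ r in Set.Ioo (t₁ : ℝ) T, A r (toV ι (pathAt (xs n) r)) (v r)) atTop
        (𝓝 (Λ (hv.toLp v)))) :
    (∫ r in Set.Ioo (t₁ : ℝ) T, inner ℝ (f r) (pathAt x r))
      - (‖pathAt x T‖ ^ 2 - ‖pathAt x t₁‖ ^ 2) / 2 ≤ Λ (hu.toLp _) := by
  have h1T : (t₁ : ℝ) ≤ T := t₁.2.2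
  have h01' : (t₀ : ℝ) < t₁ := h01
  set û := (Set.Ioo (t₀ : ℝ) T).indicator fun r => toV ι (pathAt x r) with hû
  obtain ⟨hûi, hûp⟩ := memLp_indicator_toV hu₀ hp
  rw [← hû] at hûi hûp
  have hxc := continuous_pathAt x
  -- Steps of at most t₁ - t₀ keep the backward averages on (t₁, T) inside (t₀, T), where x takes
  -- values in V; the interior time t₁ is introduced for this purpose.
  set h : ℕ → ℝ := fun n => (t₁ - t₀) / (n + 1) with hh
  have hhpos : ∀ n, 0 < h n := fun n => div_pos (by linarith) (by positivity)
  have hhle : ∀ n, h n ≤ t₁ - t₀ := fun n =>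
    div_le_self (by linarith) (by linarith [(Nat.cast_nonneg n : (0 : ℝ) ≤ n)])
  have hh0 : Tendsto h atTop (𝓝 0) := 
    ((tendsto_const_div_atTop_nhds_zero_nat ((t₁ : ℝ) - t₀)).comp
      (tendsto_add_atTop_nat 1)).congr fun n => by simp [hh]
  have hh0' : Tendsto h atTop (𝓝[≠] 0) :=
    tendsto_nhdsWithin_iff.2 ⟨hh0, Eventually.of_forall fun n => (hhpos n).ne'⟩
  have hv : ∀ n, MemLp (steklov (h n) û) (ENNReal.ofReal p)
      (volume.restrict (Set.Ioo (t₁ : ℝ) T)) := fun n => by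
    have hc := continuous_steklov hûi (h n)
    obtain ⟨C, hC⟩ := isCompact_Icc.exists_bound_of_continuousOn (s := Set.Icc (t₁ : ℝ) T)
      hc.continuousOn
    refine MemLp.of_bound hc.aestronglyMeasurable C ?_
    filter_upwards [ae_restrict_mem measurableSet_Ioo] with r hr using hC r ⟨hr.1.le, hr.2.le⟩
  set y : ℕ → ℝ → H := fun n => steklov (h n) (pathAt x)
  set y' : ℕ → ℝ → H := fun n s => (h n)⁻¹ • (pathAt x s - pathAt x (s - h n))
  have hyc : ∀ n, Continuous (y n) := fun n =>
    continuous_iff_continuousAt.2 fun s => (hasDerivAt_steklov hxc (h n) s).continuousAt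
  have hyc' : ∀ n, Continuous (y' n) := fun n =>
    (hxc.sub (hxc.comp (continuous_id.sub continuous_const))).const_smul _
  have hyv : ∀ n, ∀ᵐ r ∂volume.restrict (Set.Ioo (t₁ : ℝ) T), y n r = ι (steklov (h n) û r) :=
    fun n => by
    filter_upwards [ae_restrict_mem measurableSet_Ioo] with r hr
    rw [map_steklov ι hûi]
    refine steklov_congr (a := t₀) (b := T) ?_ (hhpos n).le (by linarith [hhle n, hr.1]) hr.2.le
    filter_upwards [hmem, ae_restrict_mem measurableSet_Ioo] with r h1 h2
    rw [hû, Set.indicator_of_mem h2, map_toV h1]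
  -- For a fixed average, the solutions `xs m` are integrated by parts and m tends to infinity;
  -- uniform convergence of the paths and weak convergence of the sources suffice.
  have hval : ∀ n, Λ ((hv n).toLp _) = (∫ r in Set.Ioo (t₁ : ℝ) T, inner ℝ (f r) (y n r))
      - (inner ℝ (pathAt x T) (y n T) - inner ℝ (pathAt x t₁) (y n t₁)
        - ∫ r in Set.Ioo (t₁ : ℝ) T, inner ℝ (pathAt x r) (y' n r)) := fun n => by
    have hx : ∀ r, Tendsto (fun m => pathAt (xs m) r) atTop (𝓝 (pathAt x r)) := fun r =>
      ((continuous_eval_const (clampTime r)).tendsto x).comp hlim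
    have hint : Tendsto (fun m => ∫ r in Set.Ioo (t₁ : ℝ) T, inner ℝ (pathAt (xs m) r) (y' n r))
        atTop (𝓝 (∫ r in Set.Ioo (t₁ : ℝ) T, inner ℝ (pathAt x r) (y' n r))) := by
      obtain ⟨C, hC⟩ := isCompact_Icc.exists_bound_of_continuousOn (s := Set.Icc (t₁ : ℝ) T)
        (hyc' n).continuousOn
      obtain ⟨D, hD⟩ := hlim.norm.bddAbove_range
      refine tendsto_integral_of_dominated_convergence (fun _ => D * C)
        (fun m => ((continuous_pathAt _).inner (hyc' n)).aestronglyMeasurable)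
        (integrable_const _) (fun m => ?_)
        (Eventually.of_forall fun r => (hx r).inner tendsto_const_nhds)
      filter_upwards [ae_restrict_mem measurableSet_Ioo] with r hr
      have hm : ‖pathAt (xs m) r‖ ≤ D := ((xs m).norm_coe_le_norm _).trans (hD ⟨m, rfl⟩)
      exact (norm_inner_le_norm _ _).trans (mul_le_mul hm (hC r ⟨hr.1.le, hr.2.le⟩)
        (norm_nonneg _) ((norm_nonneg _).trans hm))
    refine tendsto_nhds_unique (hΛ _ (hv n)) (((hfw (y n) (hyc n)).sub
      ((((hx T).inner tendsto_const_nhds).sub ((hx t₁).inner tendsto_const_nhds)).sub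
        hint)).congr fun m => ?_)
    rw [← (hs m).integral_solDeriv_pairing hA hp hpq (hv n)
      (hasDerivAt_steklov hxc (h n)) (hyc' n) (hyv n)]
    have i1 := integrable_inner_continuous (hs m).memLp_source (hyc n)
    have i2 := integrable_pairing hpq
      (memLp_solDeriv hA hp hpq (hs m).memLp (hs m).memLp_source) (hv n)
    rw [← integral_sub i1 i2]
    refine integral_congr_ae ((hyv n).mono fun r hr => ?_)
    simp only [solDeriv, _root_.sub_apply, toDual_apply]
    rw [hr]; ring
  set N : ℝ → ℝ := fun s => ‖pathAt x s‖ ^ 2 / 2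
  have hN : Continuous N := (hxc.norm.pow 2).div_const 2
  have hneg : Tendsto (fun n => -h n) atTop (𝓝[≠] 0) := by
    refine tendsto_nhdsWithin_iff.2 ⟨by simpa using hh0.neg, Eventually.of_forall fun n => ?_⟩
    exact neg_ne_zero.2 (hhpos n).ne'
  have hNlim := tendsto_integral_diffQuot hN t₁ T hneg
  -- Convexity gives (x(r), x(r) - x(r-h)) ≥ N(r) - N(r-h), and the integral of this backward
  -- difference quotient telescopes.
  have hlow : ∀ n, (∫ r in Set.Ioo (t₁ : ℝ) T, inner ℝ (f r) (y n r))
      - (inner ℝ (pathAt x T) (y n T) - inner ℝ (pathAt x t₁) (y n t₁)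
        - ∫ r in (t₁ : ℝ)..T, (-h n)⁻¹ * (N (r + -h n) - N r)) ≤ Λ ((hv n).toLp _) := fun n => by
    rw [hval n, intervalIntegral_eq_integral_Ioo h1T]
    have : ∫ r in Set.Ioo (t₁ : ℝ) T, (-h n)⁻¹ * (N (r + -h n) - N r)
        ≤ ∫ r in Set.Ioo (t₁ : ℝ) T, inner ℝ (pathAt x r) (y' n r) := by
      refine integral_mono (μ := volume.restrict (Set.Ioo (t₁ : ℝ) T)) ?_ ?_ fun r => ?_
      · exact (((hN.comp (continuous_id.add continuous_const)).sub hN).const_smul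
          (-h n)⁻¹).integrableOn_Icc.mono_set Set.Ioo_subset_Icc_self
      · exact (hxc.inner (hyc' n)).integrableOn_Icc.mono_set Set.Ioo_subset_Icc_self
      · have hh := two_mul_inner_sub_le (pathAt x r) (pathAt x (r - h n))
        have hhi := inv_nonneg.2 (hhpos n).le
        simp only [N, y', inner_smul_right, ← sub_eq_add_neg, inv_neg]
        have e : inner ℝ (pathAt x r) (pathAt x r - pathAt x (r - h n))
            = -inner ℝ (pathAt x (r - h n) - pathAt x r) (pathAt x r) := by
          rw [← inner_neg_left, neg_sub, real_inner_comm]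
        rw [e]
        nlinarith
    linarith
  have hy : ∀ r, Tendsto (fun n => y n r) atTop (𝓝 (pathAt x r)) :=
    tendsto_steklov_of_continuous hxc hh0'
  have hfy : Tendsto (fun n => ∫ r in Set.Ioo (t₁ : ℝ) T, inner ℝ (f r) (y n r)) atTop
      (𝓝 (∫ r in Set.Ioo (t₁ : ℝ) T, inner ℝ (f r) (pathAt x r))) := by
    have hfi : Integrable f (volume.restrict (Set.Ioo (t₁ : ℝ) T)) := hf.integrable (by norm_num)
    refine tendsto_integral_of_dominated_convergence (fun r => ‖f r‖ * ‖x‖)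
      (fun n => hf.1.inner (hyc n).aestronglyMeasurable) (hfi.norm.mul_const _)
      (fun n => Eventually.of_forall fun r => ?_)
      (Eventually.of_forall fun r => tendsto_const_nhds.inner (hy r))
    exact (norm_inner_le_norm _ _).trans (mul_le_mul_of_nonneg_left
      (norm_steklov_le (fun s => x.norm_coe_le_norm _) (hhpos n) r) (norm_nonneg _))
  have hvlim : Tendsto (fun n => (hv n).toLp _) atTop (𝓝 (hu.toLp _)) := by
    rw [Lp.tendsto_Lp_iff_tendsto_eLpNorm'']
    have hst := (tendsto_integral_norm_steklov_sub (p := p) (by linarith) hûi hûp hhpos hh0 h1T).2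
    simp only [integral_Ioc_eq_integral_Ioo] at hst
    have h2 : Tendsto (fun n => ENNReal.ofReal ((∫ r in Set.Ioo (t₁ : ℝ) T,
        ‖steklov (h n) û r - û r‖ ^ p) ^ p⁻¹)) atTop (𝓝 0) := by
      have := (ENNReal.continuous_ofReal.tendsto _).comp
        (hst.rpow_const (p := p⁻¹) (Or.inr (by positivity)))
      rwa [Real.zero_rpow (inv_ne_zero (by linarith : p ≠ 0)), ENNReal.ofReal_zero] at this
    refine h2.congr fun n => ?_
    have e : steklov (h n) û - (fun r => toV ι (pathAt x r))
        =ᵐ[volume.restrict (Set.Ioo (t₁ : ℝ) T)] fun r => steklov (h n) û r - û r := by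
      filter_upwards [ae_restrict_mem measurableSet_Ioo] with r hr
      have hr' : r ∈ Set.Ioo (t₀ : ℝ) T := ⟨h01'.trans hr.1, hr.2⟩
      rw [Pi.sub_apply, hû, Set.indicator_of_mem hr']
    rw [((hv n).sub hu).eLpNorm_eq_integral_rpow_norm (by positivity) ENNReal.ofReal_ne_top,
      ENNReal.toReal_ofReal (by linarith)]
    congr 2
    refine integral_congr_ae (e.mono fun r hr => ?_)
    simp only [hr]
  have hfin := le_of_tendsto_of_tendsto (hfy.sub
      (((tendsto_const_nhds.inner (hy T)).sub (tendsto_const_nhds.inner (hy t₁))).sub hNlim))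
    ((Λ.continuous.tendsto _).comp hvlim) (Eventually.of_forall hlow)
  refine le_trans (le_of_eq ?_) hfin
  simp only [N, real_inner_self_eq_norm_sq]
  ring

end Limit

/-! ### Minty's argument: the weak limit of A(t, x_n) is A(t, x) -/

section LimitEquation

variable {T : ℝ} [Fact (0 < T)] {V H : Type*} [NormedAddCommGroup V] [NormedSpace ℝ V]
  [NormedAddCommGroup H] [InnerProductSpace ℝ H] {ι : V →L[ℝ] H} {p q : ℝ}
  {A : ℝ → V → StrongDual ℝ V}
  [TopologicalSpace.SeparableSpace V] [TopologicalSpace.SeparableSpace H]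
  [CompleteSpace V] [CompleteSpace H]

/-- A continuous injection between Polish spaces is a measurable embedding, so the partial inverse
of ι preserves measurability. -/
lemma aestronglyMeasurable_toV (hinj : Function.Injective ι) {μ : Measure ℝ} {x : ℝ → H}
    (hx : Continuous x) (hmem : ∀ᵐ r ∂μ, x r ∈ Set.range ι) :
    AEStronglyMeasurable (fun r => toV ι (x r)) μ := by
  borelize V
  borelize H
  have : SecondCountableTopology V := UniformSpace.secondCountable_of_separable _
  have : SecondCountableTopology H := UniformSpace.secondCountable_of_separable _
  refine AEMeasurable.aestronglyMeasurable ?_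
  rw [← (ι.continuous.measurableEmbedding hinj).aemeasurable_comp_iff]
  refine hx.measurable.aemeasurable.congr (hmem.mono fun r hr => ?_)
  exact (map_toV hr).symm

/-- Pointwise limits in `H` of sequences bounded in `L^p(V)` are in `L^p(V)`. -/
lemma memLp_toV_of_tendsto (hι : IsGelfandTriple ι) (hp : 0 < p) {μ : Measure ℝ}
    {X : ℕ → ℝ → H} {x : ℝ → H} (hx : Continuous x)
    (hlim : ∀ r, Tendsto (fun n => X n r) atTop (𝓝 (x r)))
    (hmem : ∀ n, ∀ᵐ r ∂μ, X n r ∈ Set.range ι)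
    (hX : ∀ n, AEStronglyMeasurable (fun r => toV ι (X n r)) μ) {M : ENNReal} (hM : M ≠ ⊤)
    (hXM : ∀ n, eLpNorm (fun r => toV ι (X n r)) (ENNReal.ofReal p) μ ≤ M) :
    (∀ᵐ r ∂μ, x r ∈ Set.range ι) ∧ MemLp (fun r => toV ι (x r)) (ENNReal.ofReal p) μ := by
  have hp0 : ENNReal.ofReal p ≠ 0 := by simpa using hp
  -- By Fatou's lemma `G` is integrable, hence finite almost everywhere. At such a time a
  -- subsequence is bounded in V, and its weak limit in V must be the limit in H.
  set G : ℝ → ENNReal := fun r => liminf (fun n => ‖toV ι (X n r)‖ₑ ^ p) atTop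
  have hG : ∫⁻ r, G r ∂μ ≤ M ^ p := by
    refine (lintegral_liminf_le' fun n => (hX n).enorm.pow_const p).trans ?_
    refine liminf_le_of_le (by isBoundedDefault) fun b hb => ?_
    obtain ⟨n, hn⟩ := hb.exists
    refine hn.trans ?_
    have := hXM n
    rw [eLpNorm_eq_lintegral_rpow_enorm_toReal hp0 ENNReal.ofReal_ne_top,
      ENNReal.toReal_ofReal hp.le, one_div, ENNReal.rpow_inv_le_iff hp] at this
    exact this
  have hGm : AEMeasurable G μ := by
    refine ⟨fun r => liminf (fun n => ((hX n).enorm.pow_const p).mk _ r) atTop,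
      Measurable.liminf fun n => ((hX n).enorm.pow_const p).measurable_mk, ?_⟩
    filter_upwards [ae_all_iff.2 fun n => ((hX n).enorm.pow_const p).ae_eq_mk] with r hr
    simp only [G, hr]
  have hGt : ∀ᵐ r ∂μ, G r < ⊤ :=
    ae_lt_top' hGm (hG.trans_lt (ENNReal.rpow_lt_top_of_nonneg hp.le hM)).ne
  have key : ∀ᵐ r ∂μ, x r ∈ Set.range ι ∧ ‖toV ι (x r)‖ₑ ^ p ≤ G r := by
    filter_upwards [hGt, ae_all_iff.2 hmem] with r hr hmem
    have h1 : ∀ c, G r < c → c ≠ ⊤ → x r ∈ Set.range ι ∧ ‖toV ι (x r)‖ₑ ^ p ≤ c := by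
      intro c hc hct
      obtain ⟨ψ, hψ, hψc⟩ := extraction_of_frequently_atTop (frequently_lt_of_liminf_lt (by
        isBoundedDefault) hc)
      have hct' : c ^ p⁻¹ ≠ ⊤ := ENNReal.rpow_ne_top_of_nonneg (by positivity) hct
      obtain ⟨v, hv, hvR⟩ := exists_weak_limit hι (U := fun n => toV ι (X (ψ n) r))
        (R := (c ^ p⁻¹).toReal) (fun n => by
          rw [← toReal_enorm]
          refine ENNReal.toReal_mono hct' ?_
          rw [ENNReal.le_rpow_inv_iff hp]
          exact (hψc n).le)
        (y := x r) (by
          refine ((hlim r).comp hψ.tendsto_atTop).congr fun n => ?_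
          exact (map_toV (hmem _)).symm)
      refine ⟨⟨v, hv⟩, ?_⟩
      rw [← hv, toV_apply hι.injective, ← ENNReal.le_rpow_inv_iff hp, ← ENNReal.ofReal_toReal hct',
        ← ofReal_norm]
      exact ENNReal.ofReal_le_ofReal hvR
    obtain ⟨c, hc, hct⟩ := exists_between hr
    refine ⟨(h1 c hc hct.ne).1, le_of_forall_gt_imp_ge_of_dense fun c hc => ?_⟩
    by_cases hct : c = ⊤
    · exact hct ▸ le_top
    · exact (h1 c hc hct).2
  have hmemx : ∀ᵐ r ∂μ, x r ∈ Set.range ι := key.mono fun r h => h.1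
  refine ⟨hmemx, aestronglyMeasurable_toV hι.injective hx hmemx, ?_⟩
  rw [eLpNorm_lt_top_iff_lintegral_rpow_enorm_lt_top hp0 ENNReal.ofReal_ne_top,
    ENNReal.toReal_ofReal hp.le]
  exact ((lintegral_mono_ae (key.mono fun r h => h.2)).trans hG).trans_lt
    (ENNReal.rpow_lt_top_of_nonneg hp.le hM)

/-- Weak convergence of the sources paired with uniform convergence of the paths. -/
lemma tendsto_integral_inner_of_weak {μ : Measure ℝ} [IsFiniteMeasure μ] {xs : ℕ → PathSp T H}
    {x : PathSp T H} (hlim : Tendsto xs atTop (𝓝 x)) {fs : ℕ → ℝ → H} {f : ℝ → H} {B : ℝ}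
    (hm : ∀ n, AEStronglyMeasurable (fs n) μ)
    (hB : ∀ n, ∀ᵐ r ∂μ, ‖fs n r‖ ≤ B)
    (hfx : Tendsto (fun n => ∫ r, inner ℝ (fs n r) (pathAt x r) ∂μ) atTop
      (𝓝 (∫ r, inner ℝ (f r) (pathAt x r) ∂μ))) :
    Tendsto (fun n => ∫ r, inner ℝ (fs n r) (pathAt (xs n) r) ∂μ) atTop
      (𝓝 (∫ r, inner ℝ (f r) (pathAt x r) ∂μ)) := by
  have hint : ∀ n (y : PathSp T H), Integrable (fun r => inner ℝ (fs n r) (pathAt y r)) μ :=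
    fun n y => Integrable.of_bound ((hm n).inner (continuous_pathAt y).aestronglyMeasurable)
      (B * ‖y‖) (by
        filter_upwards [hB n] with r hr
        exact (norm_inner_le_norm _ _).trans (mul_le_mul hr (y.norm_coe_le_norm _)
          (norm_nonneg _) ((norm_nonneg _).trans hr)))
  have h1 : Tendsto (fun n => (∫ r, inner ℝ (fs n r) (pathAt (xs n) r) ∂μ)
      - ∫ r, inner ℝ (fs n r) (pathAt x r) ∂μ) atTop (𝓝 0) := by
    refine squeeze_zero_norm (a := fun n => B * ‖xs n - x‖ * μ.real Set.univ) (fun n => ?_) ?_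
    · rw [← integral_sub (hint n _) (hint n _)]
      refine norm_integral_le_of_norm_le_const ?_
      filter_upwards [hB n] with r hr
      rw [← inner_sub_right]
      exact (norm_inner_le_norm _ _).trans (mul_le_mul hr ((xs n - x).norm_coe_le_norm _)
          (norm_nonneg _) ((norm_nonneg _).trans hr))
    · have := ((tendsto_iff_norm_sub_tendsto_zero.1 hlim).const_mul B).mul_const (μ.real Set.univ)
      simpa using this
  simpa using h1.add hfx

variable [TopologicalSpace.SeparableSpace (StrongDual ℝ V)]

/-- The energies ∫⟨A(x_n), x_n⟩ converge to the number E determined by the energy identities, and E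
≤ Λ(x) by `energy_le_weak_limit`. Monotonicity against u - θw, divided by θ and followed by θ → 0,
gives ∫⟨A(x), w⟩ ≤ Λ(w); replacing w by -w gives equality. -/
lemma weak_limit_eq_integral [Fact (1 ≤ ENNReal.ofReal p)] (hι : IsGelfandTriple ι)
    (hA : HypA T p q A) (hp : 2 ≤ p) (hpq : p.HolderConjugate q)
    {t₀ t₁ : Set.Icc (0 : ℝ) T} (h01 : t₀ < t₁) {xs : ℕ → PathSp T H}
    {x : PathSp T H} {fs : ℕ → ℝ → H} {f : ℝ → H} (hs : ∀ n, IsSol ι p A t₁ (xs n) (fs n))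
    (hlim : Tendsto xs atTop (𝓝 x)) {M : ENNReal} (hM : M ≠ ⊤)
    (hUM : ∀ n, eLpNorm (fun r => toV ι (pathAt (xs n) r)) (ENNReal.ofReal p)
      (volume.restrict (Set.Ioo (t₁ : ℝ) T)) ≤ M)
    (hmem : ∀ᵐ r ∂volume.restrict (Set.Ioo (t₀ : ℝ) T), pathAt x r ∈ Set.range ι)
    (hu₀ : MemLp (fun r => toV ι (pathAt x r)) (ENNReal.ofReal p)
      (volume.restrict (Set.Ioo (t₀ : ℝ) T)))
    {B : ℝ} (hB : ∀ n, ∀ᵐ r ∂volume.restrict (Set.Ioo (t₁ : ℝ) T), ‖fs n r‖ ≤ B)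
    (hf : MemLp f 2 (volume.restrict (Set.Ioo (t₁ : ℝ) T)))
    (hfw : ∀ g : ℝ → H, Continuous g → Tendsto (fun n => ∫ r in Set.Ioo (t₁ : ℝ) T,
      inner ℝ (fs n r) (g r)) atTop (𝓝 (∫ r in Set.Ioo (t₁ : ℝ) T, inner ℝ (f r) (g r))))
    (Λ : StrongDual ℝ (Lp V (ENNReal.ofReal p) (volume.restrict (Set.Ioo (t₁ : ℝ) T))))
    (hΛ : ∀ (v : ℝ → V) (hv : MemLp v (ENNReal.ofReal p) (volume.restrict (Set.Ioo (t₁ : ℝ) T))),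
      Tendsto (fun n => ∫ r in Set.Ioo (t₁ : ℝ) T, A r (toV ι (pathAt (xs n) r)) (v r)) atTop
        (𝓝 (Λ (hv.toLp v))))
    {w : ℝ → V} (hw : MemLp w (ENNReal.ofReal p) (volume.restrict (Set.Ioo (t₁ : ℝ) T))) :
    Λ (hw.toLp w) = ∫ r in Set.Ioo (t₁ : ℝ) T, A r (toV ι (pathAt x r)) (w r) := by
  have h1T : (t₁ : ℝ) ≤ T := t₁.2.2
  have h01' : (t₀ : ℝ) < t₁ := h01
  have hle : volume.restrict (Set.Ioo (t₁ : ℝ) T) ≤ volume.restrict (Set.Ioo (t₀ : ℝ) T) :=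
    Measure.restrict_mono (Set.Ioo_subset_Ioo_left h01'.le) le_rfl
  have hu := hu₀.mono_measure hle
  have hmem₁ := ae_mono hle hmem
  have hE := energy_le_weak_limit hA hp hpq h01 hs hlim hmem hu₀ hu hf hfw Λ hΛ
  set E := (∫ r in Set.Ioo (t₁ : ℝ) T, inner ℝ (f r) (pathAt x r))
      - (‖pathAt x T‖ ^ 2 - ‖pathAt x t₁‖ ^ 2) / 2 with hEdef
  have hx : ∀ r, Tendsto (fun m => pathAt (xs m) r) atTop (𝓝 (pathAt x r)) := fun r =>
    ((continuous_eval_const (clampTime r)).tendsto x).comp hlim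
  have hAmem : ∀ z : ℝ → V, MemLp z (ENNReal.ofReal p) (volume.restrict (Set.Ioo (t₁ : ℝ) T)) →
      MemLp (fun r => A r (z r)) (ENNReal.ofReal q) (volume.restrict (Set.Ioo (t₁ : ℝ) T)) :=
    fun z hz => hA.memLp hp hpq t₁.2.1 hz
  have han : Tendsto (fun n => ∫ r in Set.Ioo (t₁ : ℝ) T,
      A r (toV ι (pathAt (xs n) r)) (toV ι (pathAt (xs n) r))) atTop (𝓝 E) := by
    have h1 := tendsto_integral_inner_of_weak hlim (fun n => (hs n).memLp_source.1) hB
      (hfw _ (continuous_pathAt x))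
    refine (h1.sub ((((hx T).norm.pow 2).sub ((hx t₁).norm.pow 2)).div_const 2)).congr fun n => ?_
    have := (hs n).energy hA hp hpq (t := T) ⟨h1T, le_rfl⟩
    rw [intervalIntegral_eq_integral_Ioo h1T, intervalIntegral_eq_integral_Ioo h1T] at this
    linarith
  have hAz : ∀ z : ℝ → V, MemLp z (ENNReal.ofReal p) (volume.restrict (Set.Ioo (t₁ : ℝ) T)) →
      Tendsto (fun n => ∫ r in Set.Ioo (t₁ : ℝ) T, A r (z r) (toV ι (pathAt (xs n) r))) atTop
        (𝓝 (∫ r in Set.Ioo (t₁ : ℝ) T, A r (z r) (toV ι (pathAt x r)))) := fun z hz => by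
    obtain ⟨D, hD⟩ := hlim.norm.bddAbove_range
    refine tendsto_integral_pairing hι hpq (fun n => (hs n).memLp) hu hM hUM (C := D)
      (fun n => ?_) ?_ (hAmem z hz)
    · filter_upwards [(hs n).mem_range] with r hr
      rw [map_toV hr]
      exact ((xs n).norm_coe_le_norm _).trans (hD ⟨n, rfl⟩)
    · filter_upwards [hmem₁, ae_all_iff.2 fun n => (hs n).mem_range] with r h1 h2
      rw [map_toV h1]
      exact (hx r).congr fun n => (map_toV (h2 n)).symm
  have hmono : ∀ᵐ r ∂volume.restrict (Set.Ioo (t₁ : ℝ) T), ∀ x y : V,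
      0 ≤ (A r x - A r y) (x - y) := ae_mono (restrict_Ioo_le_Icc t₁.2.1) hA.monotone
  have hhemi : ∀ᵐ r ∂volume.restrict (Set.Ioo (t₁ : ℝ) T), ∀ x y v : V,
      ContinuousOn (fun s : ℝ => A r (x + s • y) v) (Set.Icc 0 1) :=
    ae_mono (restrict_Ioo_le_Icc t₁.2.1) hA.hemicontinuous
  have hminty : ∀ (z : ℝ → V)
      (hz : MemLp z (ENNReal.ofReal p) (volume.restrict (Set.Ioo (t₁ : ℝ) T))),
      0 ≤ E - Λ (hz.toLp z) - (∫ r in Set.Ioo (t₁ : ℝ) T, A r (z r) (toV ι (pathAt x r)))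
        + ∫ r in Set.Ioo (t₁ : ℝ) T, A r (z r) (z r) := fun z hz => by
    refine ge_of_tendsto (((han.sub (hΛ z hz)).sub (hAz z hz)).add_const _)
      (Eventually.of_forall fun n => ?_)
    have i1 := integrable_pairing hpq (hAmem _ (hs n).memLp) (hs n).memLp
    have i2 := integrable_pairing hpq (hAmem _ (hs n).memLp) hz
    have i3 := integrable_pairing hpq (hAmem _ hz) (hs n).memLp
    have i4 := integrable_pairing hpq (hAmem _ hz) hz
    have e1 := integral_sub i1 i2
    have e2 := integral_sub (i1.sub i2) i3
    have e3 := integral_add ((i1.sub i2).sub i3) i4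
    simp only [Pi.sub_apply] at e2 e3
    rw [← e1, ← e2, ← e3]
    refine integral_nonneg_of_ae (hmono.mono fun r hr => ?_)
    have := hr (toV ι (pathAt (xs n) r)) (z r)
    simp only [_root_.sub_apply, map_sub] at this
    simp only [Pi.zero_apply]
    linarith
  have hone : ∀ (w : ℝ → V)
      (hw : MemLp w (ENNReal.ofReal p) (volume.restrict (Set.Ioo (t₁ : ℝ) T))),
      ∫ r in Set.Ioo (t₁ : ℝ) T, A r (toV ι (pathAt x r)) (w r) ≤ Λ (hw.toLp w) := fun w hw => by
    set θ : ℕ → ℝ := fun n => 1 / ((n : ℝ) + 1)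
    have hθ0 : ∀ n, 0 < θ n := fun n => by positivity
    have hθ1 : ∀ n, θ n ≤ 1 := fun n => by
      simp only [θ]; rw [div_le_one (by positivity)]; linarith [(Nat.cast_nonneg n : (0 : ℝ) ≤ n)]
    have hθ : Tendsto θ atTop (𝓝 0) := tendsto_one_div_add_atTop_nhds_zero_nat
    set z : ℕ → ℝ → V := fun n r => toV ι (pathAt x r) + θ n • -w r
    have hz : ∀ n, MemLp (z n) (ENNReal.ofReal p) (volume.restrict (Set.Ioo (t₁ : ℝ) T)) :=
      fun n => memLp_fun_add hu (hw.neg.const_smul (θ n))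
    have h1 : ∀ n, ∫ r in Set.Ioo (t₁ : ℝ) T, A r (z n r) (w r) ≤ Λ (hw.toLp w) := fun n => by
      have h := hminty (z n) (hz n)
      have e1 : Λ ((hz n).toLp _) = Λ (hu.toLp _) - θ n * Λ (hw.toLp w) := by
        have : (hz n).toLp _ = hu.toLp _ + θ n • -(hw.toLp w) := by
          rw [← MemLp.toLp_neg, ← MemLp.toLp_const_smul, ← MemLp.toLp_add]
          rfl
        rw [this, map_add, map_smul, map_neg, smul_eq_mul]
        ring
      have i1 := integrable_pairing hpq (hAmem _ (hz n)) hu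
      have i2 := integrable_pairing hpq (hAmem _ (hz n)) hw
      have e2 : ∫ r in Set.Ioo (t₁ : ℝ) T, A r (z n r) (z n r)
          = (∫ r in Set.Ioo (t₁ : ℝ) T, A r (z n r) (toV ι (pathAt x r)))
            - θ n * ∫ r in Set.Ioo (t₁ : ℝ) T, A r (z n r) (w r) := by
        rw [← integral_const_mul, ← integral_sub i1 (i2.const_mul _)]
        refine integral_congr_ae (Eventually.of_forall fun r => ?_)
        show A r (z n r) (toV ι (pathAt x r) + θ n • -w r) = _
        rw [map_add, map_smul, map_neg, smul_eq_mul]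
        ring
      rw [e1, e2] at h
      have h3 : 0 ≤ θ n * (Λ (hw.toLp w) - ∫ r in Set.Ioo (t₁ : ℝ) T, A r (z n r) (w r)) := by
        linarith
      have := nonneg_of_mul_nonneg_right h3 (hθ0 n)
      linarith
    have hz1 : MemLp (fun r => toV ι (pathAt x r) + (1 : ℝ) • -w r) (ENNReal.ofReal p)
        (volume.restrict (Set.Ioo (t₁ : ℝ) T)) := memLp_fun_add hu (hw.neg.const_smul (1 : ℝ))
    have hAu := integrable_pairing hpq (hAmem _ hu) hw
    have hAz1 := integrable_pairing hpq (hAmem _ hz1) hw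
    -- By monotonicity ⟨A(u - θw), w⟩ decreases in θ, so on [0,1] it lies between its values at 1
    -- and 0, which are integrable; hemicontinuity gives the pointwise limit.
    refine le_of_tendsto (tendsto_integral_of_dominated_convergence
      (fun r => |A r (toV ι (pathAt x r)) (w r)|
        + |A r (toV ι (pathAt x r) + (1 : ℝ) • -w r) (w r)|)
      (fun n => (integrable_pairing hpq (hAmem _ (hz n)) hw).1) (hAu.abs.add hAz1.abs)
      (fun n => ?_) ?_) (Eventually.of_forall h1)
    · filter_upwards [hmono] with r hr
      have m1 := hr (toV ι (pathAt x r)) (z n r)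
      have m2 := hr (z n r) (toV ι (pathAt x r) + (1 : ℝ) • -w r)
      have d1 : toV ι (pathAt x r) - z n r = θ n • w r := by simp [z]
      have d2 : z n r - (toV ι (pathAt x r) + (1 : ℝ) • -w r) = (1 - θ n) • w r := by
        simp only [z, sub_smul, smul_neg, one_smul]; abel
      rw [d1, map_smul, smul_eq_mul, _root_.sub_apply] at m1
      rw [d2, map_smul, smul_eq_mul, _root_.sub_apply] at m2
      have m1' := nonneg_of_mul_nonneg_right m1 (hθ0 n)
      rw [Real.norm_eq_abs, abs_le]
      have a1 := le_abs_self (A r (toV ι (pathAt x r)) (w r))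
      have a2 := neg_abs_le (A r (toV ι (pathAt x r) + (1 : ℝ) • -w r) (w r))
      have a3 := abs_nonneg (A r (toV ι (pathAt x r)) (w r))
      have a4 := abs_nonneg (A r (toV ι (pathAt x r) + (1 : ℝ) • -w r) (w r))
      refine ⟨?_, by linarith⟩
      rcases (hθ1 n).lt_or_eq with hlt | heq
      · have := nonneg_of_mul_nonneg_right m2 (by linarith : 0 < 1 - θ n)
        linarith
      · simp only [z, heq]
        linarith
    · filter_upwards [hhemi] with r hr
      have hc := hr (toV ι (pathAt x r)) (-w r) (w r) 0 ⟨le_rfl, zero_le_one⟩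
      have := hc.tendsto.comp (tendsto_nhdsWithin_iff.2
        ⟨hθ, Eventually.of_forall fun n => (⟨(hθ0 n).le, hθ1 n⟩ : θ n ∈ Set.Icc (0 : ℝ) 1)⟩)
      simp only [zero_smul, add_zero] at this
      exact this
  refine le_antisymm ?_ (hone w hw)
  have h2 := hone (-w) hw.neg
  rw [MemLp.toLp_neg hw, map_neg] at h2
  simp only [Pi.neg_apply, map_neg, integral_neg] at h2
  linarith

end LimitEquation

/-! ### Compactness of the trajectory sets -/

section WeakHilbert

variable {H : Type*} [NormedAddCommGroup H] [InnerProductSpace ℝ H]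
  [CompleteSpace H] [TopologicalSpace.SeparableSpace H]

/-- In L²(H) the limit functional is represented by a function, by Riesz's theorem; the limiting
source of a trajectory arises in this way. -/
lemma exists_weak_subseq_inner {μ : Measure ℝ} [IsFiniteMeasure μ] {fs : ℕ → ℝ → H}
    (hm : ∀ n, MemLp (fs n) 2 μ) {B : ℝ} (hB : ∀ n, ∀ᵐ r ∂μ, ‖fs n r‖ ≤ B) :
    ∃ (φ : ℕ → ℕ) (f : ℝ → H), StrictMono φ ∧ MemLp f 2 μ ∧ ∀ g : ℝ → H, MemLp g 2 μ →
      Tendsto (fun n => ∫ r, inner ℝ (fs (φ n) r) (g r) ∂μ) atTop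
        (𝓝 (∫ r, inner ℝ (f r) (g r) ∂μ)) := by
  have : Fact ((2 : ENNReal) ≠ ⊤) := ⟨by norm_num⟩
  obtain ⟨φ, Λ, hφ, hΛ⟩ := exists_weak_subseq (p := 2) (q := 2)
    (w := fun n r => innerSL ℝ (fs n r)) (μ := μ)
    (fun n => (innerSL ℝ : H →L[ℝ] _).comp_memLp' (hm n))
    (C := μ Set.univ ^ (2 : ENNReal).toReal⁻¹ * ENNReal.ofReal B)
    (ENNReal.mul_ne_top (ENNReal.rpow_ne_top_of_nonneg (by simp) (measure_ne_top _ _))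
      ENNReal.ofReal_ne_top)
    (fun n => eLpNorm_le_of_ae_bound (by
      filter_upwards [hB n] with r hr
      rwa [innerSL_apply_norm]))
  set F := (InnerProductSpace.toDual ℝ (Lp H 2 μ)).symm Λ
  refine ⟨φ, F, hφ, Lp.memLp F, fun g hg => ?_⟩
  have h1 : Λ (hg.toLp g) = ∫ r, inner ℝ (F r) (g r) ∂μ := by
    rw [← InnerProductSpace.toDual_symm_apply, L2.inner_def]
    refine integral_congr_ae (hg.coeFn_toLp.mono fun r hr => ?_)
    simp only [hr]; rfl
  rw [← h1]
  exact hΛ g hg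

/-- Testing with indicators times a fixed vector e shows (f, e) ≤ b₀‖e‖ almost everywhere. A
countable dense set of e makes the null set independent of e, and then e = f(r) is allowed. -/
lemma ae_norm_le_of_weak {μ : Measure ℝ} [IsFiniteMeasure μ] {fs : ℕ → ℝ → H} {f : ℝ → H}
    (hm : ∀ n, MemLp (fs n) 2 μ) (hf : MemLp f 2 μ)
    (hw : ∀ g : ℝ → H, MemLp g 2 μ → Tendsto (fun n => ∫ r, inner ℝ (fs n r) (g r) ∂μ) atTop
        (𝓝 (∫ r, inner ℝ (f r) (g r) ∂μ)))
    {b : ℕ → ℝ → ℝ} {b₀ : ℝ → ℝ} {D : ℝ} (hb : ∀ n, Continuous (b n)) (hb₀ : Continuous b₀)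
    (hb0 : ∀ r, 0 ≤ b₀ r) (hbD : ∀ n r, |b n r| ≤ D)
    (hlim : ∀ r, Tendsto (fun n => b n r) atTop (𝓝 (b₀ r)))
    (hfb : ∀ n, ∀ᵐ r ∂μ, ‖fs n r‖ ≤ b n r) : ∀ᵐ r ∂μ, ‖f r‖ ≤ b₀ r := by
  have hbi : ∀ n, Integrable (b n) μ := fun n =>
    Integrable.of_bound (hb n).aestronglyMeasurable D (Eventually.of_forall (hbD n))
  have hbD₀ : ∀ r, |b₀ r| ≤ D := fun r => le_of_tendsto (hlim r).abs
    (Eventually.of_forall fun n => hbD n r)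
  have hb₀i : Integrable b₀ μ :=
    Integrable.of_bound hb₀.aestronglyMeasurable D (Eventually.of_forall hbD₀)
  have key : ∀ e : H, ∀ᵐ r ∂μ, inner ℝ (f r) e ≤ b₀ r * ‖e‖ := fun e => by
    refine ae_le_of_forall_setIntegral_le ((hf.integrable (by norm_num)).inner_const e)
      (hb₀i.mul_const _) fun S hS _ => ?_
    have hgm : MemLp (S.indicator fun _ => e) 2 μ := (memLp_const e).indicator hS
    have hind : ∀ k : ℝ → H, ∫ r, inner ℝ (k r) (S.indicator (fun _ => e) r) ∂μ
        = ∫ r in S, inner ℝ (k r) e ∂μ := fun k => by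
      rw [← integral_indicator hS]
      congr 1
      funext r
      by_cases hr : r ∈ S <;> simp [hr]
    have h1 := hw _ hgm
    simp only [hind] at h1
    refine le_of_tendsto_of_tendsto h1 (tendsto_integral_of_dominated_convergence
      (fun _ => D * ‖e‖) (F := fun n r => b n r * ‖e‖)
      (fun n => ((hb n).mul_const _).aestronglyMeasurable)
      (integrable_const _) (fun n => Eventually.of_forall fun r => ?_)
      (Eventually.of_forall fun r => (hlim r).mul_const _)) (Eventually.of_forall fun n => ?_)
    · rw [norm_mul, norm_norm]
      exact mul_le_mul_of_nonneg_right (hbD n r) (norm_nonneg _)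
    · refine integral_mono_ae (((hm n).integrable (by norm_num)).inner_const e).integrableOn
        ((hbi n).mul_const _).integrableOn (ae_restrict_of_ae ?_)
      filter_upwards [hfb n] with r hr
      exact (real_inner_le_norm _ _).trans (mul_le_mul_of_nonneg_right hr (norm_nonneg _))
  filter_upwards [ae_all_iff.2 fun n => key (TopologicalSpace.denseSeq H n)] with r hr
  have hall : ∀ e : H, inner ℝ (f r) e ≤ b₀ r * ‖e‖ := fun e =>
    (TopologicalSpace.denseRange_denseSeq H).induction_on (p := fun e => inner ℝ (f r) e ≤ b₀ r * ‖e‖)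
      e (isClosed_le (by fun_prop) (by fun_prop)) hr
  have h1 := hall (f r)
  rw [real_inner_self_eq_norm_sq, sq] at h1
  rcases (norm_nonneg (f r)).eq_or_lt with h | h
  · rw [← h]; exact hb0 r
  · exact le_of_mul_le_mul_right h1 h

end WeakHilbert

section Compact

variable {T : ℝ} [Fact (0 < T)] {V H : Type*} [NormedAddCommGroup V] [NormedSpace ℝ V]
  [NormedAddCommGroup H] [InnerProductSpace ℝ H] {ι : V →L[ℝ] H} {p q : ℝ}
  {A : ℝ → V → StrongDual ℝ V}
  [TopologicalSpace.SeparableSpace V] [TopologicalSpace.SeparableSpace H]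
  [CompleteSpace V] [CompleteSpace H] [TopologicalSpace.SeparableSpace (StrongDual ℝ V)]

lemma tendsto_setIntegral_inner {a b c d : ℝ} (hac : a ≤ c) (hdb : d ≤ b) {fs : ℕ → ℝ → H}
    {f : ℝ → H}
    (hw : ∀ g : ℝ → H, MemLp g 2 (volume.restrict (Set.Ioo a b)) →
      Tendsto (fun n => ∫ r in Set.Ioo a b, inner ℝ (fs n r) (g r)) atTop
        (𝓝 (∫ r in Set.Ioo a b, inner ℝ (f r) (g r)))) {g : ℝ → H} (hg : Continuous g) :
    Tendsto (fun n => ∫ r in Set.Ioo c d, inner ℝ (fs n r) (g r)) atTop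
        (𝓝 (∫ r in Set.Ioo c d, inner ℝ (f r) (g r))) := by
  have hgm : MemLp ((Set.Ioo c d).indicator g) 2 (volume.restrict (Set.Ioo a b)) := by
    refine MemLp.indicator measurableSet_Ioo ?_
    obtain ⟨C, hC⟩ := isCompact_Icc.exists_bound_of_continuousOn (s := Set.Icc a b) hg.continuousOn
    refine MemLp.of_bound hg.aestronglyMeasurable C ?_
    filter_upwards [ae_restrict_mem measurableSet_Ioo] with r hr using hC r ⟨hr.1.le, hr.2.le⟩
  have hind : ∀ k : ℝ → H, ∫ r in Set.Ioo a b, inner ℝ (k r) ((Set.Ioo c d).indicator g r)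
      = ∫ r in Set.Ioo c d, inner ℝ (k r) (g r) := fun k => by
    have : (fun r => inner ℝ (k r) ((Set.Ioo c d).indicator g r))
        = (Set.Ioo c d).indicator fun r => inner ℝ (k r) (g r) := by
      funext r
      by_cases hr : r ∈ Set.Ioo c d
      · rw [Set.indicator_of_mem hr, Set.indicator_of_mem hr]
      · rw [Set.indicator_of_notMem hr, Set.indicator_of_notMem hr, inner_zero_right]
    rw [this, setIntegral_indicator measurableSet_Ioo,
      Set.inter_eq_self_of_subset_right (Set.Ioo_subset_Ioo hac hdb)]
  have := hw _ hgm
  simpa only [hind] using this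

lemma integral_Ioo_indicator_const {a b c d : ℝ} (hac : a ≤ c) (hdb : d ≤ b)
    (w : ℝ → StrongDual ℝ V) (v : V) :
    ∫ r in Set.Ioo a b, w r ((Set.Ioo c d).indicator (fun _ => v) r)
      = ∫ r in Set.Ioo c d, w r v := by
  have : (fun r => w r ((Set.Ioo c d).indicator (fun _ => v) r))
      = (Set.Ioo c d).indicator fun r => w r v := by
    funext r
    by_cases hr : r ∈ Set.Ioo c d
    · rw [Set.indicator_of_mem hr, Set.indicator_of_mem hr]
    · rw [Set.indicator_of_notMem hr, Set.indicator_of_notMem hr, map_zero]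
  rw [this, setIntegral_indicator measurableSet_Ioo,
    Set.inter_eq_self_of_subset_right (Set.Ioo_subset_Ioo hac hdb)]

lemma exists_weak_subseq_superposition (hA : HypA T p q A) (hp : 2 ≤ p)
    (hpq : p.HolderConjugate q) [Fact (1 ≤ ENNReal.ofReal p)] {a : ℝ} (ha : 0 ≤ a)
    {U : ℕ → ℝ → V} (hU : ∀ n, MemLp (U n) (ENNReal.ofReal p) (volume.restrict (Set.Ioo a T)))
    {M : ENNReal} (hM : M ≠ ⊤)
    (hUM : ∀ n, eLpNorm (U n) (ENNReal.ofReal p) (volume.restrict (Set.Ioo a T)) ≤ M) :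
    ∃ (φ : ℕ → ℕ) (Λ : StrongDual ℝ (Lp V (ENNReal.ofReal p) (volume.restrict (Set.Ioo a T)))),
      StrictMono φ ∧ ∀ (v : ℝ → V)
        (hv : MemLp v (ENNReal.ofReal p) (volume.restrict (Set.Ioo a T))),
      Tendsto (fun n => ∫ r in Set.Ioo a T, A r (U (φ n) r) (v r)) atTop
        (𝓝 (Λ (hv.toLp v))) := by
  have hH : ENNReal.HolderConjugate (ENNReal.ofReal q) (ENNReal.ofReal p) :=
    hpq.symm.ennrealOfReal
  have : Fact (1 ≤ ENNReal.ofReal q) := ⟨one_le_ofReal_conj hpq⟩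
  have : Fact (ENNReal.ofReal p ≠ ⊤) := ⟨ENNReal.ofReal_ne_top⟩
  obtain ⟨C, hC, hCb⟩ := eLpNorm_superposition_le hA hp hpq ha hM
  exact exists_weak_subseq (fun n => hA.memLp hp hpq ha (hU n)) hC
    fun n => hCb _ (hU n).1 (hUM n)

/-- The Minty argument needs room to the left of its starting time, so the equation is first
obtained on [s, t] for t₀ < s; then s decreases to t₀, both sides being continuous in s. -/
theorem IsSol.of_tendsto (hι : IsGelfandTriple ι) (hA : HypA T p q A) (hp : 2 ≤ p)
    (hpq : p.HolderConjugate q) {t₀ : Set.Icc (0 : ℝ) T} {xs : ℕ → PathSp T H} {x : PathSp T H}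
    {fs : ℕ → ℝ → H} {f : ℝ → H} (hs : ∀ n, IsSol ι p A t₀ (xs n) (fs n))
    (hlim : Tendsto xs atTop (𝓝 x)) {M : ENNReal} (hM : M ≠ ⊤)
    (hUM : ∀ n, eLpNorm (fun r => toV ι (pathAt (xs n) r)) (ENNReal.ofReal p)
      (volume.restrict (Set.Ioo (t₀ : ℝ) T)) ≤ M)
    {B : ℝ} (hB : ∀ n, ∀ᵐ r ∂volume.restrict (Set.Ioo (t₀ : ℝ) T), ‖fs n r‖ ≤ B)
    (hf : MemLp f 2 (volume.restrict (Set.Ioo (t₀ : ℝ) T)))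
    (hfw : ∀ g : ℝ → H, MemLp g 2 (volume.restrict (Set.Ioo (t₀ : ℝ) T)) →
      Tendsto (fun n => ∫ r in Set.Ioo (t₀ : ℝ) T, inner ℝ (fs n r) (g r)) atTop
        (𝓝 (∫ r in Set.Ioo (t₀ : ℝ) T, inner ℝ (f r) (g r)))) : IsSol ι p A t₀ x f := by
  have hx : ∀ r, Tendsto (fun m => pathAt (xs m) r) atTop (𝓝 (pathAt x r)) := fun r =>
    ((continuous_eval_const (clampTime r)).tendsto x).comp hlim
  obtain ⟨hmem, hu⟩ := memLp_toV_of_tendsto hι (by linarith) (continuous_pathAt x) hx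
    (fun n => (hs n).mem_range) (fun n => (hs n).memLp.1) hM hUM
  refine ⟨hmem, hu, hf, fun t ht v => ?_⟩
  have : Fact (1 ≤ ENNReal.ofReal p) := ⟨one_le_ofReal_conj hpq.symm⟩
  have hAi := (hA.memLp hp hpq t₀.2.1 hu).integrable (one_le_ofReal_conj hpq)
  set k : ℝ → ℝ := fun r => inner ℝ (f r) (ι v) - A r (toV ι (pathAt x r)) v
  have hk : Integrable k (volume.restrict (Set.Ioo (t₀ : ℝ) T)) :=
    (integrable_inner_const hf (ι v)).sub (hAi.apply_continuousLinearMap v)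
  have hclaim : ∀ s, (t₀ : ℝ) < s → s ≤ t →
      inner ℝ (pathAt x t - pathAt x s) (ι v) = ∫ r in s..t, k r := by
    intro s h0s hst
    have hsT : s ∈ Set.Icc 0 T := ⟨t₀.2.1.trans h0s.le, hst.trans ht.2⟩
    set t₁ : Set.Icc (0 : ℝ) T := ⟨s, hsT⟩
    have h01 : t₀ < t₁ := h0s
    have hle : volume.restrict (Set.Ioo (t₁ : ℝ) T) ≤ volume.restrict (Set.Ioo (t₀ : ℝ) T) :=
      Measure.restrict_mono (Set.Ioo_subset_Ioo_left h0s.le) le_rfl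
    have hs₁ : ∀ n, IsSol ι p A t₁ (xs n) (fs n) := fun n => (hs n).restrict hA hp hpq h01.le
    have hUM₁ : ∀ n, eLpNorm (fun r => toV ι (pathAt (xs n) r)) (ENNReal.ofReal p)
        (volume.restrict (Set.Ioo (t₁ : ℝ) T)) ≤ M := fun n =>
      (eLpNorm_mono_measure _ hle).trans (hUM n)
    obtain ⟨φ, Λ, hφ, hΛ⟩ := exists_weak_subseq_superposition hA hp hpq t₁.2.1
      (fun n => (hs₁ n).memLp) hM hUM₁
    have hw : MemLp ((Set.Ioo s t).indicator fun _ => v) (ENNReal.ofReal p)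
        (volume.restrict (Set.Ioo (t₁ : ℝ) T)) := (memLp_const v).indicator measurableSet_Ioo
    have h1 := weak_limit_eq_integral hι hA hp hpq h01 (fun n => hs₁ (φ n))
      (hlim.comp hφ.tendsto_atTop) hM (fun n => hUM₁ (φ n)) hmem hu
      (fun n => ae_mono hle (hB (φ n))) (hf.mono_measure hle)
      (fun g hg => (tendsto_setIntegral_inner (c := (t₁ : ℝ)) (d := T) h0s.le le_rfl hfw hg).comp
        hφ.tendsto_atTop) Λ hΛ hw
    have h2 := hΛ _ hw
    rw [h1] at h2
    have hI := fun y : PathSp T H => integral_Ioo_indicator_const (a := (t₁ : ℝ)) (b := T) (c := s)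
      (d := t) le_rfl ht.2 (fun r => A r (toV ι (pathAt y r))) v
    simp only [hI] at h2
    have h3 := (tendsto_setIntegral_inner (c := s) (d := t) h0s.le ht.2 hfw
      (continuous_const (y := ι v))).comp hφ.tendsto_atTop
    have hsm : s ∈ Set.Icc (t₁ : ℝ) T := ⟨le_rfl, hsT.2⟩
    have htm : t ∈ Set.Icc (t₁ : ℝ) T := ⟨hst, ht.2⟩
    have hsplit : ∀ {y : PathSp T H} {g : ℝ → H},
        MemLp g 2 (volume.restrict (Set.Ioo (t₁ : ℝ) T)) →
        MemLp (fun r => toV ι (pathAt y r)) (ENNReal.ofReal p)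
          (volume.restrict (Set.Ioo (t₁ : ℝ) T)) →
        ∫ r in s..t, (inner ℝ (g r) (ι v) - A r (toV ι (pathAt y r)) v)
          = (∫ r in Set.Ioo s t, inner ℝ (g r) (ι v))
            - ∫ r in Set.Ioo s t, A r (toV ι (pathAt y r)) v := fun hg hy => by
      rw [intervalIntegral.integral_sub
        (intervalIntegrable_of_Ioo (integrable_inner_const hg _) hsm htm)
        (intervalIntegrable_of_Ioo (((hA.memLp hp hpq t₁.2.1 hy).integrable
          (one_le_ofReal_conj hpq)).apply_continuousLinearMap v) hsm htm),
        intervalIntegral_eq_integral_Ioo hst, intervalIntegral_eq_integral_Ioo hst]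
    rw [hsplit (hf.mono_measure hle) (hu.mono_measure hle)]
    refine tendsto_nhds_unique ((((hx t).sub (hx s)).inner tendsto_const_nhds).comp
      hφ.tendsto_atTop) ((h3.sub h2).congr fun n => ?_)
    have := (hs₁ (φ n)).eqn t htm v
    rw [hsplit (hs₁ (φ n)).memLp_source (hs₁ (φ n)).memLp] at this
    exact this.symm
  rcases ht.1.eq_or_lt with h | h
  · rw [← h]; simp
  set K := (Set.Ioo (t₀ : ℝ) T).indicator k
  have hK : Integrable K := (integrable_indicator_iff measurableSet_Ioo).2 hk
  have hKk : ∀ s ∈ Set.Icc (t₀ : ℝ) t, ∫ r in s..t, K r = ∫ r in s..t, k r := fun s hs =>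
    integral_congr_Ioo (a := t₀) (b := T) ⟨hs.1, hs.2.trans ht.2⟩ ht hs.2 (by
      filter_upwards [ae_restrict_mem measurableSet_Ioo] with r hr
      exact Set.indicator_of_mem hr _)
  have hcK : Continuous fun s => ∫ r in s..t, K r := by
    have := intervalIntegral.continuous_primitive (fun a b => hK.intervalIntegrable (a := a) (b := b)) t
    refine this.neg.congr fun s => ?_
    exact (intervalIntegral.integral_symm _ _).symm
  have hcx : Continuous fun s => inner ℝ (pathAt x t - pathAt x s) (ι v) :=
    (continuous_const.sub (continuous_pathAt x)).inner continuous_const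
  rw [← hKk t₀ ⟨le_rfl, ht.1⟩]
  refine tendsto_nhds_unique (f := fun s => inner ℝ (pathAt x t - pathAt x s) (ι v))
    (l := 𝓝[>] (t₀ : ℝ)) (hcx.continuousWithinAt) ((hcK.continuousWithinAt (s := Set.Ioi (t₀ : ℝ)).tendsto).congr' ?_)
  filter_upwards [Ioo_mem_nhdsGT h] with s hs
  rw [hclaim s hs.1 hs.2.le, hKk s ⟨hs.1.le, hs.2.le⟩]

end Compact

/-! ### From weak to uniform convergence of trajectories -/

section Compact

variable {T : ℝ} [Fact (0 < T)] {V H : Type*} [NormedAddCommGroup V] [NormedSpace ℝ V]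
  [NormedAddCommGroup H] [InnerProductSpace ℝ H] {ι : V →L[ℝ] H} {p q : ℝ}
  {A : ℝ → V → StrongDual ℝ V}
  [TopologicalSpace.SeparableSpace V] [TopologicalSpace.SeparableSpace H]
  [CompleteSpace V] [CompleteSpace H] [TopologicalSpace.SeparableSpace (StrongDual ℝ V)]

lemma integral_norm_le_of_eLpNorm_le {μ : Measure ℝ} [IsFiniteMeasure μ] {u : ℝ → V}
    (hp : 1 ≤ ENNReal.ofReal p) {M : ENNReal} (hM : M ≠ ⊤)
    (hu : AEStronglyMeasurable u μ) (huM : eLpNorm u (ENNReal.ofReal p) μ ≤ M) :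
    ∫ r, ‖u r‖ ∂μ ≤ (M * μ Set.univ ^ (1 - 1 / (ENNReal.ofReal p).toReal)).toReal := by
  rw [integral_norm_eq_lintegral_enorm hu, ← eLpNorm_one_eq_lintegral_enorm]
  have h1 : 0 ≤ 1 - 1 / (ENNReal.ofReal p).toReal := by
    have : 1 ≤ (ENNReal.ofReal p).toReal := by
      simpa using ENNReal.toReal_mono ENNReal.ofReal_ne_top hp
    rw [sub_nonneg, div_le_one (by linarith)]; exact this
  refine ENNReal.toReal_mono (ENNReal.mul_ne_top hM
    (ENNReal.rpow_ne_top_of_nonneg h1 (measure_ne_top _ _))) ?_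
  refine (eLpNorm_le_eLpNorm_mul_rpow_measure_univ hp hu).trans ?_
  rw [ENNReal.toReal_one, one_div_one]
  gcongr

/-- Bounded sequences in `L^p(V)` that converge weakly in `H` pointwise are Cauchy in `L¹(H)`,
by compactness of the embedding. -/
lemma exists_integral_norm_sub_le (hι : IsGelfandTriple ι) (hp : 1 ≤ ENNReal.ofReal p)
    {μ : Measure ℝ} [IsFiniteMeasure μ] {xs : ℕ → PathSp T H}
    {C : ℝ} (hC : ∀ n, ‖xs n‖ ≤ C)
    (hmem : ∀ n, ∀ᵐ r ∂μ, pathAt (xs n) r ∈ Set.range ι)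
    (hU : ∀ n, MemLp (fun r => toV ι (pathAt (xs n) r)) (ENNReal.ofReal p) μ)
    {M : ENNReal} (hM : M ≠ ⊤)
    (hUM : ∀ n, eLpNorm (fun r => toV ι (pathAt (xs n) r)) (ENNReal.ofReal p) μ ≤ M)
    (hlim : ∀ e : H, ∃ β : ℝ → ℝ, ∀ᵐ r ∂μ,
      Tendsto (fun n => inner ℝ e (pathAt (xs n) r)) atTop (𝓝 (β r)))
    {ε : ℝ} (hε : 0 < ε) :
    ∃ N, ∀ n ≥ N, ∀ m ≥ N, ∫ r, ‖pathAt (xs n) r - pathAt (xs m) r‖ ∂μ ≤ ε := by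
  set K := (M * μ Set.univ ^ (1 - 1 / (ENNReal.ofReal p).toReal)).toReal
  have hK0 : 0 ≤ K := ENNReal.toReal_nonneg
  -- The constant makes the part controlled by the L¹(V) norms, each at most `K`, contribute at most
  -- ε/2. The finitely many remaining coordinates converge in L¹ by dominated convergence.
  obtain ⟨k, e, he⟩ := exists_finite_rank_bound hι.compact
    (show 0 < ε / (2 * (2 * K + 1)) by positivity)
  choose β hβ using fun i => hlim (e i)
  have hm : ∀ i n, AEStronglyMeasurable (fun r => inner ℝ (e i) (pathAt (xs n) r)) μ := fun i n =>
    (continuous_const.inner (continuous_pathAt (xs n))).aestronglyMeasurable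
  have hβm : ∀ i, AEStronglyMeasurable (β i) μ := fun i =>
    aestronglyMeasurable_of_tendsto_ae atTop (hm i) (hβ i)
  have hbd : ∀ i n r, |inner ℝ (e i) (pathAt (xs n) r)| ≤ ‖e i‖ * C := fun i n r =>
    (abs_real_inner_le_norm _ _).trans (mul_le_mul_of_nonneg_left
      (((xs n).norm_coe_le_norm _).trans (hC n)) (norm_nonneg _))
  have hβbd : ∀ i, ∀ᵐ r ∂μ, |β i r| ≤ ‖e i‖ * C := fun i => (hβ i).mono fun r hr =>
    le_of_tendsto hr.abs (Eventually.of_forall fun n => hbd i n r)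
  have hii : ∀ i n, Integrable (fun r => inner ℝ (e i) (pathAt (xs n) r)) μ := fun i n =>
    Integrable.of_bound (hm i n) _ (Eventually.of_forall (hbd i n))
  have hβi : ∀ i, Integrable (β i) μ := fun i => Integrable.of_bound (hβm i) _ (hβbd i)
  have hdi : ∀ i n, Integrable (fun r => |inner ℝ (e i) (pathAt (xs n) r) - β i r|) μ := fun i n =>
    ((hii i n).sub (hβi i)).abs
  have hD : ∀ i, Tendsto (fun n => ∫ r, |inner ℝ (e i) (pathAt (xs n) r) - β i r| ∂μ) atTop
      (𝓝 0) := fun i => by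
    have := tendsto_integral_of_dominated_convergence (μ := μ)
      (F := fun n r => |inner ℝ (e i) (pathAt (xs n) r) - β i r|) (f := fun _ => 0)
      (fun _ => ‖e i‖ * C + ‖e i‖ * C) (fun n => (hdi i n).1) (integrable_const _)
      (fun n => by
        filter_upwards [hβbd i] with r hr
        rw [Real.norm_eq_abs, abs_abs]
        exact (abs_sub _ _).trans (add_le_add (hbd i n r) hr))
      ((hβ i).mono fun r hr => by simpa using (hr.sub_const (β i r)).abs)
    simpa using this
  have hDs : Tendsto (fun n => ∑ i, ∫ r, |inner ℝ (e i) (pathAt (xs n) r) - β i r| ∂μ) atTop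
      (𝓝 0) := by
    simpa using tendsto_finsetSum Finset.univ fun i _ => hD i
  obtain ⟨N, hN⟩ := (hDs.eventually (gt_mem_nhds (show (0 : ℝ) < ε / 4 by linarith))).exists_forall_of_atTop
  refine ⟨N, fun n hn m hm' => ?_⟩
  have hUi : ∀ n, Integrable (fun r => toV ι (pathAt (xs n) r)) μ := fun n => (hU n).integrable hp
  have hUK : ∀ n, ∫ r, ‖toV ι (pathAt (xs n) r)‖ ∂μ ≤ K := fun n =>
    integral_norm_le_of_eLpNorm_le hp hM (hU n).1 (hUM n)
  set δ := ε / (2 * (2 * K + 1))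
  have hδ : 0 < δ := by positivity
  have i1 : Integrable (fun r => δ * (‖toV ι (pathAt (xs n) r)‖ + ‖toV ι (pathAt (xs m) r)‖)) μ :=
    ((hUi n).norm.add (hUi m).norm).const_mul _
  have i2 : Integrable (fun r => ∑ i, (|inner ℝ (e i) (pathAt (xs n) r) - β i r|
      + |inner ℝ (e i) (pathAt (xs m) r) - β i r|)) μ :=
    integrable_finsetSum _ fun i _ => (hdi i n).add (hdi i m)
  have h1 : ∫ r, ‖pathAt (xs n) r - pathAt (xs m) r‖ ∂μ
      ≤ ∫ r, (δ * (‖toV ι (pathAt (xs n) r)‖ + ‖toV ι (pathAt (xs m) r)‖)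
        + ∑ i, (|inner ℝ (e i) (pathAt (xs n) r) - β i r|
          + |inner ℝ (e i) (pathAt (xs m) r) - β i r|)) ∂μ := by
    refine integral_mono_of_nonneg (Eventually.of_forall fun r => norm_nonneg _) (i1.add i2) ?_
    filter_upwards [hmem n, hmem m] with r h1 h2
    have := he (toV ι (pathAt (xs n) r) - toV ι (pathAt (xs m) r))
    rw [map_sub, map_toV h1, map_toV h2] at this
    refine this.trans (add_le_add ?_ (Finset.sum_le_sum fun i _ => ?_))
    · exact mul_le_mul_of_nonneg_left (norm_sub_le _ _) hδ.le
    · rw [inner_sub_right, abs_sub_comm (inner ℝ (e i) (pathAt (xs m) r))]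
      exact abs_sub_le _ _ _
  rw [integral_add i1 i2, integral_const_mul, integral_add (hUi n).norm (hUi m).norm] at h1
  have h2 : ∫ r, ∑ i, (|inner ℝ (e i) (pathAt (xs n) r) - β i r|
          + |inner ℝ (e i) (pathAt (xs m) r) - β i r|) ∂μ
      = (∑ i, ∫ r, |inner ℝ (e i) (pathAt (xs n) r) - β i r| ∂μ)
        + ∑ i, ∫ r, |inner ℝ (e i) (pathAt (xs m) r) - β i r| ∂μ := by
    rw [← Finset.sum_add_distrib]
    refine (integral_finsetSum _ fun i _ => (hdi i n).add (hdi i m)).trans ?_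
    exact Finset.sum_congr rfl fun i _ => integral_add (hdi i n) (hdi i m)
  rw [h2] at h1
  have h3 : δ * (∫ r, ‖toV ι (pathAt (xs n) r)‖ ∂μ + ∫ r, ‖toV ι (pathAt (xs m) r)‖ ∂μ)
      ≤ ε / 2 := by
    refine (mul_le_mul_of_nonneg_left (add_le_add (hUK n) (hUK m)) hδ.le).trans ?_
    rw [div_mul_eq_mul_div, div_le_div_iff₀ (by positivity) (by norm_num)]
    nlinarith
  linarith [hN n hn, hN m hm']

/-- The difference energy bounds |x_n(t) - x_m(t)|² by 4B times the L¹(H) distance, uniformly in t,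
so Cauchy in L¹(H) becomes Cauchy in the supremum norm. -/
lemma cauchySeq_of_weak (hι : IsGelfandTriple ι) (hA : HypA T p q A) (hp : 2 ≤ p)
    (hpq : p.HolderConjugate q) {t₀ : Set.Icc (0 : ℝ) T} {xs : ℕ → PathSp T H} {x₀ : PathSp T H}
    (hx₀ : ∀ n, ∀ t ≤ t₀, xs n t = x₀ t)
    {fs : ℕ → ℝ → H} (hs : ∀ n, IsSol ι p A t₀ (xs n) (fs n)) {C : ℝ} (hC : ∀ n, ‖xs n‖ ≤ C)
    {M : ENNReal} (hM : M ≠ ⊤)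
    (hUM : ∀ n, eLpNorm (fun r => toV ι (pathAt (xs n) r)) (ENNReal.ofReal p)
      (volume.restrict (Set.Ioo (t₀ : ℝ) T)) ≤ M)
    {B : ℝ} (hB0 : 0 ≤ B) (hB : ∀ n, ∀ᵐ r ∂volume.restrict (Set.Ioo (t₀ : ℝ) T), ‖fs n r‖ ≤ B)
    (hlim : ∀ e : H, ∃ β : ℝ → ℝ, ∀ᵐ r ∂volume.restrict (Set.Ioo (t₀ : ℝ) T),
      Tendsto (fun n => inner ℝ e (pathAt (xs n) r)) atTop (𝓝 (β r))) : CauchySeq xs := by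
  refine Metric.cauchySeq_iff.2 fun δ hδ => ?_
  have hε : 0 < δ ^ 2 / 4 / (4 * B + 1) := by positivity
  obtain ⟨N, hN⟩ := exists_integral_norm_sub_le hι (one_le_ofReal_conj hpq.symm) hC
    (fun n => (hs n).mem_range) (fun n => (hs n).memLp) hM hUM hlim hε
  refine ⟨N, fun n hn m hm => ?_⟩
  have hI := hN n hn m hm
  have hbound : ∀ t : Set.Icc (0 : ℝ) T, ‖xs n t - xs m t‖ ≤ δ / 2 := by
    intro t
    rcases le_total t t₀ with ht | ht
    · rw [hx₀ n t ht, hx₀ m t ht, sub_self, norm_zero]; linarith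
    have ht' : (t : ℝ) ∈ Set.Icc (t₀ : ℝ) T := ⟨ht, t.2.2⟩
    have he := (hs n).diff_energy hA hp hpq (hs m) (by
      rw [pathAt_coe, pathAt_coe, hx₀ n _ le_rfl, hx₀ m _ le_rfl]) ht'
    rw [pathAt_coe, pathAt_coe, intervalIntegral_eq_integral_Ioo ht,
      intervalIntegral_eq_integral_Ioo ht] at he
    have hsub : Set.Ioo (t₀ : ℝ) t ⊆ Set.Ioo (t₀ : ℝ) T := Set.Ioo_subset_Ioo_right t.2.2
    have h1 : 0 ≤ ∫ r in Set.Ioo (t₀ : ℝ) t, (A r (toV ι (pathAt (xs n) r))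
        - A r (toV ι (pathAt (xs m) r))) (toV ι (pathAt (xs n) r) - toV ι (pathAt (xs m) r)) := by
      refine integral_nonneg_of_ae ?_
      filter_upwards [ae_restrict_of_ae_restrict_of_subset hsub
        (ae_mono (restrict_Ioo_le_Icc t₀.2.1) hA.monotone)] with r hr using hr _ _
    have hci : Integrable (fun r => ‖pathAt (xs n) r - pathAt (xs m) r‖)
        (volume.restrict (Set.Ioo (t₀ : ℝ) T)) :=
      (((continuous_pathAt _).sub (continuous_pathAt _)).norm.integrableOn_Icc).mono_set
        Set.Ioo_subset_Icc_self
    have h2 : ∫ r in Set.Ioo (t₀ : ℝ) t, inner ℝ (fs n r - fs m r)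
        (pathAt (xs n) r - pathAt (xs m) r)
        ≤ 2 * B * ∫ r in Set.Ioo (t₀ : ℝ) T, ‖pathAt (xs n) r - pathAt (xs m) r‖ := by
      have hfi := integrable_inner_continuous ((hs n).memLp_source.sub (hs m).memLp_source)
        ((continuous_pathAt (xs n)).sub (continuous_pathAt (xs m)))
      have h3 : ∫ r in Set.Ioo (t₀ : ℝ) t, inner ℝ (fs n r - fs m r)
          (pathAt (xs n) r - pathAt (xs m) r)
          ≤ ∫ r in Set.Ioo (t₀ : ℝ) t, 2 * B * ‖pathAt (xs n) r - pathAt (xs m) r‖ := by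
        refine integral_mono_ae (IntegrableOn.mono_set hfi hsub)
          (IntegrableOn.mono_set (hci.const_mul _) hsub) ?_
        filter_upwards [ae_restrict_of_ae_restrict_of_subset hsub (hB n),
          ae_restrict_of_ae_restrict_of_subset hsub (hB m)] with r h1 h2
        refine (real_inner_le_norm _ _).trans (mul_le_mul_of_nonneg_right ?_ (norm_nonneg _))
        linarith [norm_sub_le (fs n r) (fs m r)]
      refine h3.trans ?_
      rw [integral_const_mul]
      refine mul_le_mul_of_nonneg_left ?_ (by linarith)
      exact setIntegral_mono_set hci (Eventually.of_forall fun r => norm_nonneg _)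
        hsub.eventuallyLE
    have h4 : 2 * B * ∫ r in Set.Ioo (t₀ : ℝ) T, ‖pathAt (xs n) r - pathAt (xs m) r‖
        ≤ 2 * B * (δ ^ 2 / 4 / (4 * B + 1)) := mul_le_mul_of_nonneg_left hI (by linarith)
    have h5 : 2 * (2 * B * (δ ^ 2 / 4 / (4 * B + 1))) ≤ (δ / 2) ^ 2 := by
      rw [show 2 * (2 * B * (δ ^ 2 / 4 / (4 * B + 1))) = 4 * B * (δ ^ 2 / 4) / (4 * B + 1) by ring,
        div_le_iff₀ (by positivity)]
      nlinarith [sq_nonneg δ]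
    have hxx : pathAt (xs n) t₀ = pathAt (xs m) t₀ := by
      rw [pathAt_coe, pathAt_coe, hx₀ n _ le_rfl, hx₀ m _ le_rfl]
    refine abs_le_of_sq_le_sq' ?_ (by linarith) |>.2
    linarith
  rw [dist_eq_norm]
  refine ((ContinuousMap.norm_le (xs n - xs m) (by linarith : (0 : ℝ) ≤ δ / 2)).2 hbound).trans_lt ?_
  linarith

/-- Sequential compactness of the trajectory sets. -/
theorem exists_subseq_tendsto_trajectories (hι : IsGelfandTriple ι) (hA : HypA T p q A)
    (hp : 2 ≤ p) (hpq : p.HolderConjugate q) {L : ℝ} (hL : 0 ≤ L) {t₀ : Set.Icc (0 : ℝ) T}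
    {x₀ : PathSp T H} {xs : ℕ → PathSp T H} (hxs : ∀ n, xs n ∈ trajectories ι p q A L t₀ x₀) :
    ∃ x ∈ trajectories ι p q A L t₀ x₀, ∃ φ : ℕ → ℕ, StrictMono φ ∧
      Tendsto (xs ∘ φ) atTop (𝓝 x) ∧ ∀ t ∈ Set.Icc (t₀ : ℝ) T, ∀ v : V,
        Tendsto (fun n => ∫ r in (t₀ : ℝ)..t, A r (toV ι (pathAt (xs (φ n)) r)) v) atTop
          (𝓝 (∫ r in (t₀ : ℝ)..t, A r (toV ι (pathAt x r)) v)) := by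
  simp only [mem_trajectories_iff hA hp hpq] at hxs
  choose hx₀ fs hs hfs using hxs
  obtain ⟨C, M, hC0, hM, hbd⟩ := exists_apriori_bound hA hp hpq hL t₀ x₀ (ι := ι)
  have hC : ∀ n, ‖xs n‖ ≤ C := fun n => (hbd _ _ (hx₀ n) (hs n) (hfs n)).1
  have hUM := fun n => (hbd _ _ (hx₀ n) (hs n) (hfs n)).2
  set B := L * (1 + C)
  have hB0 : 0 ≤ B := by positivity
  have hsC : ∀ n r, L * (1 + ‖stopAt (clampTime r) (xs n)‖) ≤ B := fun n r =>
    mul_le_mul_of_nonneg_left (by linarith [norm_stopAt_le (clampTime r) (xs n), hC n]) hL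
  have hB : ∀ n, ∀ᵐ r ∂volume.restrict (Set.Ioo (t₀ : ℝ) T), ‖fs n r‖ ≤ B := fun n =>
    (hfs n).mono fun r hr => hr.trans (hsC n r)
  obtain ⟨φ₁, f, hφ₁, hf, hfw⟩ := exists_weak_subseq_inner (fun n => (hs n).memLp_source) hB
  have : Fact (1 ≤ ENNReal.ofReal p) := ⟨one_le_ofReal_conj hpq.symm⟩
  obtain ⟨φ₂, Λ, hφ₂, hΛ⟩ := exists_weak_subseq_superposition hA hp hpq t₀.2.1
    (fun n => (hs (φ₁ n)).memLp) hM (fun n => hUM (φ₁ n))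
  set φ := fun n => φ₁ (φ₂ n)
  have hφ : StrictMono φ := hφ₁.comp hφ₂
  have hfw' : ∀ g : ℝ → H, MemLp g 2 (volume.restrict (Set.Ioo (t₀ : ℝ) T)) →
      Tendsto (fun n => ∫ r in Set.Ioo (t₀ : ℝ) T, inner ℝ (fs (φ n) r) (g r)) atTop
        (𝓝 (∫ r in Set.Ioo (t₀ : ℝ) T, inner ℝ (f r) (g r))) := fun g hg =>
    (hfw g hg).comp hφ₂.tendsto_atTop
  -- The integrated equation writes (x_n(t), v) in terms of the weakly convergent sources and
  -- operator terms, so it converges at every time; density of V extends this to all of H.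
  have hweak : ∀ t ∈ Set.Icc (t₀ : ℝ) T, ∀ v : V,
      CauchySeq fun n => inner ℝ (ι v) (pathAt (xs (φ n)) t) := fun t ht v => by
    have h1 := tendsto_setIntegral_inner (c := (t₀ : ℝ)) (d := t) le_rfl ht.2 hfw'
      (continuous_const (y := ι v))
    have h2 := hΛ _ ((memLp_const v).indicator (measurableSet_Ioo (a := (t₀ : ℝ)) (b := t)))
    have hI := fun y : PathSp T H => integral_Ioo_indicator_const (a := (t₀ : ℝ)) (b := T)
      (c := t₀) (d := t) le_rfl ht.2 (fun r => A r (toV ι (pathAt y r))) v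
    simp only [hI] at h2
    refine Tendsto.cauchySeq (((h1.sub h2).const_add (inner ℝ (ι v) (pathAt x₀ t₀))).congr
      fun n => ?_)
    have := (hs (φ n)).integral_A hA hp hpq ht v
    rw [intervalIntegral_eq_integral_Ioo ht.1, intervalIntegral_eq_integral_Ioo ht.1,
      inner_sub_left, pathAt_congr (hx₀ (φ n)) le_rfl] at this
    rw [real_inner_comm (pathAt x₀ t₀), real_inner_comm (pathAt (xs (φ n)) t)]
    linarith
  have hweakH : ∀ t ∈ Set.Icc (t₀ : ℝ) T, ∀ e : H,
      CauchySeq fun n => inner ℝ e (pathAt (xs (φ n)) t) := fun t ht e => by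
    refine Metric.cauchySeq_iff.2 fun ε hε => ?_
    obtain ⟨v, hv⟩ := hι.dense.exists_dist_lt e (show 0 < ε / (4 * (C + 1)) by positivity)
    obtain ⟨N, hN⟩ := Metric.cauchySeq_iff.1 (hweak t ht v) (ε / 2) (by linarith)
    refine ⟨N, fun n hn m hm => ?_⟩
    have h1 := hN n hn m hm
    rw [dist_eq_norm] at hv
    rw [Real.dist_eq] at h1 ⊢
    have hd : ∀ k, |inner ℝ (e - ι v) (pathAt (xs (φ k)) t)| ≤ ε / 4 := fun k => by
      refine (abs_real_inner_le_norm _ _).trans ((mul_le_mul hv.le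
        (((xs (φ k)).norm_coe_le_norm _).trans (hC (φ k))) (norm_nonneg _) (by positivity)).trans ?_)
      rw [div_mul_eq_mul_div, div_le_div_iff₀ (by positivity) (by norm_num)]
      nlinarith
    have hn' := hd n
    have hm' := hd m
    rw [inner_sub_left] at hn' hm'
    rw [abs_lt] at h1 ⊢
    rw [abs_le] at hn' hm'
    constructor <;> linarith
  have hlim : ∀ e : H, ∃ β : ℝ → ℝ, ∀ᵐ r ∂volume.restrict (Set.Ioo (t₀ : ℝ) T),
      Tendsto (fun n => inner ℝ e (pathAt (xs (φ n)) r)) atTop (𝓝 (β r)) := fun e => by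
    refine ⟨fun r => limUnder atTop fun n => inner ℝ e (pathAt (xs (φ n)) r), ?_⟩
    filter_upwards [ae_restrict_mem measurableSet_Ioo] with r hr
    exact (hweakH r ⟨hr.1.le, hr.2.le⟩ e).tendsto_limUnder
  have hcauchy := cauchySeq_of_weak hι hA hp hpq (fun n => hx₀ (φ n)) (fun n => hs (φ n))
    (fun n => hC (φ n)) hM (fun n => hUM (φ n)) hB0 (fun n => hB (φ n)) hlim
  obtain ⟨x, hx⟩ := cauchySeq_tendsto_of_complete hcauchy
  have hsol := IsSol.of_tendsto hι hA hp hpq (fun n => hs (φ n)) hx hM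
    (fun n => hUM (φ n)) (fun n => hB (φ n)) hf hfw'
  refine ⟨x, ?_, φ, hφ, hx, fun t ht v => ?_⟩
  swap
  · have h1 := tendsto_setIntegral_inner (c := (t₀ : ℝ)) (d := t) le_rfl ht.2 hfw'
      (continuous_const (y := ι v))
    have h2 : ∀ r, Tendsto (fun n => pathAt (xs (φ n)) r) atTop (𝓝 (pathAt x r)) := fun r =>
      ((continuous_eval_const (clampTime r)).tendsto x).comp hx
    rw [hsol.integral_A hA hp hpq ht v, intervalIntegral_eq_integral_Ioo ht.1]
    refine (h1.sub (((h2 t).sub (h2 t₀)).inner tendsto_const_nhds)).congr fun n => ?_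
    rw [(hs (φ n)).integral_A hA hp hpq ht v, intervalIntegral_eq_integral_Ioo ht.1]
  rw [mem_trajectories_iff hA hp hpq]
  refine ⟨fun t ht => ?_, f, hsol, ?_⟩
  · refine tendsto_nhds_unique (((continuous_eval_const t).tendsto x).comp hx) ?_
    simp only [Function.comp_def, hx₀ _ t ht]
    exact tendsto_const_nhds
  · have hcs : ∀ y : PathSp T H, Continuous fun r => L * (1 + ‖stopAt (clampTime r) y‖) := fun y =>
      (continuous_const.add (continuous_stopAt.comp
        (continuous_clampTime.prodMk continuous_const)).norm).const_mul _
    refine ae_norm_le_of_weak (fun n => (hs (φ n)).memLp_source) hf hfw'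
      (b := fun n r => L * (1 + ‖stopAt (clampTime r) (xs (φ n))‖)) (D := B)
      (fun n => hcs _) (hcs x) (fun r => by positivity) (fun n r => ?_) (fun r => ?_)
      (fun n => hfs (φ n))
    · rw [abs_of_nonneg (by positivity)]
      exact hsC _ r
    · exact ((tendsto_const_nhds.add (((continuous_stopAt.comp
        (continuous_const.prodMk continuous_id)).tendsto x).comp hx).norm).const_mul _)

end Compact

/-! ### Compact tubes and continuity of the less smooth part of test functions -/

section Consequences

variable {T : ℝ} [Fact (0 < T)] {V H : Type*} [NormedAddCommGroup V] [NormedSpace ℝ V]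
  [NormedAddCommGroup H] [InnerProductSpace ℝ H] {ι : V →L[ℝ] H} {p q : ℝ}
  {A : ℝ → V → StrongDual ℝ V}

lemma tildePhi_self (z : V) (t₀ : Set.Icc (0 : ℝ) T) (x : PathSp T H) :
    tildePhi ι A z t₀ ⟨t₀, x⟩ = 0 := by simp [tildePhi]

lemma tildePhi_congr {z : V} {t₀ t : Set.Icc (0 : ℝ) T} (h0 : t₀ ≤ t) {x y : PathSp T H}
    (hxy : ∀ s ≤ t, x s = y s) : tildePhi ι A z t₀ ⟨t, x⟩ = tildePhi ι A z t₀ ⟨t, y⟩ := by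
  refine intervalIntegral.integral_congr fun r hr => ?_
  rw [Set.uIcc_of_le (show (t₀ : ℝ) ≤ t from h0)] at hr
  simp only [pathAt_congr hxy hr.2]

lemma eq_of_stopAt_eq {t s : Set.Icc (0 : ℝ) T} {x y : PathSp T H} (h : stopAt t x = stopAt t y)
    (hs : s ≤ t) : x s = y s := by
  rw [← stopAt_apply_of_le hs x, h, stopAt_apply_of_le hs y]

variable [TopologicalSpace.SeparableSpace V] [TopologicalSpace.SeparableSpace H]
  [CompleteSpace V] [CompleteSpace H] [TopologicalSpace.SeparableSpace (StrongDual ℝ V)]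

theorem isCompact_trajectories (hι : IsGelfandTriple ι) (hA : HypA T p q A)
    (hp : 2 ≤ p) (hpq : p.HolderConjugate q) {L : ℝ} (hL : 0 ≤ L) (t₀ : Set.Icc (0 : ℝ) T)
    (x₀ : PathSp T H) : IsCompact (trajectories ι p q A L t₀ x₀) := by
  refine IsSeqCompact.isCompact fun xs hxs => ?_
  obtain ⟨x, hx, φ, hφ, hlim, -⟩ := exists_subseq_tendsto_trajectories hι hA hp hpq hL hxs
  exact ⟨x, hx, φ, hφ, hlim⟩

/-- The part of the tube up to the time `t₂` is compact. -/
lemma isCompact_tube_le (hι : IsGelfandTriple ι) (hA : HypA T p q A)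
    (hp : 2 ≤ p) (hpq : p.HolderConjugate q) {L : ℝ} (hL : 0 ≤ L) (t₀ t₂ : Set.Icc (0 : ℝ) T)
    (x₀ : PathSp T H) : IsCompact {P | P ∈ tube ι p q A L t₀ x₀ ∧ P.time ≤ t₂} := by
  have h := ((isClosed_Icc (a := t₀) (b := t₂)).isCompact.prod
    (isCompact_trajectories hι hA hp hpq hL t₀ x₀)).image continuous_timePath_mk
  convert h using 1
  ext ⟨s, x⟩
  constructor
  · rintro ⟨⟨h1, h2⟩, h3⟩
    exact ⟨(s, x), ⟨⟨h1, h3⟩, h2⟩, rfl⟩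
  · rintro ⟨⟨s', x'⟩, ⟨⟨h1, h3⟩, h2⟩, h⟩
    cases h
    exact ⟨⟨h1, h2⟩, h3⟩

lemma exists_source_bound (hA : HypA T p q A)
    (hp : 2 ≤ p) (hpq : p.HolderConjugate q) {L : ℝ} (hL : 0 ≤ L) (t₀ : Set.Icc (0 : ℝ) T)
    (x₀ : PathSp T H) : ∃ B : ℝ, 0 ≤ B ∧ ∀ x ∈ trajectories ι p q A L t₀ x₀, ∃ f : ℝ → H,
      IsSol ι p A t₀ x f ∧ ∀ᵐ r ∂volume.restrict (Set.Ioo (t₀ : ℝ) T), ‖f r‖ ≤ B := by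
  obtain ⟨C, M, hC0, -, hbd⟩ := exists_apriori_bound hA hp hpq hL t₀ x₀ (ι := ι)
  refine ⟨L * (1 + C), by positivity, fun x hx => ?_⟩
  rw [mem_trajectories_iff hA hp hpq] at hx
  obtain ⟨h0, f, hf, hfL⟩ := hx
  refine ⟨f, hf, hfL.mono fun r hr => hr.trans (mul_le_mul_of_nonneg_left ?_ hL)⟩
  linarith [norm_stopAt_le (clampTime r) x, (hbd x f h0 hf hfL).1]

/-- With A eliminated by the equation, the modulus in time depends only on the bound of the source
and on the modulus of the path in H. -/
lemma abs_tildePhi_sub_le (hA : HypA T p q A) (hp : 2 ≤ p) (hpq : p.HolderConjugate q)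
    {t₀ : Set.Icc (0 : ℝ) T} {x : PathSp T H} {f : ℝ → H} (h : IsSol ι p A t₀ x f) {B : ℝ}
    (hB : ∀ᵐ r ∂volume.restrict (Set.Ioo (t₀ : ℝ) T), ‖f r‖ ≤ B) (z : V)
    {s t : Set.Icc (0 : ℝ) T} (hs : t₀ ≤ s) (ht : t₀ ≤ t) :
    |tildePhi ι A z t₀ ⟨s, x⟩ - tildePhi ι A z t₀ ⟨t, x⟩|
      ≤ B * ‖ι z‖ * |(s : ℝ) - t| + ‖x s - x t‖ * ‖ι z‖ := by
  wlog hst : t ≤ s generalizing s t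
  · have := this ht hs (le_of_not_ge hst)
    rwa [abs_sub_comm, abs_sub_comm (s : ℝ), norm_sub_rev]
  have h0 : (t₀ : ℝ) ∈ Set.Icc (t₀ : ℝ) T := ⟨le_rfl, t₀.2.2⟩
  have hs' : (s : ℝ) ∈ Set.Icc (t₀ : ℝ) T := ⟨hs, s.2.2⟩
  have ht' : (t : ℝ) ∈ Set.Icc (t₀ : ℝ) T := ⟨ht, t.2.2⟩
  have hi : ∀ {r}, r ∈ Set.Icc (t₀ : ℝ) T →
      IntervalIntegrable (fun r => inner ℝ (f r) (ι z)) volume t₀ r := fun hr =>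
    intervalIntegrable_of_Ioo (integrable_inner_const h.memLp_source (ι z)) h0 hr
  have e : tildePhi ι A z t₀ ⟨s, x⟩ - tildePhi ι A z t₀ ⟨t, x⟩
      = (∫ r in (t : ℝ)..s, inner ℝ (f r) (ι z)) - inner ℝ (x s - x t) (ι z) := by
    rw [tildePhi, tildePhi, h.integral_A hA hp hpq hs', h.integral_A hA hp hpq ht',
      ← intervalIntegral.integral_interval_sub_left (hi hs') (hi ht')]
    simp only [pathAt_coe, inner_sub_left]
    ring
  rw [e]
  refine (abs_sub _ _).trans (add_le_add ?_ (abs_real_inner_le_norm _ _))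
  rw [← Real.norm_eq_abs, ← Real.norm_eq_abs ((s : ℝ) - t)]
  refine intervalIntegral.norm_integral_le_of_norm_le_const_ae ?_
  have hae := ae_restrict_of_ae_restrict_of_subset
    (Set.Ioo_subset_Ioo (show (t₀ : ℝ) ≤ t from ht) s.2.2) hB
  rw [ae_restrict_iff' measurableSet_Ioo] at hae
  have hne : ∀ᵐ r : ℝ, r ≠ s := by simp [ae_iff, measure_singleton]
  filter_upwards [hae, hne] with r hr hrs hmem
  rw [Set.uIoc_of_le (show (t : ℝ) ≤ s from hst)] at hmem
  exact (norm_inner_le_norm _ _).trans (mul_le_mul_of_nonneg_right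
    (hr ⟨hmem.1, lt_of_le_of_ne hmem.2 hrs⟩) (norm_nonneg _))

/-- Convergence in d_∞ controls the paths only up to the current time. By compactness a subsequence
of the full paths converges to some trajectory y, which agrees with x up to t, and `tildePhi` sees
no more than that. The moving time is handled by `abs_tildePhi_sub_le`. -/
theorem continuousOn_tildePhi (hι : IsGelfandTriple ι) (hA : HypA T p q A)
    (hp : 2 ≤ p) (hpq : p.HolderConjugate q) {L : ℝ} (hL : 0 ≤ L) (t₀ : Set.Icc (0 : ℝ) T)
    (x₀ : PathSp T H) (z : V) :
    ContinuousOn (tildePhi ι A z t₀) (tube ι p q A L t₀ x₀) := by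
  obtain ⟨B, hB0, hB⟩ := exists_source_bound hA hp hpq hL t₀ x₀ (ι := ι)
  rintro ⟨t, x⟩ ⟨ht0, hx⟩
  refine tendsto_of_seq_tendsto fun P hP => ?_
  rw [tendsto_nhdsWithin_iff] at hP
  refine tendsto_of_subseq_tendsto fun ns hns => ?_
  obtain ⟨hP1, hP2⟩ := hP
  obtain ⟨N, hN⟩ := (hns.eventually hP2).exists_forall_of_atTop
  have hQ : Tendsto (fun n => P (ns (n + N))) atTop (𝓝 (⟨t, x⟩ : TimePath T H)) :=
    hP1.comp (hns.comp (tendsto_add_atTop_nat N))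
  have hQt : Tendsto (fun n => (P (ns (n + N))).time) atTop (𝓝 t) :=
    (continuous_time.tendsto (⟨t, x⟩ : TimePath T H)).comp hQ
  have hQs : Tendsto (fun n => stopAt (P (ns (n + N))).time (P (ns (n + N))).path) atTop
      (𝓝 (stopAt t x)) := (continuous_stopped.tendsto (⟨t, x⟩ : TimePath T H)).comp hQ
  have hmem : ∀ n, P (ns (n + N)) ∈ tube ι p q A L t₀ x₀ := fun n => hN _ (by omega)
  obtain ⟨y, hy, φ, hφ, hlim, hJ⟩ := exists_subseq_tendsto_trajectories hι hA hp hpq hL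
    (fun n => (hmem n).2)
  refine ⟨fun n => φ n + N, ?_⟩
  have hyx : stopAt t y = stopAt t x := by
    refine tendsto_nhds_unique ?_ (hQs.comp hφ.tendsto_atTop)
    exact (continuous_stopAt.tendsto (t, y)).comp
      ((hQt.comp hφ.tendsto_atTop).prodMk_nhds hlim)
  have hval : tildePhi ι A z t₀ ⟨t, x⟩ = tildePhi ι A z t₀ ⟨t, y⟩ :=
    tildePhi_congr ht0 fun s hs => (eq_of_stopAt_eq hyx hs).symm
  have h1 : Tendsto (fun n => tildePhi ι A z t₀ ⟨t, (P (ns (φ n + N))).path⟩) atTop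
      (𝓝 (tildePhi ι A z t₀ ⟨t, y⟩)) := hJ t ⟨ht0, t.2.2⟩ z
  have hev : ∀ r : ℕ → Set.Icc (0 : ℝ) T, Tendsto r atTop (𝓝 t) →
      Tendsto (fun n => (P (ns (φ n + N))).path (r n)) atTop (𝓝 (y t)) := fun r hr =>
    ((continuous_eval (X := Set.Icc (0 : ℝ) T) (Y := H)).tendsto (y, t)).comp (hlim.prodMk_nhds hr)
  have hQφ : Tendsto (fun n => (P (ns (φ n + N))).time) atTop (𝓝 t) := hQt.comp hφ.tendsto_atTop
  have h2 : Tendsto (fun n => tildePhi ι A z t₀ (P (ns (φ n + N)))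
      - tildePhi ι A z t₀ ⟨t, (P (ns (φ n + N))).path⟩) atTop (𝓝 0) := by
    have hg : Tendsto (fun n => B * ‖ι z‖ * |((P (ns (φ n + N))).time : ℝ) - t|
        + ‖(P (ns (φ n + N))).path (P (ns (φ n + N))).time - (P (ns (φ n + N))).path t‖ * ‖ι z‖)
        atTop (𝓝 (B * ‖ι z‖ * |(t : ℝ) - t| + ‖y t - y t‖ * ‖ι z‖)) :=
      ((((continuous_subtype_val.tendsto t).comp hQφ).sub_const _).abs.const_mul _).add
        (((hev _ hQφ).sub (hev _ tendsto_const_nhds)).norm.mul_const _)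
    simp only [sub_self, abs_zero, norm_zero, mul_zero, zero_mul, add_zero] at hg
    refine squeeze_zero_norm (fun n => ?_) hg
    obtain ⟨f, hf, hfB⟩ := hB _ (hmem (φ n)).2
    exact abs_tildePhi_sub_le hA hp hpq hf hfB z (hmem (φ n)).1 ht0
  rw [hval]
  simpa using h2.add h1

end Consequences

/-! ### Reduction to affine test functions -/

section Viscosity

variable {T : ℝ} [Fact (0 < T)] {V H : Type*} [NormedAddCommGroup V] [NormedSpace ℝ V]
  [NormedAddCommGroup H] [InnerProductSpace ℝ H] {ι : V →L[ℝ] H} {p q : ℝ}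
  {A : ℝ → V → StrongDual ℝ V}

variable (ι A) in
/-- The test functional `κ t + (x(t), z) + ∫_{t₁}^t ⟨A(s,x(s)), z⟩ ds`. -/
def affineTest (t₁ : Set.Icc (0 : ℝ) T) (κ : ℝ) (z : V) (P : TimePath T H) : ℝ :=
  κ * P.time + inner ℝ (P.path P.time) (ι z) + tildePhi ι A z t₁ P

lemma isC11V_affine (hinj : Function.Injective ι) (hpq : p.HolderConjugate q)
    (t₀ : Set.Icc (0 : ℝ) T) (c κ : ℝ) (z : V) :
    IsC11V ι p q t₀ (fun P : TimePath T H => c + κ * P.time + inner ℝ (P.path P.time) (ι z))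
      (fun _ => κ) (fun _ => ι z) where
  cont := by
    have h1 : Continuous fun P : TimePath T H => (P.time : ℝ) :=
      continuous_subtype_val.comp continuous_time
    have h2 : Continuous fun P : TimePath T H => P.path P.time := continuous_current
    exact ((continuous_const.add (h1.const_mul κ)).add (h2.inner continuous_const)).continuousOn
  cont_dt := continuousOn_const
  cont_dx := continuousOn_const
  mem_range _ _ := Eventually.of_forall fun _ => ⟨z, rfl⟩
  chain_rule := by
    intro t₀' _ h0T x₀ x x' hx hW
    have hi := (hW.memLp_deriv.integrable (one_le_ofReal_conj hpq)).apply_continuousLinearMap z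
    have hm : (t₀' : ℝ) ∈ Set.Icc (t₀' : ℝ) T := ⟨le_rfl, h0T.le⟩
    simp only [toV_apply hinj]
    refine ⟨Eventually.of_forall fun _ => ⟨z, rfl⟩, ?_, fun t ht => ?_⟩
    · rw [integrableOn_Icc_iff_integrableOn_Ioo]
      exact (integrable_const κ).add hi
    · have ht' : (t : ℝ) ∈ Set.Icc (t₀' : ℝ) T := ⟨ht, t.2.2⟩
      rw [intervalIntegral.integral_add intervalIntegrable_const
        (intervalIntegrable_of_Ioo hi hm ht'), ← inner_sub_eq_integral_of_memW hpq hW z hm ht',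
        pathAt_coe, pathAt_coe, hx _ le_rfl, inner_sub_left, intervalIntegral.integral_const,
        smul_eq_mul]
      ring

lemma mem_tube_self {L : ℝ} {t₀ : Set.Icc (0 : ℝ) T} {x₀ : PathSp T H}
    (hx₀ : x₀ ∈ trajectories ι p q A L t₀ x₀) : (⟨t₀, x₀⟩ : TimePath T H) ∈ tube ι p q A L t₀ x₀ :=
  ⟨le_rfl, hx₀⟩

/-- Affine functionals are test functions, for which the mean term vanishes. -/
lemma SubInequalityAt.affine (hinj : Function.Injective ι) (hpq : p.HolderConjugate q) {L : ℝ}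
    {F : TimePath T H × H → ℝ} {u : TimePath T H → ℝ} {t₀ T₀ : Set.Icc (0 : ℝ) T}
    {x₀ : PathSp T H} (h : SubInequalityAt ι p q A L F u t₀ x₀)
    (hx₀ : x₀ ∈ trajectories ι p q A L t₀ x₀) (hT₀ : t₀ < T₀) {κ : ℝ} {z : V}
    (hmax : ∀ P ∈ tube ι p q A L t₀ x₀, P.time ≤ T₀ →
      u P - affineTest ι A t₀ κ z P ≤ u ⟨t₀, x₀⟩ - affineTest ι A t₀ κ z ⟨t₀, x₀⟩) :
    0 ≤ κ + F (⟨t₀, x₀⟩, ι z) := by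
  set c := u ⟨t₀, x₀⟩ - κ * t₀ - inner ℝ (x₀ t₀) (ι z)
  have htouch : TouchesAbove ι p q A L u t₀ x₀
      (fun P => c + κ * P.time + inner ℝ (P.path P.time) (ι z)) z := by
    have h0 : c + κ * (t₀ : ℝ) + inner ℝ (x₀ t₀) (ι z) + tildePhi ι A z t₀ ⟨t₀, x₀⟩
        - u ⟨t₀, x₀⟩ = 0 := by
      rw [tildePhi_self]; simp only [c]; ring
    refine ⟨T₀, hT₀, h0, ?_, ?_⟩
    · rintro _ ⟨P, ⟨hP, hPT⟩, rfl⟩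
      have := hmax P hP hPT
      simp only [affineTest, tildePhi_self] at this
      simp only [c]
      linarith
    · intro b hb
      have := hb ⟨⟨t₀, x₀⟩, ⟨mem_tube_self hx₀, hT₀.le⟩, rfl⟩
      simpa only [h0] using this
  have := h _ _ _ z (isC11V_affine hinj hpq t₀ c κ z) htouch
  have hmean : ∀ (x : PathSp T H) (δ : ℝ), meanTerm ι A z (fun _ => ι z) t₀ x δ = 0 := by
    intro x δ
    simp [meanTerm, toV_apply hinj]
  have hsup : ∀ δ : ℝ, (⨆ x ∈ trajectories ι p q A L t₀ x₀,
      ((meanTerm ι A z (fun _ => ι z) t₀ x δ : ℝ) : EReal)) = 0 := fun δ => by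
    simp only [hmean, EReal.coe_zero]
    -- The trajectory set must be nonempty here; an empty supremum would be ⊥.
    exact biSup_const ⟨x₀, hx₀⟩
  simp only [hsup, limsup_const, add_zero] at this
  exact_mod_cast this

variable [TopologicalSpace.SeparableSpace V] [TopologicalSpace.SeparableSpace H]
  [CompleteSpace V] [CompleteSpace H] [TopologicalSpace.SeparableSpace (StrongDual ℝ V)]

/-- Writing x' as f - A splits the integrand of the chain rule into integrable pieces, so that ⟨A,
∂_x φ⟩ can be merged with the increment of `tildePhi` into the mean term. -/
lemma IsC11V.chain_rule_of_isSol (hA : HypA T p q A) (hp : 2 ≤ p) (hpq : p.HolderConjugate q)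
    {t₀ : Set.Icc (0 : ℝ) T} (h0T : (t₀ : ℝ) < T) {φ dt : TimePath T H → ℝ}
    {dx : TimePath T H → H} (hφ : IsC11V ι p q t₀ φ dt dx) {x₀ x : PathSp T H} {f : ℝ → H}
    (hx₀ : ∀ t ≤ t₀, x t = x₀ t) (hx : IsSol ι p A t₀ x f) :
    IntegrableOn (fun s => A s (toV ι (pathAt x s)) (toV ι (dx (pointAt s x))))
      (Set.Ioo (t₀ : ℝ) T) ∧
    IntegrableOn (fun s => dt (pointAt s x)) (Set.Ioo (t₀ : ℝ) T) ∧
    IntegrableOn (fun s => inner ℝ (f s) (dx (pointAt s x))) (Set.Ioo (t₀ : ℝ) T) ∧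
    ∀ t : Set.Icc (0 : ℝ) T, t₀ ≤ t → φ ⟨t, x⟩ - φ ⟨t₀, x₀⟩
      = (∫ s in (t₀ : ℝ)..t, dt (pointAt s x))
        + (∫ s in (t₀ : ℝ)..t, inner ℝ (f s) (dx (pointAt s x)))
        - ∫ s in (t₀ : ℝ)..t, A s (toV ι (pathAt x s)) (toV ι (dx (pointAt s x))) := by
  obtain ⟨hr, hi, he⟩ := hφ.chain_rule t₀ le_rfl h0T x₀ x _ hx₀ (hx.memW hA hp hpq)
  have hmaps : Set.MapsTo (fun s => pointAt s x) (Set.Icc (t₀ : ℝ) T) {P | t₀ ≤ P.time} := by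
    intro s hs
    have := monotone_clampTime (T := T) hs.1
    rwa [clampTime_coe] at this
  have hdtc : ContinuousOn (fun s => dt (pointAt s x)) (Set.Icc (t₀ : ℝ) T) :=
    hφ.cont_dt.comp (continuous_pointAt x).continuousOn hmaps
  have hdxc : ContinuousOn (fun s => dx (pointAt s x)) (Set.Icc (t₀ : ℝ) T) :=
    hφ.cont_dx.comp (continuous_pointAt x).continuousOn hmaps
  have hdt : IntegrableOn (fun s => dt (pointAt s x)) (Set.Ioo (t₀ : ℝ) T) :=
    hdtc.integrableOn_Icc.mono_set Set.Ioo_subset_Icc_self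
  have hfi : Integrable f (volume.restrict (Set.Ioo (t₀ : ℝ) T)) :=
    hx.memLp_source.integrable (by norm_num)
  have hdx : IntegrableOn (fun s => inner ℝ (f s) (dx (pointAt s x))) (Set.Ioo (t₀ : ℝ) T) := by
    obtain ⟨C, hC⟩ := isCompact_Icc.exists_bound_of_continuousOn hdxc
    refine (hfi.norm.mul_const C).mono' (hfi.1.inner
      ((hdxc.mono Set.Ioo_subset_Icc_self).aestronglyMeasurable measurableSet_Ioo)) ?_
    filter_upwards [ae_restrict_mem measurableSet_Ioo] with r hr
    exact (norm_inner_le_norm _ _).trans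
      (mul_le_mul_of_nonneg_left (hC r ⟨hr.1.le, hr.2.le⟩) (norm_nonneg _))
  have hr' := ae_restrict_of_ae_restrict_of_subset (Set.Ioo_subset_Icc_self) hr
  have hi' := hi.mono_set (Set.Ioo_subset_Icc_self)
  have hae : ∀ᵐ s ∂volume.restrict (Set.Ioo (t₀ : ℝ) T),
      dt (pointAt s x) + solDeriv ι A x f s (toV ι (dx (pointAt s x)))
        = dt (pointAt s x) + inner ℝ (f s) (dx (pointAt s x))
          - A s (toV ι (pathAt x s)) (toV ι (dx (pointAt s x))) := by
    filter_upwards [hr'] with s hs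
    rw [solDeriv, _root_.sub_apply, toDual_apply, map_toV hs]
    ring
  have hAi : IntegrableOn (fun s => A s (toV ι (pathAt x s)) (toV ι (dx (pointAt s x))))
      (Set.Ioo (t₀ : ℝ) T) := by
    refine ((hdt.add hdx).sub hi').congr ?_
    filter_upwards [hae] with s hs
    simp only [Pi.sub_apply, Pi.add_apply, hs]
    ring
  refine ⟨hAi, hdt, hdx, fun t ht => ?_⟩
  have hm : (t₀ : ℝ) ∈ Set.Icc (t₀ : ℝ) T := ⟨le_rfl, h0T.le⟩
  have ht' : (t : ℝ) ∈ Set.Icc (t₀ : ℝ) T := ⟨ht, t.2.2⟩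
  rw [he t ht, integral_congr_Ioo hm ht' ht hae]
  have e1 := intervalIntegral.integral_add (intervalIntegrable_of_Ioo hdt hm ht')
    (intervalIntegrable_of_Ioo hdx hm ht')
  have e2 := intervalIntegral.integral_sub ((intervalIntegrable_of_Ioo hdt hm ht').add
    (intervalIntegrable_of_Ioo hdx hm ht')) (intervalIntegrable_of_Ioo hAi hm ht')
  rw [← e1, ← e2]

lemma intervalIntegral_le_of_ae {a b C : ℝ} (hab : a ≤ b) {g : ℝ → ℝ}
    (hg : IntervalIntegrable g volume a b) (h : ∀ᵐ s ∂volume.restrict (Set.Ioo a b), g s ≤ C) :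
    ∫ s in a..b, g s ≤ C * (b - a) := by
  rw [intervalIntegral_eq_integral_Ioo hab]
  have hg' : IntegrableOn g (Set.Ioo a b) :=
    (intervalIntegrable_iff_integrableOn_Ioo_of_le hab).1 hg
  refine (integral_mono_ae hg' (integrable_const C) h).trans ?_
  rw [integral_const, measureReal_restrict_apply_univ, Real.volume_real_Ioo_of_le hab, smul_eq_mul,
    mul_comm]

/-- The trajectories leave their common initial path uniformly slowly. -/
lemma eventually_dist_pointAt_lt (hι : IsGelfandTriple ι) (hA : HypA T p q A)
    (hp : 2 ≤ p) (hpq : p.HolderConjugate q) {L : ℝ} (hL : 0 ≤ L) (t₀ : Set.Icc (0 : ℝ) T)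
    (x₀ : PathSp T H) {s : Set (TimePath T H)} (hs : s ∈ 𝓝 (⟨t₀, x₀⟩ : TimePath T H)) :
    ∀ᶠ r in 𝓝 (t₀ : ℝ), ∀ x ∈ trajectories ι p q A L t₀ x₀, pointAt r x ∈ s := by
  refine (isCompact_trajectories hι hA hp hpq hL t₀ x₀).eventually_forall_of_forall_eventually
    (P := fun (r : ℝ) x => pointAt r x ∈ s) fun x hx => ?_
  have hc : Continuous fun Q : ℝ × PathSp T H => pointAt Q.1 Q.2 :=
    continuous_timePath_mk.comp ((continuous_clampTime.comp continuous_fst).prodMk continuous_snd)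
  have h0 : pointAt (t₀ : ℝ) x = ⟨t₀, x⟩ := by rw [pointAt, clampTime_coe]
  -- At time t₀ all trajectories represent the same point of the pseudometric space, so a
  -- neighbourhood of (t₀, x₀) is one of each (t₀, x); compactness makes the choice of times
  -- uniform.
  have hins : Inseparable (⟨t₀, x⟩ : TimePath T H) ⟨t₀, x₀⟩ := by
    rw [Metric.inseparable_iff, dist_timePath, stopAt_congr hx.1]
    simp
  have := hc.tendsto ((t₀ : ℝ), x)
  simp only [h0] at this
  rw [hins.nhds_eq] at this
  exact this hs

/-- To verify the viscosity inequality it suffices to consider affine test functionals. -/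
theorem subInequalityAt_of_affine (hι : IsGelfandTriple ι) (hA : HypA T p q A)
    (hp : 2 ≤ p) (hpq : p.HolderConjugate q) {L : ℝ} (hL : 0 ≤ L)
    {F : TimePath T H × H → ℝ} (hF : Continuous F) {u : TimePath T H → ℝ}
    {t₀ : Set.Icc (0 : ℝ) T} (h0T : (t₀ : ℝ) < T) {x₀ : PathSp T H}
    (h : ∀ (κ : ℝ) (z : V) (T₀ : Set.Icc (0 : ℝ) T), t₀ < T₀ →
      (∀ P ∈ tube ι p q A L t₀ x₀, P.time ≤ T₀ →
        u P - affineTest ι A t₀ κ z P ≤ u ⟨t₀, x₀⟩ - affineTest ι A t₀ κ z ⟨t₀, x₀⟩) →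
      0 ≤ κ + F (⟨t₀, x₀⟩, ι z)) : SubInequalityAt ι p q A L F u t₀ x₀ := by
  intro φ dt dx z hφ ⟨T₀, hT₀, htouch0, hglb⟩
  set a := dt ⟨t₀, x₀⟩ with ha
  set p₀ := dx ⟨t₀, x₀⟩ with hp₀
  set b := F (⟨t₀, x₀⟩, p₀) with hb
  set l := limsup (fun δ : ℝ => ⨆ x ∈ trajectories ι p q A L t₀ x₀,
          ((meanTerm ι A z dx t₀ x δ : ℝ) : EReal)) (𝓝[>] (0 : ℝ)) with hl
  by_contra hcon
  have hlt : l < ((-a - b : ℝ) : EReal) := by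
    by_contra hle
    rw [not_lt] at hle
    refine hcon ?_
    calc (0 : EReal) = (a : EReal) + ((-a - b : ℝ) : EReal) + (b : EReal) := by
          rw [← EReal.coe_add, ← EReal.coe_add, ← EReal.coe_zero]; congr 1; ring
      _ ≤ _ := by gcongr
  obtain ⟨c, hc1, hc2⟩ := EReal.lt_iff_exists_real_btwn.1 hlt
  have hc2' : c < -a - b := by exact_mod_cast hc2
  obtain ⟨B, hB0, hB⟩ := exists_source_bound hA hp hpq hL t₀ x₀ (ι := ι)
  -- The gap by which the inequality fails is 2γ. The slope below will be c + a + γ, and F at the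
  -- nearby vector ι z' costs less than another γ/2, so the affine inequality would give 0 < -γ/2.
  set γ := (-a - b - c) / 2 with hγ
  have hγ0 : 0 < γ := by simp only [hγ]; linarith
  have hFc : ∀ᶠ y in 𝓝 p₀, F (⟨t₀, x₀⟩, y) < b + γ / 2 ∧ B * ‖p₀ - y‖ < γ / 2 := by
    refine Eventually.and ?_ ?_
    · have : Continuous fun y => F (⟨t₀, x₀⟩, y) := hF.comp (by fun_prop)
      exact (this.tendsto p₀).eventually (gt_mem_nhds (by linarith))
    · have : Continuous fun y => B * ‖p₀ - y‖ := by fun_prop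
      exact (this.tendsto p₀).eventually (gt_mem_nhds (by simpa using by linarith))
  obtain ⟨z', hz1, hz2⟩ := hι.dense.mem_nhds hFc
  -- Chosen so that the oscillation of ∂_t φ, at most η, and that of ∂_x φ paired with the source,
  -- at most Bη, add up to γ/2.
  set η := γ / (2 * (1 + B)) with hη
  have hη0 : 0 < η := by positivity
  have hηγ : η + B * η = γ / 2 := by rw [hη]; field_simp
  have hs : {P : TimePath T H | t₀ ≤ P.time → |dt P - a| < η ∧ ‖dx P - p₀‖ < η}
      ∈ 𝓝 (⟨t₀, x₀⟩ : TimePath T H) := by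
    have h1 := (hφ.cont_dt ⟨t₀, x₀⟩ (le_refl t₀)).eventually (Metric.ball_mem_nhds _ hη0)
    have h2 := (hφ.cont_dx ⟨t₀, x₀⟩ (le_refl t₀)).eventually (Metric.ball_mem_nhds _ hη0)
    have h3 := eventually_nhdsWithin_iff.1 (h1.and h2)
    filter_upwards [h3] with P hP hPt
    have := hP hPt
    rwa [Real.dist_eq, dist_eq_norm] at this
  obtain ⟨ρ₁, hρ₁, hE1⟩ := Metric.eventually_nhds_iff.1
    (eventually_dist_pointAt_lt hι hA hp hpq hL t₀ x₀ hs)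
  obtain ⟨ρ₂, hρ₂, hE2⟩ := mem_nhdsGT_iff_exists_Ioo_subset.1 (eventually_lt_of_limsup_lt hc1)
  have hρ₂' : (0 : ℝ) < ρ₂ := hρ₂
  have hT₀' : (t₀ : ℝ) < T₀ := hT₀
  set ρ := min (min (ρ₁ / 2) (ρ₂ / 2)) (T₀ - t₀) with hρ
  have hρ0 : 0 < ρ := lt_min (lt_min (by linarith) (by linarith)) (by linarith)
  have hρ1 : ρ ≤ ρ₁ / 2 := (min_le_left _ _).trans (min_le_left _ _)
  have hρ2 : ρ ≤ ρ₂ / 2 := (min_le_left _ _).trans (min_le_right _ _)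
  have hρ3 : ρ ≤ T₀ - t₀ := min_le_right _ _
  have hτ : (t₀ : ℝ) + ρ ∈ Set.Icc (0 : ℝ) T :=
    ⟨by linarith [t₀.2.1], by linarith [T₀.2.2]⟩
  -- Up to time t₀ + ρ the increment of φ + `tildePhi` along any trajectory is at most (c + a + γ)(t
  -- - t₀) + ∫(f, ι z'). By the equation this is exactly the increment of the affine functional with
  -- slope c + a + γ and vector z'.
  have hκ := h (c + a + γ) z' ⟨(t₀ : ℝ) + ρ, hτ⟩ (show (t₀ : ℝ) < t₀ + ρ by linarith) ?_
  · linarith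
  rintro ⟨t, x⟩ ⟨ht0, hx⟩ htρ
  have ht0' : (t₀ : ℝ) ≤ t := ht0
  have htρ' : (t : ℝ) ≤ t₀ + ρ := htρ
  obtain ⟨f, hf, hfB⟩ := hB x hx
  obtain ⟨hAi, hdti, hdxi, hchain⟩ := hφ.chain_rule_of_isSol hA hp hpq h0T hx.1 hf
  have hu : u ⟨t, x⟩ ≤ φ ⟨t, x⟩ + tildePhi ι A z t₀ ⟨t, x⟩ := by
    have hle : t ≤ T₀ := show (t : ℝ) ≤ T₀ by linarith
    have := hglb.1 ⟨⟨t, x⟩, ⟨⟨ht0, hx⟩, hle⟩, rfl⟩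
    linarith
  rw [tildePhi_self] at htouch0
  have hc := hchain t ht0
  have hm : (t₀ : ℝ) ∈ Set.Icc (t₀ : ℝ) T := ⟨le_rfl, h0T.le⟩
  have ht' : (t : ℝ) ∈ Set.Icc (t₀ : ℝ) T := ⟨ht0, t.2.2⟩
  have hAz := (hf.integrable_A hA hp hpq).apply_continuousLinearMap z
  have hmean : tildePhi ι A z t₀ ⟨t, x⟩
      - (∫ s in (t₀ : ℝ)..t, A s (toV ι (pathAt x s)) (toV ι (dx (pointAt s x))))
      ≤ c * (t - t₀) := by
    rw [tildePhi, ← intervalIntegral.integral_sub (intervalIntegrable_of_Ioo hAz hm ht')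
      (intervalIntegrable_of_Ioo hAi hm ht')]
    rcases ht0'.eq_or_lt with h | h
    · rw [← h]; simp
    have h1 : (⨆ x ∈ trajectories ι p q A L t₀ x₀,
        ((meanTerm ι A z dx t₀ x (t - t₀) : ℝ) : EReal)) < c :=
      hE2 ⟨by linarith, by linarith⟩
    have h2 : ((meanTerm ι A z dx t₀ x (t - t₀) : ℝ) : EReal) < c :=
      (le_iSup₂ (f := fun x (_ : x ∈ trajectories ι p q A L t₀ x₀) =>
        ((meanTerm ι A z dx t₀ x (t - t₀) : ℝ) : EReal)) x hx).trans_lt h1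
    have h3 : meanTerm ι A z dx t₀ x (t - t₀) < c := by exact_mod_cast h2
    have hpos : (0 : ℝ) < t - t₀ := by linarith
    rw [meanTerm, add_sub_cancel, inv_mul_lt_iff₀ hpos] at h3
    linarith
  have hnear : ∀ s ∈ Set.Ioo (t₀ : ℝ) t,
      |dt (pointAt s x) - a| < η ∧ ‖dx (pointAt s x) - p₀‖ < η := fun s hs => by
    refine hE1 (y := s) ?_ x hx ?_
    · rw [Real.dist_eq, abs_of_pos (by linarith [hs.1])]; linarith [hs.2]
    · have := monotone_clampTime (T := T) hs.1.le
      rwa [clampTime_coe] at this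
  have hI1 : ∫ s in (t₀ : ℝ)..t, dt (pointAt s x) ≤ (a + η) * (t - t₀) :=
    intervalIntegral_le_of_ae ht0' (intervalIntegrable_of_Ioo hdti hm ht') (by
      filter_upwards [ae_restrict_mem measurableSet_Ioo] with s hs
      linarith [(abs_lt.1 (hnear s hs).1).2])
  have hfi := integrable_inner_const hf.memLp_source (ι z')
  have hI2 : (∫ s in (t₀ : ℝ)..t, inner ℝ (f s) (dx (pointAt s x)))
      - (∫ s in (t₀ : ℝ)..t, inner ℝ (f s) (ι z')) ≤ (γ / 2 + B * η) * (t - t₀) := by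
    rw [← intervalIntegral.integral_sub (intervalIntegrable_of_Ioo hdxi hm ht')
      (intervalIntegrable_of_Ioo hfi hm ht')]
    refine intervalIntegral_le_of_ae ht0' ((intervalIntegrable_of_Ioo hdxi hm ht').sub
      (intervalIntegrable_of_Ioo hfi hm ht')) ?_
    filter_upwards [ae_restrict_mem measurableSet_Ioo, ae_restrict_of_ae_restrict_of_subset
      (Set.Ioo_subset_Ioo_right t.2.2) hfB] with s hs hsB
    rw [← inner_sub_right]
    refine (real_inner_le_norm _ _).trans ?_
    have h1 : ‖dx (pointAt s x) - ι z'‖ ≤ η + ‖p₀ - ι z'‖ :=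
      (norm_sub_le_norm_sub_add_norm_sub _ p₀ _).trans (by linarith [(hnear s hs).2])
    have h2 := mul_le_mul hsB h1 (norm_nonneg _) hB0
    nlinarith
  have hJ := hf.integral_A hA hp hpq ht' z'
  rw [pathAt_coe, pathAt_coe, hx.1 _ le_rfl, inner_sub_left] at hJ
  simp only [affineTest, tildePhi_self]
  have hJ' : tildePhi ι A z' t₀ ⟨t, x⟩ = ∫ s in (t₀ : ℝ)..t, A s (toV ι (pathAt x s)) z' := rfl
  rw [hJ']
  nlinarith

end Viscosity

/-! ### Half-relaxed limits -/

section Relaxed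

variable {Y : Type*} [PseudoMetricSpace Y] {S : Set Y} {g : ℕ → Y → ℝ} {y₀ : Y}

lemma eventually_lt_of_upperRelaxed_lt {c : ℝ} (h : upperRelaxed S g y₀ < c) {k : ℕ → ℕ}
    (hk : Tendsto k atTop atTop) {y : ℕ → Y} (hy : Tendsto y atTop (𝓝 y₀)) (hyS : ∀ n, y n ∈ S) :
    ∀ᶠ n in atTop, g (k n) (y n) < c := by
  have h1 := eventually_lt_of_limsup_lt h
  have h2 : Tendsto (fun n => (k n, y n)) atTop (atTop ×ˢ 𝓝[S] y₀) :=
    hk.prodMk (tendsto_nhdsWithin_iff.2 ⟨hy, Eventually.of_forall hyS⟩)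
  filter_upwards [h2.eventually h1] with n hn
  exact_mod_cast hn

lemma exists_seq_of_upperRelaxed {w : ℝ} (h : (w : EReal) = upperRelaxed S g y₀) :
    ∃ (k : ℕ → ℕ) (y : ℕ → Y), Tendsto k atTop atTop ∧ Tendsto y atTop (𝓝 y₀) ∧
      (∀ n, y n ∈ S) ∧ ∀ n : ℕ, w - 1 / ((n : ℝ) + 1) < g (k n) (y n) := by
  have hex : ∀ n : ℕ, ∃ (k : ℕ) (y : Y), n ≤ k ∧ y ∈ S ∧ dist y y₀ < 1 / ((n : ℝ) + 1) ∧
      w - 1 / ((n : ℝ) + 1) < g k y := fun n => by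
    have hpos : (0 : ℝ) < 1 / ((n : ℝ) + 1) := by positivity
    have h1 : ((w - 1 / ((n : ℝ) + 1) : ℝ) : EReal) < upperRelaxed S g y₀ := by
      rw [← h]; exact EReal.coe_lt_coe_iff.2 (by linarith)
    have h2 := frequently_lt_of_lt_limsup (by isBoundedDefault) h1
    have h3 : ∀ᶠ k : ℕ × Y in atTop ×ˢ 𝓝[S] y₀, n ≤ k.1 ∧ k.2 ∈ S ∧
        dist k.2 y₀ < 1 / ((n : ℝ) + 1) :=
      (eventually_ge_atTop n).prod_mk ((eventually_mem_nhdsWithin (a := y₀) (s := S)).and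
        (mem_nhdsWithin_of_mem_nhds (Metric.ball_mem_nhds _ hpos)))
    obtain ⟨⟨k, y⟩, hlt, hk, hy, hd⟩ := (h2.and_eventually h3).exists
    exact ⟨k, y, hk, hy, hd, by exact_mod_cast hlt⟩
  choose k y hk hy hd hlt using hex
  refine ⟨k, y, tendsto_atTop_mono hk tendsto_id, ?_, hy, hlt⟩
  exact tendsto_iff_dist_tendsto_zero.2 (squeeze_zero (fun _ => dist_nonneg) (fun n => (hd n).le)
    tendsto_one_div_add_atTop_nhds_zero_nat)

/-- The uniform bound excludes ±∞; that y₀ lies in S keeps the filter nontrivial, without which the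
upper limit would be ⊥. -/
lemma coe_toReal_upperRelaxed {C : ℝ} (hC : ∀ n, ∀ y ∈ S, |g n y| ≤ C) (hy₀ : y₀ ∈ S) :
    (((upperRelaxed S g y₀).toReal : ℝ) : EReal) = upperRelaxed S g y₀ := by
  have hne : (𝓝[S] y₀).NeBot := mem_closure_iff_nhdsWithin_neBot.1 (subset_closure hy₀)
  have hev : ∀ᶠ k : ℕ × Y in atTop ×ˢ 𝓝[S] y₀, k.2 ∈ S :=
    (eventually_mem_nhdsWithin (a := y₀) (s := S)).prod_inr _
  have h1 : upperRelaxed S g y₀ ≤ (C : EReal) :=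
    limsup_le_of_le (by isBoundedDefault) (hev.mono fun k hk => by
      exact_mod_cast (abs_le.1 (hC k.1 k.2 hk)).2)
  have h2 : ((-C : ℝ) : EReal) ≤ upperRelaxed S g y₀ :=
    le_limsup_of_frequently_le (Eventually.frequently (hev.mono fun k hk => by
      exact_mod_cast (abs_le.1 (hC k.1 k.2 hk)).1)) (by isBoundedDefault)
  refine EReal.coe_toReal ?_ ?_
  · exact (h1.trans_lt (EReal.coe_lt_top C)).ne
  · exact ((EReal.bot_lt_coe _).trans_le h2).ne'

/-- A relative neighbourhood that witnesses a strict upper bound at y serves all nearby points of S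
as well. -/
lemma upperSemicontinuousOn_of_eq_upperRelaxed {w : Y → ℝ}
    (hw : ∀ y ∈ S, ((w y : ℝ) : EReal) = upperRelaxed S g y) : UpperSemicontinuousOn w S := by
  intro y hy c hc
  have h1 : upperRelaxed S g y < (c : EReal) := by rw [← hw y hy]; exact_mod_cast hc
  obtain ⟨c', hc1, hc2⟩ := EReal.lt_iff_exists_real_btwn.1 h1
  have h2 := eventually_lt_of_limsup_lt hc1
  obtain ⟨a, ha, b, hb, hab⟩ := eventually_prod_iff.1 h2
  filter_upwards [eventually_eventually_nhdsWithin.2 hb, self_mem_nhdsWithin] with z hz hzS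
  have h3 : upperRelaxed S g z ≤ (c' : EReal) :=
    limsup_le_of_le (by isBoundedDefault) (eventually_prod_iff.2
      ⟨a, ha, b, hz, fun hx _ hy => (hab hx hy).le⟩)
  rw [← hw z hzS] at h3
  exact_mod_cast h3.trans_lt hc2

end Relaxed

/-! ### Stability of subsolutions -/

section Stability

variable {T : ℝ} [Fact (0 < T)] {V H : Type*} [NormedAddCommGroup V] [NormedSpace ℝ V]
  [NormedAddCommGroup H] [InnerProductSpace ℝ H] {ι : V →L[ℝ] H} {p q : ℝ}
  {A : ℝ → V → StrongDual ℝ V}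
  [TopologicalSpace.SeparableSpace V] [TopologicalSpace.SeparableSpace H]
  [CompleteSpace V] [CompleteSpace H] [TopologicalSpace.SeparableSpace (StrongDual ℝ V)]

lemma continuousOn_affineTest (hι : IsGelfandTriple ι) (hA : HypA T p q A)
    (hp : 2 ≤ p) (hpq : p.HolderConjugate q) {L : ℝ} (hL : 0 ≤ L) (t₁ : Set.Icc (0 : ℝ) T)
    (x₁ : PathSp T H) (κ : ℝ) (z : V) :
    ContinuousOn (affineTest ι A t₁ κ z) (tube ι p q A L t₁ x₁) := by
  have h1 : Continuous fun P : TimePath T H => (P.time : ℝ) :=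
    continuous_subtype_val.comp continuous_time
  have h2 : Continuous fun P : TimePath T H => P.path P.time := continuous_current
  exact ((h1.const_mul κ).add (h2.inner continuous_const)).continuousOn.add
    (continuousOn_tildePhi hι hA hp hpq hL t₁ x₁ z)

lemma tube_subset_tube (hA : HypA T p q A) (hp : 2 ≤ p) (hpq : p.HolderConjugate q) {L : ℝ}
    {t₁ : Set.Icc (0 : ℝ) T} {x₁ : PathSp T H} {P : TimePath T H}
    (hP : P ∈ tube ι p q A L t₁ x₁) :
    tube ι p q A L P.time P.path ⊆ tube ι p q A L t₁ x₁ := fun _ hQ =>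
  ⟨hP.1.trans hQ.1, trajectories_concat hA hp hpq hP.1 hP.2 hQ.2⟩

/-- Moving the base time of `tildePhi` changes the functional on a smaller tube only by a constant,
so one functional can serve all maximizers. -/
lemma affineTest_sub (hA : HypA T p q A) (hp : 2 ≤ p) (hpq : p.HolderConjugate q) {L : ℝ}
    {t₁ : Set.Icc (0 : ℝ) T} {x₁ : PathSp T H} {P Q : TimePath T H}
    (hP : P ∈ tube ι p q A L t₁ x₁) (hQ : Q ∈ tube ι p q A L P.time P.path) (κ : ℝ) (z : V) :
    affineTest ι A t₁ κ z Q - affineTest ι A t₁ κ z P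
      = affineTest ι A P.time κ z Q - affineTest ι A P.time κ z P := by
  have h1 : t₁ ≤ P.time := hP.1
  have h2 : P.time ≤ Q.time := hQ.1
  have hm : (t₁ : ℝ) ∈ Set.Icc (t₁ : ℝ) T := ⟨le_rfl, t₁.2.2⟩
  have hmP : (P.time : ℝ) ∈ Set.Icc (t₁ : ℝ) T := ⟨h1, P.time.2.2⟩
  have hmQ : (Q.time : ℝ) ∈ Set.Icc (t₁ : ℝ) T := ⟨h1.trans h2, Q.time.2.2⟩
  obtain ⟨-, f, hf, -⟩ := (mem_trajectories_iff hA hp hpq).1 (tube_subset_tube hA hp hpq hP hQ).2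
  have hi := (hf.integrable_A hA hp hpq).apply_continuousLinearMap z
  have e1 : tildePhi ι A z t₁ Q - tildePhi ι A z t₁ ⟨P.time, Q.path⟩
      = tildePhi ι A z P.time Q :=
    intervalIntegral.integral_interval_sub_left (intervalIntegrable_of_Ioo hi hm hmQ)
      (intervalIntegrable_of_Ioo hi hm hmP)
  have e2 : tildePhi ι A z t₁ ⟨P.time, Q.path⟩ = tildePhi ι A z t₁ P :=
    tildePhi_congr h1 hQ.2.1
  have e3 : tildePhi ι A z P.time P = 0 := tildePhi_self z P.time P.path
  rw [e2] at e1
  simp only [affineTest]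
  linarith

/-- Maximizers of `u_k - Θ` converge along a subsequence. -/
lemma exists_maximizers (hι : IsGelfandTriple ι) (hA : HypA T p q A)
    (hp : 2 ≤ p) (hpq : p.HolderConjugate q) {L : ℝ} (hL : 0 ≤ L) {t₁ : Set.Icc (0 : ℝ) T}
    {x₁ : PathSp T H} {un : ℕ → TimePath T H → ℝ}
    (husc : ∀ n, UpperSemicontinuousOn (un n) (tube ι p q A L t₁ x₁))
    {t₀ : Set.Icc (0 : ℝ) T} {x₀ : PathSp T H}
    (hP₀ : (⟨t₀, x₀⟩ : TimePath T H) ∈ tube ι p q A L t₁ x₁) {w : ℝ}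
    (hw : (w : EReal) = upperRelaxed (tube ι p q A L t₁ x₁) un ⟨t₀, x₀⟩)
    {T₀ : Set.Icc (0 : ℝ) T} (hT₀ : ∀ᶠ t in 𝓝 t₀, t ≤ T₀) (κ : ℝ) (z : V) :
    ∃ (k : ℕ → ℕ) (Q : ℕ → TimePath T H) (s : Set.Icc (0 : ℝ) T) (y : PathSp T H) (a : ℕ → ℝ),
      Tendsto k atTop atTop ∧ Tendsto Q atTop (𝓝 ⟨s, y⟩) ∧
      Tendsto (fun n => (Q n).path) atTop (𝓝 y) ∧
      (∀ n, Q n ∈ tube ι p q A L t₁ x₁ ∧ (Q n).time ≤ T₀) ∧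
      (⟨s, y⟩ : TimePath T H) ∈ tube ι p q A L t₀ x₀ ∧ s ≤ T₀ ∧
      (∀ n, ∀ P ∈ tube ι p q A L (Q n).time (Q n).path, P.time ≤ T₀ →
        un (k n) P - affineTest ι A t₁ κ z P ≤ un (k n) (Q n) - affineTest ι A t₁ κ z (Q n)) ∧
      Tendsto a atTop (𝓝 (w - affineTest ι A t₁ κ z ⟨t₀, x₀⟩)) ∧
      ∀ n, a n ≤ un (k n) (Q n) - affineTest ι A t₁ κ z (Q n) := by
  obtain ⟨k₀, P, hk₀, hP, hPS, hwP⟩ := exists_seq_of_upperRelaxed hw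
  set Θ := affineTest ι A t₁ κ z
  have hΘ : ContinuousOn Θ (tube ι p q A L t₁ x₁) :=
    continuousOn_affineTest hι hA hp hpq hL t₁ x₁ κ z
  have hPt : Tendsto (fun n => (P n).time) atTop (𝓝 t₀) :=
    (continuous_time.tendsto (⟨t₀, x₀⟩ : TimePath T H)).comp hP
  have hPs : Tendsto (fun n => stopAt (P n).time (P n).path) atTop (𝓝 (stopAt t₀ x₀)) :=
    (continuous_stopped.tendsto (⟨t₀, x₀⟩ : TimePath T H)).comp hP
  obtain ⟨N, hN⟩ := (hPt.eventually hT₀).exists_forall_of_atTop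
  -- The maximum is taken over the tube issuing from the approximating point, not from (t₀, x₀).
  -- That tube is compact up to T₀, and by concatenation it contains the tube of each of its points.
  have hmax : ∀ n, ∃ Q, (Q ∈ tube ι p q A L (P (n + N)).time (P (n + N)).path ∧ Q.time ≤ T₀) ∧
      ∀ R ∈ tube ι p q A L (P (n + N)).time (P (n + N)).path, R.time ≤ T₀ →
        un (k₀ (n + N)) R - Θ R ≤ un (k₀ (n + N)) Q - Θ Q := fun n => by
    have hsub := tube_subset_tube hA hp hpq (hPS (n + N))
    have hself : P (n + N) ∈ tube ι p q A L (P (n + N)).time (P (n + N)).path :=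
      ⟨le_rfl, trajectories_restrict hA hp hpq (hPS (n + N)).1 (hPS (n + N)).2 fun _ _ => rfl⟩
    have hu : UpperSemicontinuousOn (fun R => un (k₀ (n + N)) R - Θ R)
        {R | R ∈ tube ι p q A L (P (n + N)).time (P (n + N)).path ∧ R.time ≤ T₀} := by
      have h1 := (husc (k₀ (n + N))).add (f := un (k₀ (n + N)))
        (continuousOn_neg_iff.2 hΘ).upperSemicontinuousOn
      simp only [sub_eq_add_neg]
      exact h1.mono fun R hR => hsub hR.1
    obtain ⟨Q, hQ, hQmax⟩ := hu.exists_isMaxOn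
      (show Set.Nonempty {R | R ∈ tube ι p q A L (P (n + N)).time (P (n + N)).path ∧ R.time ≤ T₀}
        from ⟨P (n + N), hself, hN _ (by omega)⟩)
      (isCompact_tube_le hι hA hp hpq hL (P (n + N)).time T₀ (P (n + N)).path)
    exact ⟨Q, hQ, fun R hR hRT => hQmax ⟨hR, hRT⟩⟩
  choose Q₀ hQ₀ hQ₀max using hmax
  have hQ₀S : ∀ n, Q₀ n ∈ tube ι p q A L t₁ x₁ := fun n =>
    tube_subset_tube hA hp hpq (hPS (n + N)) (hQ₀ n).1
  obtain ⟨y, hy, φ₁, hφ₁, hlim⟩ := (isCompact_trajectories hι hA hp hpq hL t₁ x₁).tendsto_subseq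
    (fun n => (hQ₀S n).2)
  obtain ⟨s, -, φ₂, hφ₂, hs⟩ := isCompact_univ.tendsto_subseq
    (x := fun n => (Q₀ (φ₁ n)).time) fun _ => Set.mem_univ _
  set φ := fun n => φ₁ (φ₂ n)
  have hφ : StrictMono φ := hφ₁.comp hφ₂
  have hφN : Tendsto (fun n => φ n + N) atTop atTop :=
    (tendsto_add_atTop_nat N).comp hφ.tendsto_atTop
  have hpath : Tendsto (fun n => (Q₀ (φ n)).path) atTop (𝓝 y) := hlim.comp hφ₂.tendsto_atTop
  have hPQ : ∀ n, stopAt (P (n + N)).time (Q₀ n).path = stopAt (P (n + N)).time (P (n + N)).path :=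
    fun n => stopAt_congr (hQ₀ n).1.2.1
  -- Each maximizer extends the path of its starting point, so in the limit y extends x₀ beyond t₀;
  -- afterwards the two may differ.
  have hyx₀ : stopAt t₀ y = stopAt t₀ x₀ := by
    refine tendsto_nhds_unique (f := fun n => stopAt (P (φ n + N)).time (Q₀ (φ n)).path) (l := atTop) ?_ ?_
    · exact (continuous_stopAt.tendsto (t₀, y)).comp ((hPt.comp hφN).prodMk_nhds hpath)
    · simp only [hPQ]
      exact hPs.comp hφN
  refine ⟨fun n => k₀ (φ n + N), fun n => Q₀ (φ n), s, y,
    fun n => w - 1 / (((φ n + N : ℕ) : ℝ) + 1) - Θ (P (φ n + N)), hk₀.comp hφN, ?_, hpath,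
    fun n => ⟨hQ₀S _, (hQ₀ _).2⟩, ⟨?_, ?_⟩, ?_, fun n R hR hRT => ?_, ?_, fun n => ?_⟩
  · exact (continuous_timePath_mk.tendsto (s, y)).comp (hs.prodMk_nhds hpath)
  · exact le_of_tendsto_of_tendsto (hPt.comp hφN) hs (Eventually.of_forall fun n => (hQ₀ (φ n)).1.1)
  · exact trajectories_restrict hA hp hpq hP₀.1 hy fun r hr => eq_of_stopAt_eq hyx₀ hr
  · exact le_of_tendsto hs (Eventually.of_forall fun n => (hQ₀ (φ n)).2)
  · exact hQ₀max _ R (tube_subset_tube hA hp hpq (hQ₀ (φ n)).1 hR) hRT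
  · have h1 : Tendsto (fun n => Θ (P (φ n + N))) atTop (𝓝 (Θ ⟨t₀, x₀⟩)) :=
      (hΘ _ hP₀).tendsto.comp (tendsto_nhdsWithin_iff.2
        ⟨hP.comp hφN, Eventually.of_forall fun n => hPS _⟩)
    have h2 : Tendsto (fun n => 1 / (((φ n + N : ℕ) : ℝ) + 1)) atTop (𝓝 0) :=
      tendsto_one_div_add_atTop_nhds_zero_nat.comp hφN
    simpa using (h2.const_sub w).sub h1
  · have h1 := hQ₀max (φ n) (P (φ n + N)) ⟨le_rfl, trajectories_restrict hA hp hpq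
      (hPS (φ n + N)).1 (hPS (φ n + N)).2 fun _ _ => rfl⟩ (hN _ (by omega))
    have h2 := hwP (φ n + N)
    show w - 1 / (((φ n + N : ℕ) : ℝ) + 1) - Θ (P (φ n + N)) ≤ _
    linarith

end Stability

lemma le_of_tendsto_of_upperRelaxed {Y : Type*} [PseudoMetricSpace Y] {S : Set Y}
    {g : ℕ → Y → ℝ} {y₀ : Y} {w : ℝ} (hw : (w : EReal) = upperRelaxed S g y₀) (hy₀ : y₀ ∈ S)
    {k : ℕ → ℕ} (hk : Tendsto k atTop atTop) {y : ℕ → Y} (hy : Tendsto y atTop (𝓝 y₀))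
    (hyS : ∀ n, y n ∈ S) {θ : Y → ℝ} (hθ : ContinuousOn θ S) {a : ℕ → ℝ} {ℓ : ℝ}
    (ha : Tendsto a atTop (𝓝 ℓ)) (hle : ∀ n, a n ≤ g (k n) (y n) - θ (y n)) : ℓ ≤ w - θ y₀ := by
  refine le_of_forall_pos_le_add fun ε hε => ?_
  have h1 : upperRelaxed S g y₀ < ((w + ε : ℝ) : EReal) := by
    rw [← hw]; exact EReal.coe_lt_coe_iff.2 (by linarith)
  have h2 : Tendsto (fun n => w + ε - θ (y n)) atTop (𝓝 (w + ε - θ y₀)) :=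
    ((hθ y₀ hy₀).tendsto.comp (tendsto_nhdsWithin_iff.2 ⟨hy, Eventually.of_forall hyS⟩)).const_sub _
  have h3 := le_of_tendsto_of_tendsto ha h2 (by
    filter_upwards [eventually_lt_of_upperRelaxed_lt h1 hk hy hyS] with n hn
    linarith [hle n])
  linarith

section Stability

variable {T : ℝ} [Fact (0 < T)] {V H : Type*} [NormedAddCommGroup V] [NormedSpace ℝ V]
  [NormedAddCommGroup H] [InnerProductSpace ℝ H] {ι : V →L[ℝ] H} {p q : ℝ}
  {A : ℝ → V → StrongDual ℝ V}

lemma coe_finalTime : ((finalTime : Set.Icc (0 : ℝ) T) : ℝ) = T :=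
  coe_clampTime_of_mem ⟨(Fact.out : 0 < T).le, le_rfl⟩

lemma le_finalTime (t : Set.Icc (0 : ℝ) T) : t ≤ finalTime := by
  show (t : ℝ) ≤ (finalTime : Set.Icc (0 : ℝ) T)
  rw [coe_finalTime]; exact t.2.2

lemma inseparable_of_eqOn {t : Set.Icc (0 : ℝ) T} {x y : PathSp T H} (h : ∀ s ≤ t, x s = y s) :
    Inseparable (⟨t, x⟩ : TimePath T H) ⟨t, y⟩ := by
  rw [Metric.inseparable_iff]
  show |(t : ℝ) - t| + ‖stopAt t x - stopAt t y‖ = 0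
  rw [stopAt_congr h]; simp

variable [TopologicalSpace.SeparableSpace V] [TopologicalSpace.SeparableSpace H]
  [CompleteSpace V] [CompleteSpace H] [TopologicalSpace.SeparableSpace (StrongDual ℝ V)]

lemma affine_inequality_of_maximizer (hι : IsGelfandTriple ι) (hA : HypA T p q A)
    (hp : 2 ≤ p) (hpq : p.HolderConjugate q) {L : ℝ} {t₁ : Set.Icc (0 : ℝ) T}
    {x₁ : PathSp T H} {u : TimePath T H → ℝ} {F : TimePath T H × H → ℝ}
    (hsub : ∀ (t₀ : Set.Icc (0 : ℝ) T) (x₀ : PathSp T H), (t₀ : ℝ) < T →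
      SubInequalityAt ι p q A L F u t₀ x₀)
    {Q : TimePath T H} (hQ : Q ∈ tube ι p q A L t₁ x₁) {T₀ : Set.Icc (0 : ℝ) T}
    (hT₀ : Q.time < T₀) {κ : ℝ} {z : V}
    (hmax : ∀ P ∈ tube ι p q A L Q.time Q.path, P.time ≤ T₀ →
      u P - affineTest ι A t₁ κ z P ≤ u Q - affineTest ι A t₁ κ z Q) :
    0 ≤ κ + F (Q, ι z) := by
  have hlt : (Q.time : ℝ) < T := lt_of_lt_of_le (show (Q.time : ℝ) < T₀ from hT₀) T₀.2.2
  refine (hsub Q.time Q.path hlt).affine hι.injective hpq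
    (trajectories_restrict hA hp hpq hQ.1 hQ.2 fun _ _ => rfl) hT₀ fun P hP hPT => ?_
  have h1 := hmax P hP hPT
  have h2 := affineTest_sub hA hp hpq hQ hP κ z
  show u P - affineTest ι A Q.time κ z P ≤ u Q - affineTest ι A Q.time κ z Q
  linarith

lemma eventually_hamiltonian_lt {L : ℝ} {t₁ : Set.Icc (0 : ℝ) T}
    {x₁ : PathSp T H} {Fn : ℕ → TimePath T H × H → ℝ} {F : TimePath T H × H → ℝ}
    {P : TimePath T H} {v : H}
    (hF : upperRelaxed (tube ι p q A L t₁ x₁ ×ˢ Set.univ) Fn (P, v) ≤ ((F (P, v) : ℝ) : EReal))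
    {c : ℝ} (hc : F (P, v) < c) {k : ℕ → ℕ} (hk : Tendsto k atTop atTop) {Q : ℕ → TimePath T H}
    (hQ : Tendsto Q atTop (𝓝 P)) (hQS : ∀ n, Q n ∈ tube ι p q A L t₁ x₁) :
    ∀ᶠ n in atTop, Fn (k n) (Q n, v) < c :=
  eventually_lt_of_upperRelaxed_lt (y := fun n => (Q n, v))
    (hF.trans_lt (EReal.coe_lt_coe_iff.2 hc)) hk
    (hQ.prodMk_nhds tendsto_const_nhds) fun n => ⟨hQS n, Set.mem_univ _⟩

/-- Maximizers for the slope κ + ε converge to the contact point, where the inequalities for `Fn`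
pass to the limit. The surplus ε both localizes in time and leaves the strict inequality that is
contradicted. -/
lemma stability_interior (hι : IsGelfandTriple ι) (hA : HypA T p q A)
    (hp : 2 ≤ p) (hpq : p.HolderConjugate q) {L : ℝ} (hL : 0 ≤ L) {t₁ : Set.Icc (0 : ℝ) T}
    {x₁ : PathSp T H} {un : ℕ → TimePath T H → ℝ}
    (husc : ∀ n, UpperSemicontinuousOn (un n) (tube ι p q A L t₁ x₁))
    {Fn : ℕ → TimePath T H × H → ℝ} {F : TimePath T H × H → ℝ} (hFc : Continuous F)
    (hsub : ∀ n (t₀ : Set.Icc (0 : ℝ) T) (x₀ : PathSp T H), (t₀ : ℝ) < T →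
      SubInequalityAt ι p q A L (Fn n) (un n) t₀ x₀)
    (hF : ∀ P ∈ tube ι p q A L t₁ x₁, ∀ v : H,
      upperRelaxed (tube ι p q A L t₁ x₁ ×ˢ Set.univ) Fn (P, v) ≤ ((F (P, v) : ℝ) : EReal))
    {w : TimePath T H → ℝ} (hw : ∀ P ∈ tube ι p q A L t₁ x₁,
      ((w P : ℝ) : EReal) = upperRelaxed (tube ι p q A L t₁ x₁) un P)
    {t₀ : Set.Icc (0 : ℝ) T} {x₀ : PathSp T H} (h0T : (t₀ : ℝ) < T)
    (hP₀ : (⟨t₀, x₀⟩ : TimePath T H) ∈ tube ι p q A L t₁ x₁) :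
    SubInequalityAt ι p q A L F w t₀ x₀ := by
  refine subInequalityAt_of_affine hι hA hp hpq hL hFc h0T fun κ z T₀ hT₀ hmax => ?_
  by_contra hcon
  rw [not_le] at hcon
  obtain ⟨ε, hε, hε'⟩ : ∃ ε > 0, κ + ε + F (⟨t₀, x₀⟩, ι z) < 0 :=
    ⟨-(κ + F (⟨t₀, x₀⟩, ι z)) / 2, by linarith, by linarith⟩
  obtain ⟨k, Q, s, y, a, hk, hQ, -, hQS, hsy, hsT, hQmax, ha, hle⟩ := exists_maximizers hι hA hp hpq
    hL husc hP₀ (hw _ hP₀) ((eventually_lt_nhds hT₀).mono fun _ h => h.le) (κ + ε) z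
  have hsyS := tube_subset_tube hA hp hpq hP₀ hsy
  have h1 := le_of_tendsto_of_upperRelaxed (hw _ hsyS) hsyS hk hQ (fun n => (hQS n).1)
    (continuousOn_affineTest hι hA hp hpq hL t₁ x₁ (κ + ε) z) ha hle
  have h2 := hmax _ hsy hsT
  have h3 := affineTest_sub hA hp hpq hP₀ hsy (κ + ε) z
  -- The limit (s, y) does at least as well as (t₀, x₀) for slope κ + ε and no better for slope κ,
  -- whence ε(s - t₀) ≤ 0.
  have hst : s = t₀ := by
    refine le_antisymm (show (s : ℝ) ≤ t₀ from ?_) hsy.1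
    simp only [affineTest] at h1 h2 h3
    nlinarith
  subst hst
  -- The limiting path may differ from x₀ after t₀, but d_∞ does not see this, so the maximizers
  -- also converge to (t₀, x₀).
  rw [(inseparable_of_eqOn hsy.2.1).nhds_eq] at hQ
  have h4 : ∀ᶠ n in atTop, (Q n).time < T₀ :=
    ((continuous_time.tendsto (⟨s, x₀⟩ : TimePath T H)).comp hQ).eventually_lt_const hT₀
  obtain ⟨n, hn, hn'⟩ := (h4.and (eventually_hamiltonian_lt (hF _ hP₀ (ι z))
    (c := -(κ + ε)) (by linarith) hk hQ fun n => (hQS n).1)).exists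
  have h5 := affine_inequality_of_maximizer hι hA hp hpq (hsub (k n)) (hQS n).1 hn (hQmax n)
  linarith

/-- With z = 0 and the slope -F - 1 a maximizer before the final time would violate the subsolution
inequality of `un`. Hence maximizers eventually sit at T, where `un` lies below `hn`. Uniform
convergence of the full paths is needed because `hn` is relaxed in the supremum norm. -/
lemma stability_terminal (hι : IsGelfandTriple ι) (hA : HypA T p q A)
    (hp : 2 ≤ p) (hpq : p.HolderConjugate q) {L : ℝ} (hL : 0 ≤ L) {t₁ : Set.Icc (0 : ℝ) T}
    {x₁ : PathSp T H} {un : ℕ → TimePath T H → ℝ}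
    (husc : ∀ n, UpperSemicontinuousOn (un n) (tube ι p q A L t₁ x₁))
    {Fn : ℕ → TimePath T H × H → ℝ} {F : TimePath T H × H → ℝ}
    (hsub : ∀ n (t₀ : Set.Icc (0 : ℝ) T) (x₀ : PathSp T H), (t₀ : ℝ) < T →
      SubInequalityAt ι p q A L (Fn n) (un n) t₀ x₀)
    (hF : ∀ P ∈ tube ι p q A L t₁ x₁, ∀ v : H,
      upperRelaxed (tube ι p q A L t₁ x₁ ×ˢ Set.univ) Fn (P, v) ≤ ((F (P, v) : ℝ) : EReal))
    {hn : ℕ → PathSp T H → ℝ} {h : PathSp T H → ℝ} (hterm : ∀ n x, un n ⟨finalTime, x⟩ ≤ hn n x)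
    {x : PathSp T H} (hx : x ∈ trajectories ι p q A L t₁ x₁)
    (hh : upperRelaxed (trajectories ι p q A L t₁ x₁) hn x ≤ ((h x : ℝ) : EReal))
    {w : ℝ} (hw : (w : EReal) = upperRelaxed (tube ι p q A L t₁ x₁) un ⟨finalTime, x⟩) :
    w ≤ h x := by
  by_contra! hcon
  have hP₀ : (⟨finalTime, x⟩ : TimePath T H) ∈ tube ι p q A L t₁ x₁ := ⟨le_finalTime t₁, hx⟩
  obtain ⟨k, Q, s, y, a, hk, hQ, hpath, hQS, hsy, -, hQmax, ha, hle⟩ := exists_maximizers hι hA hp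
    hpq hL husc hP₀ hw (Eventually.of_forall le_finalTime) (-F (⟨finalTime, x⟩, ι 0) - 1) 0
  obtain rfl : s = finalTime := le_antisymm (le_finalTime s) hsy.1
  obtain rfl : y = x := by ext t; exact hsy.2.1 t (le_finalTime t)
  have h1 := eventually_hamiltonian_lt (hF _ hP₀ (ι 0)) (c := F (⟨finalTime, y⟩, ι 0) + 1)
    (by linarith) hk hQ fun n => (hQS n).1
  have h2 : ∀ᶠ n in atTop, hn (k n) (Q n).path < (h y + w) / 2 :=
    eventually_lt_of_upperRelaxed_lt (hh.trans_lt (EReal.coe_lt_coe_iff.2 (by linarith))) hk hpath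
      fun n => (hQS n).1.2
  have hθ := (continuousOn_affineTest hι hA hp hpq hL t₁ x₁ (-F (⟨finalTime, y⟩, ι 0) - 1) 0 _
    hP₀).tendsto.comp (tendsto_nhdsWithin_iff.2 ⟨hQ, Eventually.of_forall fun n => (hQS n).1⟩)
  have h3 := le_of_tendsto_of_tendsto ha (hθ.const_sub ((h y + w) / 2)) (by
    filter_upwards [h1, h2] with n hn1 hn2
    have hfin : (Q n).time = finalTime := by
      by_contra hne
      have := affine_inequality_of_maximizer hι hA hp hpq (hsub (k n)) (hQS n).1
        (lt_of_le_of_ne (le_finalTime _) hne) (hQmax n)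
      linarith
    have h4 : un (k n) (Q n) ≤ hn (k n) (Q n).path := by
      have := hterm (k n) (Q n).path
      rwa [← hfin] at this
    have h5 := hle n
    simp only [Function.comp_apply]
    linarith)
  linarith

/-- Stability of viscosity subsolutions under upper half-relaxed limits. -/
theorem exists_isViscositySubOn_upperRelaxed (hι : IsGelfandTriple ι) (hA : HypA T p q A)
    (hp : 2 ≤ p) (hpq : p.HolderConjugate q) {L : ℝ} (hL : 0 ≤ L) {t₁ : Set.Icc (0 : ℝ) T}
    {x₁ : PathSp T H} (h1T : (t₁ : ℝ) < T) {un : ℕ → TimePath T H → ℝ}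
    {Fn : ℕ → TimePath T H × H → ℝ} {F : TimePath T H × H → ℝ} (hFc : Continuous F)
    {hn : ℕ → PathSp T H → ℝ} {h : PathSp T H → ℝ}
    (hsub : ∀ n, IsViscositySub ι p q A L (Fn n) (hn n) (un n))
    (hF : ∀ P ∈ tube ι p q A L t₁ x₁, ∀ v : H,
      upperRelaxed (tube ι p q A L t₁ x₁ ×ˢ Set.univ) Fn (P, v) ≤ ((F (P, v) : ℝ) : EReal))
    (hh : ∀ x ∈ trajectories ι p q A L t₁ x₁,
      upperRelaxed (trajectories ι p q A L t₁ x₁) hn x ≤ ((h x : ℝ) : EReal))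
    {C : ℝ} (hC : ∀ n, ∀ P ∈ tube ι p q A L t₁ x₁, |un n P| ≤ C) :
    ∃ w : TimePath T H → ℝ, (∀ P ∈ tube ι p q A L t₁ x₁,
      ((w P : ℝ) : EReal) = upperRelaxed (tube ι p q A L t₁ x₁) un P) ∧
      IsViscositySubOn ι p q A L F h t₁ x₁ w := by
  have hw : ∀ P ∈ tube ι p q A L t₁ x₁,
      (((upperRelaxed (tube ι p q A L t₁ x₁) un P).toReal : ℝ) : EReal)
        = upperRelaxed (tube ι p q A L t₁ x₁) un P := fun P hP => coe_toReal_upperRelaxed hC hP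
  have husc := fun n => (hsub n).semicont t₁ x₁ L h1T hL
  refine ⟨fun P => (upperRelaxed (tube ι p q A L t₁ x₁) un P).toReal, hw, ?_, ?_, ?_⟩
  · exact upperSemicontinuousOn_of_eq_upperRelaxed hw
  · exact fun x hx => stability_terminal hι hA hp hpq hL husc (fun n => (hsub n).interior) hF
      (fun n => (hsub n).terminal) hx (hh x hx) (hw _ ⟨le_finalTime t₁, hx⟩)
  · exact fun t₀ h10 h0T x₀ hx₀ => stability_interior hι hA hp hpq hL husc hFc
      (fun n => (hsub n).interior) hF hw h0T ⟨h10, hx₀⟩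

end Stability

/-! ### Supersolutions by reflection -/

lemma ereal_neg_iInf₂ {α : Type*} (X : Set α) (f : α → EReal) :
    -(⨅ x ∈ X, f x) = ⨆ x ∈ X, -f x := by
  refine le_antisymm (EReal.neg_le.1 (le_iInf₂ fun x hx => EReal.neg_le.1 ?_))
    (iSup₂_le fun x hx => EReal.neg_le_neg_iff.2 (iInf₂_le x hx))
  exact le_iSup₂ (f := fun x (_ : x ∈ X) => -f x) x hx

/-- Negation does not distribute over ⊤ + ⊥ in the extended reals; with `a` and `b` real such sums
do not occur, but the infinite values of `l` are treated separately. -/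
lemma zero_le_add_neg_add {a b : ℝ} {l : EReal}
    (h : ((a : ℝ) : EReal) + l + ((b : ℝ) : EReal) ≤ 0) :
    (0 : EReal) ≤ ((-a : ℝ) : EReal) + -l + ((-b : ℝ) : EReal) := by
  induction l with
  | bot => simp
  | top => simp at h
  | coe l => norm_cast at h ⊢; linarith

lemma add_neg_add_le_zero {a b : ℝ} {l : EReal}
    (h : (0 : EReal) ≤ ((a : ℝ) : EReal) + l + ((b : ℝ) : EReal)) :
    ((-a : ℝ) : EReal) + -l + ((-b : ℝ) : EReal) ≤ 0 := by
  induction l with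
  | bot => simp at h
  | top => simp
  | coe l => norm_cast at h ⊢; linarith

lemma upperRelaxed_neg {Y : Type*} [TopologicalSpace Y] (S : Set Y) (g : ℕ → Y → ℝ) (y₀ : Y) :
    upperRelaxed S (fun n y => -g n y) y₀ = -lowerRelaxed S g y₀ := by
  rw [upperRelaxed, lowerRelaxed, ← EReal.limsup_neg]
  rfl

/-- The Hamiltonian `-F(t, x, -v)` of the reflected equation. -/
def reflect {Y H : Type*} [Neg H] (F : Y × H → ℝ) (P : Y × H) : ℝ := -F (P.1, -P.2)

lemma reflect_reflect {Y H : Type*} [InvolutiveNeg H] (F : Y × H → ℝ) :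
    reflect (reflect F) = F := by
  ext P; simp [reflect]

/-- The homeomorphism v ↦ -v carries the defining filter at (y, v) to the one at (y, -v). -/
lemma upperRelaxed_reflect {Y H : Type*} [TopologicalSpace Y] [NormedAddCommGroup H] (S : Set Y)
    (F : ℕ → Y × H → ℝ) (y : Y) (v : H) :
    upperRelaxed (S ×ˢ Set.univ) (fun n => reflect (F n)) (y, v)
      = -lowerRelaxed (S ×ˢ Set.univ) F (y, -v) := by
  rw [← upperRelaxed_neg]
  have h1 : 𝓝[S ×ˢ Set.univ] (y, -v)
      = map (Prod.map id (fun h : H => -h)) (𝓝[S ×ˢ Set.univ] (y, v)) := by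
    simp only [nhdsWithin_prod_eq, nhdsWithin_univ, ← Filter.prod_map_map_eq', map_id]
    congr 1
    exact ((Homeomorph.neg H).map_nhds_eq v).symm
  rw [upperRelaxed, upperRelaxed, h1]
  have h2 : (atTop : Filter ℕ) ×ˢ map (Prod.map id fun h : H => -h) (𝓝[S ×ˢ Set.univ] (y, v))
      = map (Prod.map id (Prod.map id fun h : H => -h))
        ((atTop : Filter ℕ) ×ˢ 𝓝[S ×ˢ Set.univ] (y, v)) := by
    rw [← Filter.prod_map_map_eq', map_id]
  rw [h2, ← Filter.limsup_comp]
  rfl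

section Reflection

variable {T : ℝ} [Fact (0 < T)] {V H : Type*} [NormedAddCommGroup V] [NormedSpace ℝ V]
  [NormedAddCommGroup H] [InnerProductSpace ℝ H] {ι : V →L[ℝ] H} {p q : ℝ}
  {A : ℝ → V → StrongDual ℝ V}

lemma toV_neg (hinj : Function.Injective ι) {h : H} (hh : h ∈ Set.range ι) :
    toV ι (-h) = -toV ι h := by
  obtain ⟨v, rfl⟩ := hh
  rw [← map_neg, toV_apply hinj, toV_apply hinj]

lemma IsC11V.neg (hinj : Function.Injective ι) {t₁ : Set.Icc (0 : ℝ) T}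
    {φ dt : TimePath T H → ℝ} {dx : TimePath T H → H} (h : IsC11V ι p q t₁ φ dt dx) :
    IsC11V ι p q t₁ (fun P => -φ P) (fun P => -dt P) (fun P => -dx P) where
  cont := h.cont.neg
  cont_dt := h.cont_dt.neg
  cont_dx := h.cont_dx.neg
  mem_range x hx := (h.mem_range x hx).mono fun t ⟨v, hv⟩ => ⟨-v, by rw [map_neg, hv]⟩
  chain_rule := by
    intro t₀ h10 h0T x₀ x x' hx hW
    obtain ⟨hr, hi, he⟩ := h.chain_rule t₀ h10 h0T x₀ x x' hx hW
    have hae : ∀ᵐ s ∂(volume.restrict (Set.Icc (t₀ : ℝ) T)),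
        -(dt (pointAt s x) + x' s (toV ι (dx (pointAt s x))))
          = -dt (pointAt s x) + x' s (toV ι (-dx (pointAt s x))) :=
      hr.mono fun s hs => by rw [toV_neg hinj hs, map_neg]; ring
    refine ⟨hr.mono fun t ⟨v, hv⟩ => ⟨-v, by rw [map_neg, hv]⟩, hi.neg.congr hae, fun t ht => ?_⟩
    have e : ∫ s in (t₀ : ℝ)..t, (-dt (pointAt s x) + x' s (toV ι (-dx (pointAt s x))))
        = ∫ s in (t₀ : ℝ)..t, -(dt (pointAt s x) + x' s (toV ι (dx (pointAt s x)))) := by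
      refine intervalIntegral.integral_congr_ae ?_
      have h2 := (ae_restrict_iff' measurableSet_Icc).1 hae
      filter_upwards [h2] with s hs hst
      rw [Set.uIoc_of_le (show (t₀ : ℝ) ≤ t from ht)] at hst
      exact (hs ⟨hst.1.le, hst.2.trans t.2.2⟩).symm
    rw [e, intervalIntegral.integral_neg, ← he t ht]
    ring

lemma tildePhi_neg (z : V) (t₀ : Set.Icc (0 : ℝ) T) (P : TimePath T H) :
    tildePhi ι A (-z) t₀ P = -tildePhi ι A z t₀ P := by
  simp only [tildePhi, map_neg, intervalIntegral.integral_neg]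

lemma TouchesAbove.neg {L : ℝ} {u : TimePath T H → ℝ} {t₀ : Set.Icc (0 : ℝ) T} {x₀ : PathSp T H}
    {φ : TimePath T H → ℝ} {z : V}
    (h : TouchesAbove ι p q A L (fun P => -u P) t₀ x₀ φ z) :
    TouchesBelow ι p q A L u t₀ x₀ (fun P => -φ P) (-z) := by
  obtain ⟨T₀, hT₀, h0, hlb, hgt⟩ := h
  refine ⟨T₀, hT₀, by rw [tildePhi_neg]; linarith, ?_, fun b hb => ?_⟩
  · rintro _ ⟨P, hP, rfl⟩
    have := hlb ⟨P, hP, rfl⟩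
    simp only [tildePhi_neg] at this ⊢
    linarith
  · have : -b ≤ 0 := hgt (by
      rintro _ ⟨P, hP, rfl⟩
      have := hb ⟨P, hP, rfl⟩
      simp only [tildePhi_neg] at this ⊢
      linarith)
    linarith

lemma TouchesBelow.neg {L : ℝ} {u : TimePath T H → ℝ} {t₀ : Set.Icc (0 : ℝ) T} {x₀ : PathSp T H}
    {φ : TimePath T H → ℝ} {z : V} (h : TouchesBelow ι p q A L (fun P => -u P) t₀ x₀ φ z) :
    TouchesAbove ι p q A L u t₀ x₀ (fun P => -φ P) (-z) := by
  obtain ⟨T₀, hT₀, h0, hlb, hgt⟩ := h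
  refine ⟨T₀, hT₀, by rw [tildePhi_neg]; linarith, ?_, fun b hb => ?_⟩
  · rintro _ ⟨P, hP, rfl⟩
    have := hlb ⟨P, hP, rfl⟩
    simp only [tildePhi_neg] at this ⊢
    linarith
  · have : 0 ≤ -b := hgt (by
      rintro _ ⟨P, hP, rfl⟩
      have := hb ⟨P, hP, rfl⟩
      simp only [tildePhi_neg] at this ⊢
      linarith)
    linarith

/-- `toV` is odd only on the range of ι. The derivative ∂_x φ is known to lie there almost
everywhere on [t₀, T], hence the restriction on δ. -/
lemma meanTerm_neg (hinj : Function.Injective ι) {L : ℝ} {t₀ : Set.Icc (0 : ℝ) T}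
    {φ dt : TimePath T H → ℝ} {dx : TimePath T H → H} (h : IsC11V ι p q t₀ φ dt dx)
    {x₀ x : PathSp T H} (hx : x ∈ trajectories ι p q A L t₀ x₀) (z : V) {δ : ℝ} (hδ : 0 < δ)
    (hδT : t₀ + δ ≤ T) :
    meanTerm ι A (-z) (fun P => -dx P) t₀ x δ = -meanTerm ι A z dx t₀ x δ := by
  obtain ⟨-, x', f, hW, -⟩ := hx
  have hr := h.mem_range x (by rw [← restrict_Ioo_eq_restrict_Icc]; exact hW.mem_range)
  rw [meanTerm, meanTerm, ← mul_neg, ← intervalIntegral.integral_neg]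
  congr 1
  refine intervalIntegral.integral_congr_ae ?_
  filter_upwards [(ae_restrict_iff' measurableSet_Icc).1 hr] with s hs hst
  rw [Set.uIoc_of_le (by linarith)] at hst
  rw [toV_neg hinj (hs ⟨hst.1.le, hst.2.trans hδT⟩), map_neg, map_neg]
  ring

lemma limsup_meanTerm_eq (hinj : Function.Injective ι) {L : ℝ} {t₀ : Set.Icc (0 : ℝ) T}
    (h0T : (t₀ : ℝ) < T) {φ dt : TimePath T H → ℝ} {dx : TimePath T H → H}
    (h : IsC11V ι p q t₀ φ dt dx) (x₀ : PathSp T H) (z : V) :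
    limsup (fun δ : ℝ => ⨆ x ∈ trajectories ι p q A L t₀ x₀,
        ((meanTerm ι A z dx t₀ x δ : ℝ) : EReal)) (𝓝[>] (0 : ℝ))
      = -liminf (fun δ : ℝ => ⨅ x ∈ trajectories ι p q A L t₀ x₀,
        ((meanTerm ι A (-z) (fun P => -dx P) t₀ x δ : ℝ) : EReal)) (𝓝[>] (0 : ℝ)) := by
  rw [← EReal.limsup_neg]
  refine limsup_congr ?_
  -- The mean terms agree only while t₀ + δ stays below T, which suffices for the limit.
  filter_upwards [Ioo_mem_nhdsGT (sub_pos.2 h0T)] with δ hδ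
  rw [Pi.neg_apply, ereal_neg_iInf₂]
  refine iSup_congr fun x => iSup_congr fun hx => ?_
  rw [meanTerm_neg hinj h hx z hδ.1 (by linarith [hδ.2]), EReal.coe_neg, neg_neg]

lemma SuperInequalityAt.neg (hinj : Function.Injective ι) {L : ℝ} {F : TimePath T H × H → ℝ}
    {u : TimePath T H → ℝ} {t₀ : Set.Icc (0 : ℝ) T} {x₀ : PathSp T H} (h0T : (t₀ : ℝ) < T)
    (h : SuperInequalityAt ι p q A L F u t₀ x₀) :
    SubInequalityAt ι p q A L (reflect F) (fun P => -u P) t₀ x₀ := by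
  intro φ dt dx z hφ ht
  have h1 := zero_le_add_neg_add (h _ _ _ _ (hφ.neg hinj) ht.neg)
  rw [limsup_meanTerm_eq hinj h0T hφ]
  simpa only [neg_neg, reflect] using h1

lemma SubInequalityAt.neg (hinj : Function.Injective ι) {L : ℝ} {F : TimePath T H × H → ℝ}
    {u : TimePath T H → ℝ} {t₀ : Set.Icc (0 : ℝ) T} {x₀ : PathSp T H} (h0T : (t₀ : ℝ) < T)
    (h : SubInequalityAt ι p q A L F u t₀ x₀) :
    SuperInequalityAt ι p q A L (reflect F) (fun P => -u P) t₀ x₀ := by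
  intro φ dt dx z hφ ht
  have h1 := add_neg_add_le_zero (h _ _ _ _ (hφ.neg hinj) ht.neg)
  rw [limsup_meanTerm_eq hinj h0T (hφ.neg hinj)] at h1
  simpa only [neg_neg, reflect] using h1

lemma IsViscositySuper.neg (hinj : Function.Injective ι) {L : ℝ} {F : TimePath T H × H → ℝ}
    {h : PathSp T H → ℝ} {u : TimePath T H → ℝ} (hu : IsViscositySuper ι p q A L F h u) :
    IsViscositySub ι p q A L (reflect F) (fun x => -h x) (fun P => -u P) where
  semicont t₁ x₁ L₁ h1 hL P hP c hc := by
    filter_upwards [hu.semicont t₁ x₁ L₁ h1 hL P hP (-c) (by linarith)] with R hR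
    linarith
  terminal x := neg_le_neg (hu.terminal x)
  interior t₀ x₀ h0T := (hu.interior t₀ x₀ h0T).neg hinj h0T

lemma IsViscositySubOn.neg (hinj : Function.Injective ι) {L : ℝ} {F : TimePath T H × H → ℝ}
    {h : PathSp T H → ℝ} {t₁ : Set.Icc (0 : ℝ) T} {x₁ : PathSp T H} {u : TimePath T H → ℝ}
    (hu : IsViscositySubOn ι p q A L F h t₁ x₁ u) :
    IsViscositySuperOn ι p q A L (reflect F) (fun x => -h x) t₁ x₁ (fun P => -u P) where
  semicont P hP c hc := by
    filter_upwards [hu.semicont P hP (-c) (by linarith)] with R hR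
    linarith
  terminal x hx := neg_le_neg (hu.terminal x hx)
  interior t₀ h10 h0T x₀ hx₀ := (hu.interior t₀ h10 h0T x₀ hx₀).neg hinj h0T

variable [TopologicalSpace.SeparableSpace V] [TopologicalSpace.SeparableSpace H]
  [CompleteSpace V] [CompleteSpace H] [TopologicalSpace.SeparableSpace (StrongDual ℝ V)]

/-- Stability of viscosity supersolutions under lower half-relaxed limits. -/
theorem exists_isViscositySuperOn_lowerRelaxed (hι : IsGelfandTriple ι) (hA : HypA T p q A)
    (hp : 2 ≤ p) (hpq : p.HolderConjugate q) {L : ℝ} (hL : 0 ≤ L) {t₁ : Set.Icc (0 : ℝ) T}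
    {x₁ : PathSp T H} (h1T : (t₁ : ℝ) < T) {un : ℕ → TimePath T H → ℝ}
    {Fn : ℕ → TimePath T H × H → ℝ} {F : TimePath T H × H → ℝ} (hFc : Continuous F)
    {hn : ℕ → PathSp T H → ℝ} {h : PathSp T H → ℝ}
    (hsuper : ∀ n, IsViscositySuper ι p q A L (Fn n) (hn n) (un n))
    (hF : ∀ P ∈ tube ι p q A L t₁ x₁, ∀ v : H,
      ((F (P, v) : ℝ) : EReal) ≤ lowerRelaxed (tube ι p q A L t₁ x₁ ×ˢ Set.univ) Fn (P, v))
    (hh : ∀ x ∈ trajectories ι p q A L t₁ x₁,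
      ((h x : ℝ) : EReal) ≤ lowerRelaxed (trajectories ι p q A L t₁ x₁) hn x)
    {C : ℝ} (hC : ∀ n, ∀ P ∈ tube ι p q A L t₁ x₁, |un n P| ≤ C) :
    ∃ w : TimePath T H → ℝ, (∀ P ∈ tube ι p q A L t₁ x₁,
      ((w P : ℝ) : EReal) = lowerRelaxed (tube ι p q A L t₁ x₁) un P) ∧
      IsViscositySuperOn ι p q A L F h t₁ x₁ w := by
  obtain ⟨w, hw, hsol⟩ := exists_isViscositySubOn_upperRelaxed hι hA hp hpq hL h1T
    (F := reflect F) (hFc.comp (continuous_fst.prodMk continuous_snd.neg)).neg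
    (h := fun x => -h x) (fun n => (hsuper n).neg hι.injective)
    (fun P hP v => by
      rw [upperRelaxed_reflect, reflect, EReal.coe_neg, EReal.neg_le_neg_iff]
      exact hF P hP (-v))
    (fun x hx => by
      rw [upperRelaxed_neg, EReal.coe_neg, EReal.neg_le_neg_iff]
      exact hh x hx)
    (C := C) (fun n P hP => by rw [abs_neg]; exact hC n P hP)
  refine ⟨fun P => -w P, fun P hP => ?_, ?_⟩
  · rw [EReal.coe_neg, hw P hP, upperRelaxed_neg, neg_neg]
  · simpa only [reflect_reflect, neg_neg] using hsol.neg hι.injective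

end Reflection

end PathHJ

end

theorem theorem6p2
    {V H : Type*} [NormedAddCommGroup V] [NormedSpace ℝ V] [CompleteSpace V]
    [TopologicalSpace.SeparableSpace V]
    [NormedAddCommGroup H] [InnerProductSpace ℝ H] [CompleteSpace H]
    [TopologicalSpace.SeparableSpace H]
    (ι : V →L[ℝ] H) (hι : PathHJ.IsGelfandTriple ι)
    (T : ℝ) [Fact (0 < T)] (p q : ℝ) (hp : 2 ≤ p) (hpq : p.HolderConjugate q)
    (A : ℝ → V → StrongDual ℝ V) (hA : PathHJ.HypA T p q A)
    (L : ℝ) (hL : 0 ≤ L)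
    (Fn : ℕ → PathHJ.TimePath T H × H → ℝ) (hFn : ∀ n, Continuous (Fn n))
    (hn : ℕ → PathHJ.PathSp T H → ℝ)
    (un : ℕ → PathHJ.TimePath T H → ℝ)
    (hbound : ∀ (t₁ : Set.Icc (0 : ℝ) T) (x₁ : PathHJ.PathSp T H), (t₁ : ℝ) < T →
      ∃ C : ℝ, ∀ n, ∀ P ∈ PathHJ.tube ι p q A L t₁ x₁, |un n P| ≤ C)
    (F : PathHJ.TimePath T H × H → ℝ) (hF : Continuous F)
    (h : PathHJ.PathSp T H → ℝ) (hh : Continuous h) :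
    ((∀ n, PathHJ.IsViscositySub ι p q A L (Fn n) (hn n) (un n)) →
      (∀ (t₁ : Set.Icc (0 : ℝ) T) (x₁ : PathHJ.PathSp T H), (t₁ : ℝ) < T →
        ∀ P ∈ PathHJ.tube ι p q A L t₁ x₁, ∀ z : H,
          PathHJ.upperRelaxed (PathHJ.tube ι p q A L t₁ x₁ ×ˢ Set.univ) Fn (P, z)
            ≤ ((F (P, z) : ℝ) : EReal)) →
      (∀ (t₁ : Set.Icc (0 : ℝ) T) (x₁ : PathHJ.PathSp T H), (t₁ : ℝ) < T →
        ∀ x ∈ PathHJ.trajectories ι p q A L t₁ x₁,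
          PathHJ.upperRelaxed (PathHJ.trajectories ι p q A L t₁ x₁) hn x
            ≤ ((h x : ℝ) : EReal)) →
      ∀ (t₁ : Set.Icc (0 : ℝ) T) (x₁ : PathHJ.PathSp T H), (t₁ : ℝ) < T →
        ∃ w : PathHJ.TimePath T H → ℝ,
          (∀ P ∈ PathHJ.tube ι p q A L t₁ x₁,
            ((w P : ℝ) : EReal) = PathHJ.upperRelaxed (PathHJ.tube ι p q A L t₁ x₁) un P) ∧
          PathHJ.IsViscositySubOn ι p q A L F h t₁ x₁ w)
    ∧
    ((∀ n, PathHJ.IsViscositySuper ι p q A L (Fn n) (hn n) (un n)) →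
      (∀ (t₁ : Set.Icc (0 : ℝ) T) (x₁ : PathHJ.PathSp T H), (t₁ : ℝ) < T →
        ∀ P ∈ PathHJ.tube ι p q A L t₁ x₁, ∀ z : H,
          ((F (P, z) : ℝ) : EReal)
            ≤ PathHJ.lowerRelaxed (PathHJ.tube ι p q A L t₁ x₁ ×ˢ Set.univ) Fn (P, z)) →
      (∀ (t₁ : Set.Icc (0 : ℝ) T) (x₁ : PathHJ.PathSp T H), (t₁ : ℝ) < T →
        ∀ x ∈ PathHJ.trajectories ι p q A L t₁ x₁,
          ((h x : ℝ) : EReal)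
            ≤ PathHJ.lowerRelaxed (PathHJ.trajectories ι p q A L t₁ x₁) hn x) →
      ∀ (t₁ : Set.Icc (0 : ℝ) T) (x₁ : PathHJ.PathSp T H), (t₁ : ℝ) < T →
        ∃ w : PathHJ.TimePath T H → ℝ,
          (∀ P ∈ PathHJ.tube ι p q A L t₁ x₁,
            ((w P : ℝ) : EReal) = PathHJ.lowerRelaxed (PathHJ.tube ι p q A L t₁ x₁) un P) ∧
          PathHJ.IsViscositySuperOn ι p q A L F h t₁ x₁ w) := by
  -- Separability of V* is assumed as an instance in most of the lemmas; reflexivity and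
  -- separability of V provide it.
  have := PathHJ.separableSpace_dual_of_reflexive hι.reflexive
  refine ⟨fun hsub hF' hh' t₁ x₁ h1T => ?_, fun hsuper hF' hh' t₁ x₁ h1T => ?_⟩
  · obtain ⟨C, hC⟩ := hbound t₁ x₁ h1T
    exact PathHJ.exists_isViscositySubOn_upperRelaxed hι hA hp hpq hL h1T hF hsub
      (hF' t₁ x₁ h1T) (hh' t₁ x₁ h1T) hC
  · obtain ⟨C, hC⟩ := hbound t₁ x₁ h1T
    exact PathHJ.exists_isViscositySuperOn_lowerRelaxed hι hA hp hpq hL h1T hF hsuper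
      (hF' t₁ x₁ h1T) (hh' t₁ x₁ h1T) hC
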